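/- A Beurling system is a commutative monoid $G$ that is freely generated by a countable set $P$ of primes, together with a multiplicative norm $|\cdot|:G\to(0,\infty)$ such that $N(x):=\#\{g\in G:|g|\le x\}$ is finite for every real $x$. It satisfies Axiom A with constants $A$, $\kappa>0$, $0<\theta<1$ if $|N(x)-\kappa(x-1)|\le A x^{\theta}$ for all $x\ge 1$. Its zeta function $\zeta$ is $\sum_{g\in G}|g|^{-s}$ for $\Re s>1$, continued analytically to $\{\Re s>\theta\}\setminus\{1\}$. Put $\Lambda(g)=\log|p|$ if $g=p^k$ with $p\in P$ and $k\ge1$, $\Lambda(g)=0$ otherwise, $\psi(x)=\sum_{|g|\le x}\Lambda(g)$ and $\Delta(x)=\psi(x)-x$. Let $G$ be a Beurling system satisfying Axiom A with constants $A,\kappa,\theta$, and let $\rho_0=\beta_0+i\gamma_0$ be a zero of its zeta function with $\beta_0>\theta$. (a) For every $\varepsilon>0$ there are arbitrarily large $x$ with $|\Delta(x)|\ge(1-\varepsilon)\,x^{\beta_0}/|\rho_0|$; moreover, if $\gamma_0\ne0$, there are arbitrarily large $x$ with $|\Delta(x)|\ge(\pi/2-\varepsilon)\,x^{\beta_0}/|\rho_0|$.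 (b) There are constants $A_9,A_{10}$, depending only on $A,\kappa,\theta$ (and neither on the system nor on the zero), such that the following holds if $\gamma_0>0$. For every $0<\varepsilon<0.1$ and every $Y>0$ with $$\log Y>\max\left\{\frac{5\log\frac1{\beta_0-\theta}}{\beta_0-\theta},\ \frac{\log(8/\varepsilon)}{\beta_0-\theta},\ \frac{40}{\varepsilon^2\gamma_0^4},\ \log|\rho_0|,\ A_9\right\}$$ there is an $x$ in the interval $$\left[\,Y,\;Y^{A_{10}\frac{\log(\gamma_0+5)}{(\beta_0-\theta)^2}}\right]$$ with $|\Delta(x)|>(\pi/2-\varepsilon)\,x^{\beta_0}/|\rho_0|$. -/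

import Mathlib

universe u

/-- A Beurling system (arithmetical semigroup): a commutative monoid `G` freely generated by a
countable set of primes, with a positive multiplicative norm for which only finitely many elements
have norm at most any given bound. -/
structure BeurlingSystem (G : Type u) [CommMonoid G] where
  /-- the primes of `G` -/
  primes : Set G
  countable_primes : primes.Countable
  /-- every element is, up to order, a product of primes in exactly one way -/
  free : Function.Bijective
    (fun s : Multiset primes => (s.map (fun p : primes => (p : G))).prod)
  /-- the norm `|g|` -/
  norm : G →* ℝ
  norm_pos : ∀ g, 0 < norm g
  finite_norm_le : ∀ x : ℝ, {g : G | norm g ≤ x}.Finite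

namespace BeurlingSystem

variable {G : Type u} [CommMonoid G]

/-- The counting function `N(x) = #{g ∈ G : |g| ≤ x}`. -/
noncomputable def count (B : BeurlingSystem G) (x : ℝ) : ℕ :=
  (B.finite_norm_le x).toFinset.card

/-- Axiom A with parameters `A, κ, θ`: `|N(x) - κ (x - 1)| ≤ A x ^ θ` for all `x ≥ 1`. -/
def AxiomA (B : BeurlingSystem G) (A κ θ : ℝ) : Prop :=
  0 < κ ∧ 0 < θ ∧ θ < 1 ∧
    ∀ x : ℝ, 1 ≤ x → |(B.count x : ℝ) - κ * (x - 1)| ≤ A * x ^ θ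

/-- `Z` is the Beurling zeta function on `Re s > θ`: it is holomorphic there except possibly at
`s = 1`, and it is given by the Dirichlet series `∑ |g|^(-s)` on `Re s > 1`. Since the domain is
connected, there is at most one such function on it. -/
def IsZetaFunction (B : BeurlingSystem G) (θ : ℝ) (Z : ℂ → ℂ) : Prop :=
  DifferentiableOn ℂ Z {s : ℂ | θ < s.re ∧ s ≠ 1} ∧
    ∀ s : ℂ, 1 < s.re → Z s = ∑' g : G, (B.norm g : ℂ) ^ (-s)

/-- `ρ` is a zero, with real part larger than `θ`, of the Beurling zeta function. The point `1` is
excluded, because the value of `Z` there is irrelevant (the zeta function has a pole at `1`). -/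
def IsZetaZero (B : BeurlingSystem G) (θ : ℝ) (ρ : ℂ) : Prop :=
  θ < ρ.re ∧ ρ ≠ 1 ∧ ∃ Z : ℂ → ℂ, B.IsZetaFunction θ Z ∧ Z ρ = 0

open Classical in
/-- The von Mangoldt function: `log |p|` if `g = p ^ k` with `p` prime and `k ≥ 1`, else `0`. -/
noncomputable def vonMangoldt (B : BeurlingSystem G) (g : G) : ℝ :=
  if h : ∃ p ∈ B.primes, ∃ k : ℕ, 1 ≤ k ∧ g = p ^ k then Real.log (B.norm h.choose) else 0

/-- `ψ(x) = ∑_{|g| ≤ x} Λ(g)`. -/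
noncomputable def psi (B : BeurlingSystem G) (x : ℝ) : ℝ :=
  ∑ g ∈ (B.finite_norm_le x).toFinset, B.vonMangoldt g

/-- `Δ(x) = ψ(x) - x`. -/
noncomputable def Delta (B : BeurlingSystem G) (x : ℝ) : ℝ := B.psi x - x

end BeurlingSystem

/-! Put d = β₀ - θ and y = log Y. By Axiom A, (s-1)ζ(s) = κ + s(s-1)∫_1^∞ (N(x) - κ(x-1)) x^(-s-1)
dx for Re s > θ (`zetaReg`), and -ζ'/ζ = ∑ Λ(g)|g|^(-s) for Re s > 1.

For the quantitative part, Δ(e^u) is integrated against e^(-ρ₀u)(ρ₀K - K'), the negative derivative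
of e^(-ρ₀u)K, where K is carried by [14yν, 22yν] and has Laplace transform Φ^ν with Φ(0) = 1
(`exists_oscKernels`). By `explicit_formula` the integral is -∑ Φ(ρ-ρ₀)^ν over finitely many
split-off zeros, plus a line integral of g'/g, where g is the cofactor left after splitting. Since
|Φ(z)| ≤ e^(14y Re z) for Re z ≤ 0 and Φ is tiny at heights beyond e^60, moving the line to d/2 left
of ρ₀ leaves an error e^(-7dy) times a polynomial in y/d. Only zeros in a box of bounded height
around ρ₀ survive (`norm_integral_add_sum_le`). Their number n is O(log(γ₀+5)/d²)
(`exists_card_rect_le`), and ρ₀ contributes the summand 1. Cassels' theorem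
`exists_one_le_re_powerSum` supplies ν ≤ 2n-1 for which the sum has real part at least 1. This range
of ν is what determines the length of the interval for x.

Suppose |Δ(x)| ≤ (π/2-ε)x^β₀/|ρ₀| on the whole interval. After multiplication by a unimodular
constant c the integral is real, and it is bounded by (π/2-ε)/|ρ₀| times ∫ |Re(c
e^(-iγ₀u)(ρ₀K-K'))|. The kernel contains a uniform average over one period of |cos γ₀t|, which
produces the factor 2/π, and a bump q of width y, for which ∫|ρ₀q-q'| exceeds |ρ₀| only by
O(1/(y²|ρ₀|)). Hence the integral is at most 1-ε/2 (`osc_constant_le`), whereas the power sum forces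
at least 1-ε/8.

For the constant 1-ε in (a), a bound |Δ(x)| ≤ m x^β₀ for large x continues ζ'/ζ to Re s > β₀ through
the Mellin transform of Δ, with size at most (|ρ₀|m + o(1))/η at ρ₀+η. A zero of order k+1 makes it
(k+1+o(1))/η, so |ρ₀|m ≥ 1. The constant π/2-ε in (a) follows from (b), after conjugation if γ₀ < 0.
-/

section PowerSums

/-! ### Power sums: Newton's identities and Cassels' theorem. -/

open Finset in
/-- Newton's identities force a sign: the first `card σ + 1` power sums of finitely many complex
numbers cannot all be negative reals. -/
theorem not_forall_psum_neg {σ : Type*} [Fintype σ] (w : σ → ℂ)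
    (h : ∀ k, 1 ≤ k → k ≤ Fintype.card σ + 1 →
      ∃ p : ℝ, p < 0 ∧ ∑ i, w i ^ k = (p : ℂ)) : False := by
  set e : ℕ → ℂ := fun k => MvPolynomial.aeval w (MvPolynomial.esymm σ ℂ k) with he
  have newton : ∀ k : ℕ, (k : ℂ) * e k = (-1) ^ (k + 1) *
      ∑ a ∈ antidiagonal k with a.1 < k, (-1) ^ a.1 * e a.1 * ∑ i, w i ^ a.2 := by
    intro k
    have := congrArg (MvPolynomial.aeval w) (MvPolynomial.mul_esymm_eq_sum σ ℂ k)
    simpa [he, MvPolynomial.psum] using this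
  -- Newton's identity multiplied by (-1)^k reads k(-1)^k e_k = -∑_{a<k} (-1)^a e_a p_{k-a}.
  -- Negative power sums therefore propagate positivity of (-1)^k e_k from k = 0 up to n+1, where
  -- e_{n+1} = 0 gives the contradiction.
  have pos : ∀ k, k ≤ Fintype.card σ + 1 → ∃ a : ℝ, 0 < a ∧ (-1) ^ k * e k = (a : ℂ) := by
    intro k
    induction k using Nat.strong_induction_on with
    | _ k ih =>
      intro hk
      rcases Nat.eq_zero_or_pos k with rfl | hk0
      · exact ⟨1, one_pos, by simp [he]⟩
      have hterm : ∀ a ∈ (antidiagonal k).filter (fun a => a.1 < k),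
          ∃ q : ℝ, q < 0 ∧ (-1) ^ a.1 * e a.1 * ∑ i, w i ^ a.2 = (q : ℂ) := by
        intro a ha
        rw [mem_filter, HasAntidiagonal.mem_antidiagonal] at ha
        obtain ⟨x, hx, hxe⟩ := ih a.1 ha.2 (by omega)
        obtain ⟨p, hp, hpe⟩ := h a.2 (by omega) (by omega)
        exact ⟨x * p, mul_neg_of_pos_of_neg hx hp, by rw [hxe, hpe]; push_cast; ring⟩
      choose! q hq hqe using hterm
      have hsum : ∑ a ∈ antidiagonal k with a.1 < k, q a < 0 := by
        apply sum_neg hq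
        exact ⟨(0, k), by simp [hk0]⟩
      refine ⟨-(∑ a ∈ antidiagonal k with a.1 < k, q a) / k, by
        apply div_pos (by linarith) (by exact_mod_cast hk0), ?_⟩
      have hkc : (k : ℂ) ≠ 0 := by exact_mod_cast hk0.ne'
      have := newton k
      rw [sum_congr rfl hqe] at this
      push_cast
      rw [eq_div_iff hkc]
      calc (-1) ^ k * e k * k = (-1) ^ k * (k * e k) := by ring
        _ = _ := by
          rw [this, pow_succ]
          have h1 : ((-1 : ℂ) ^ k) * (-1) ^ k = 1 := by rw [← mul_pow]; simp
          linear_combination (-(∑ a ∈ antidiagonal k with a.1 < k, (q a : ℂ))) * h1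
  obtain ⟨a, ha, hae⟩ := pos (Fintype.card σ + 1) le_rfl
  have : e (Fintype.card σ + 1) = 0 := by
    have : powersetCard (Fintype.card σ + 1) (univ : Finset σ) = ∅ :=
      powersetCard_eq_empty.2 (by simp)
    simp [he, MvPolynomial.esymm, this]
  rw [this, mul_zero] at hae
  exact ha.ne (by exact_mod_cast hae)

/-- **Cassels' theorem on pure power sums**, in the one-sided form. -/
theorem exists_one_le_re_powerSum (S : Multiset ℂ) (h1 : (1 : ℂ) ∈ S) :
    ∃ ν : ℕ, 1 ≤ ν ∧ ν ≤ 2 * Multiset.card S - 1 ∧ 1 ≤ ((S.map (· ^ ν)).sum).re := by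
  obtain ⟨S', rfl⟩ := Multiset.exists_cons_of_mem h1
  by_contra! hcon
  induction S' using Quotient.inductionOn with | _ l
  -- Adjoining the conjugates makes every power sum real, equal to twice the real part. For n
  -- numbers including 1, this leaves 2(n-1) numbers, so 2n-1 exponents are needed.
  refine not_forall_psum_neg (σ := Fin l.length ⊕ Fin l.length)
    (Sum.elim (fun i => l.get i) (fun i => (starRingEnd ℂ) (l.get i))) ?_
  intro k hk hkn
  have := hcon k hk (by simp at hkn ⊢; omega)
  have hsum : ∑ i, l.get i ^ k = (l.map (· ^ k)).sum := by
    rw [← List.sum_ofFn]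
    congr 1
    apply List.ext_get <;> simp
  refine ⟨2 * ((l.map (· ^ k)).sum).re, ?_, ?_⟩
  · have h2 : (Multiset.map (· ^ k) (1 ::ₘ (Quotient.mk _ l : Multiset ℂ))).sum
        = 1 + (l.map (· ^ k)).sum := by simp
    rw [h2] at this
    simp at this
    linarith
  · rw [Fintype.sum_sum_type]
    simp only [Sum.elim_inl, Sum.elim_inr, ← map_pow, ← map_sum]
    rw [hsum, Complex.add_conj]

end PowerSums

/-! ### Zeros of holomorphic functions in discs: Jensen, factorization, logarithmic derivatives. -/

section ComplexAnalysis

open Metric Set Complex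

/-- The product `∏ (z - ρ)` over a multiset of points. -/
noncomputable def rootProd (S : Multiset ℂ) (z : ℂ) : ℂ := (S.map (fun ρ => z - ρ)).prod

@[simp] theorem rootProd_zero (z : ℂ) : rootProd 0 z = 1 := by simp [rootProd]

@[simp] theorem rootProd_cons (ρ : ℂ) (S : Multiset ℂ) (z : ℂ) :
    rootProd (ρ ::ₘ S) z = (z - ρ) * rootProd S z := by simp [rootProd]

theorem rootProd_add (S T : Multiset ℂ) (z : ℂ) :
    rootProd (S + T) z = rootProd S z * rootProd T z := by simp [rootProd]

theorem differentiable_rootProd (S : Multiset ℂ) : Differentiable ℂ (rootProd S) := by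
  induction S using Multiset.induction_on with
  | empty => simp [funext rootProd_zero]
  | cons ρ S ih =>
    have : rootProd (ρ ::ₘ S) = fun z => (z - ρ) * rootProd S z := funext (rootProd_cons ρ S)
    rw [this]
    fun_prop

theorem rootProd_eq_zero_iff {S : Multiset ℂ} {z : ℂ} : rootProd S z = 0 ↔ z ∈ S := by
  simp [rootProd, Multiset.prod_eq_zero_iff, sub_eq_zero]

/-- The logarithmic derivative of a product of linear factors. -/
theorem deriv_rootProd_div (S : Multiset ℂ) {z : ℂ} (hz : z ∉ S) :
    deriv (rootProd S) z / rootProd S z = (S.map (fun ρ => 1 / (z - ρ))).sum := by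
  induction S using Multiset.induction_on with
  | empty => simp [funext rootProd_zero]
  | cons ρ S ih =>
    have hρ : z - ρ ≠ 0 := fun h => hz (by simp [sub_eq_zero.1 h])
    have hS : z ∉ S := fun h => hz (Multiset.mem_cons_of_mem h)
    have h0 : rootProd S z ≠ 0 := fun h => hS (rootProd_eq_zero_iff.1 h)
    have hfun : rootProd (ρ ::ₘ S) = fun z => (z - ρ) * rootProd S z := funext (rootProd_cons ρ S)
    have hd : deriv (rootProd (ρ ::ₘ S)) z
        = rootProd S z + (z - ρ) * deriv (rootProd S) z := by
      rw [hfun]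
      have h1 : HasDerivAt (fun z : ℂ => z - ρ) 1 z := (hasDerivAt_id z).sub_const ρ
      have h2 := (differentiable_rootProd S z).hasDerivAt
      have := (h1.mul h2).deriv
      simpa [Pi.mul_def] using this
    rw [hd, rootProd_cons, Multiset.map_cons, Multiset.sum_cons, ← ih hS]
    field_simp

theorem norm_rootProd_le {S : Multiset ℂ} {z : ℂ} {r : ℝ} (h : ∀ ρ ∈ S, ‖z - ρ‖ ≤ r) :
    ‖rootProd S z‖ ≤ r ^ Multiset.card S := by
  induction S using Multiset.induction_on with
  | empty => simp
  | cons ρ S ih =>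
    have h1 := h ρ (by simp)
    have h2 := ih (fun ρ' h' => h ρ' (by simp [h']))
    rw [rootProd_cons, norm_mul, Multiset.card_cons, pow_succ, mul_comm]
    exact mul_le_mul h2 h1 (norm_nonneg _) ((norm_nonneg _).trans h2)

theorem le_norm_rootProd {S : Multiset ℂ} {z : ℂ} {r : ℝ} (hr : 0 ≤ r)
    (h : ∀ ρ ∈ S, r ≤ ‖z - ρ‖) :
    r ^ Multiset.card S ≤ ‖rootProd S z‖ := by
  induction S using Multiset.induction_on with
  | empty => simp
  | cons ρ S ih =>
    have h1 := h ρ (by simp)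
    have h2 := ih (fun ρ' h' => h ρ' (by simp [h']))
    rw [rootProd_cons, norm_mul, Multiset.card_cons, pow_succ, mul_comm]
    gcongr

/-- The product of the numerators `(R² - conj(ρ - c) (z - c)) / R` of Blaschke factors. -/
noncomputable def blaschkeProd (c : ℂ) (R : ℝ) (S : Multiset ℂ) (z : ℂ) : ℂ :=
  (S.map (fun ρ => ((R : ℂ) ^ 2 - (starRingEnd ℂ) (ρ - c) * (z - c)) / R)).prod

theorem blaschkeProd_cons (c : ℂ) (R : ℝ) (ρ : ℂ) (S : Multiset ℂ) (z : ℂ) :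
    blaschkeProd c R (ρ ::ₘ S) z =
      ((R : ℂ) ^ 2 - (starRingEnd ℂ) (ρ - c) * (z - c)) / R * blaschkeProd c R S z := by
  simp [blaschkeProd]

theorem differentiable_blaschkeProd (c : ℂ) (R : ℝ) (S : Multiset ℂ) :
    Differentiable ℂ (blaschkeProd c R S) := by
  induction S using Multiset.induction_on with
  | empty => exact differentiable_const 1
  | cons ρ S ih =>
    rw [funext (blaschkeProd_cons c R ρ S)]
    fun_prop

/-- On the circle R² = (z-c)·conj(z-c), so each numerator becomes (z-c)·conj(z-ρ), of modulus
R|z-ρ|. -/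
theorem norm_blaschkeProd_of_mem_sphere {c : ℂ} {R : ℝ} (hR : 0 < R) (S : Multiset ℂ) {z : ℂ}
    (hz : z ∈ sphere c R) : ‖blaschkeProd c R S z‖ = ‖rootProd S z‖ := by
  induction S using Multiset.induction_on with
  | empty => simp [blaschkeProd]
  | cons ρ S ih =>
    rw [blaschkeProd_cons, rootProd_cons, norm_mul, norm_mul, ih]
    congr 1
    have hz' : ‖z - c‖ = R := by simpa [dist_eq] using hz
    have h1 : (R : ℂ) ^ 2 = (z - c) * (starRingEnd ℂ) (z - c) := by
      rw [mul_conj, normSq_eq_norm_sq, hz']; push_cast; rfl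
    have h2 : (R : ℂ) ^ 2 - (starRingEnd ℂ) (ρ - c) * (z - c)
        = (z - c) * (starRingEnd ℂ) (z - ρ) := by
      rw [h1]; simp only [map_sub]; ring
    rw [h2, norm_div, norm_mul, RCLike.norm_conj, hz', norm_real, Real.norm_of_nonneg hR.le]
    field_simp

theorem blaschkeProd_center {c : ℂ} {R : ℝ} (hR : 0 < R) (S : Multiset ℂ) :
    blaschkeProd c R S c = (R : ℂ) ^ Multiset.card S := by
  induction S using Multiset.induction_on with
  | empty => simp [blaschkeProd]
  | cons ρ S ih =>
    have : (R : ℂ) ≠ 0 := by exact_mod_cast hR.ne'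
    rw [blaschkeProd_cons, ih, Multiset.card_cons]
    simp only [sub_self, mul_zero, sub_zero]
    field_simp
    rw [pow_succ']

/-- Jensen's inequality, in the form needed to count zeros. -/
theorem pow_card_mul_norm_le {c : ℂ} {R B : ℝ} (hR : 0 < R) {g : ℂ → ℂ} {S : Multiset ℂ}
    (hg : DifferentiableOn ℂ g (closedBall c R))
    (hB : ∀ z ∈ sphere c R, ‖rootProd S z * g z‖ ≤ B) :
    R ^ Multiset.card S * ‖g c‖ ≤ B := by
  -- Replacing root factors by Blaschke numerators keeps the modulus on the circle but makes the
  -- value at the centre R^n g(c). The maximum principle then gives the inequality.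
  have hd : DiffContOnCl ℂ (fun z => blaschkeProd c R S z * g z) (ball c R) := by
    apply DifferentiableOn.diffContOnCl
    rw [closure_ball c hR.ne']
    exact (differentiable_blaschkeProd c R S).differentiableOn.mul hg
  have := norm_le_of_forall_mem_frontier_norm_le isBounded_ball hd (C := B) (fun z hz => by
    rw [frontier_ball c hR.ne'] at hz
    have := hB z hz
    rwa [norm_mul, ← norm_blaschkeProd_of_mem_sphere hR S hz, ← norm_mul] at this)
    (subset_closure (mem_ball_self hR))
  rw [norm_mul, blaschkeProd_center hR, norm_pow, norm_real, Real.norm_of_nonneg hR.le] at this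
  exact this

/-- The number of zeros in a smaller disc is controlled by the growth on a larger one. -/
theorem card_mul_log_le {c : ℂ} {r R B : ℝ} (hr : 0 < r) (hR : r < R) {F g : ℂ → ℂ}
    {S : Multiset ℂ} (hg : DifferentiableOn ℂ g (closedBall c R))
    (hF : ∀ z ∈ closedBall c R, F z = rootProd S z * g z) (hFc : F c ≠ 0)
    (hS : ∀ ρ ∈ S, ρ ∈ closedBall c r) (hB : ∀ z ∈ sphere c R, ‖F z‖ ≤ B) :
    Multiset.card S * Real.log (R / r) ≤ Real.log (B / ‖F c‖) := by
  have hR0 : 0 < R := hr.trans hR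
  have h1 := pow_card_mul_norm_le (c := c) (B := B) hR0 (S := S) hg
    (fun z hz => by rw [← hF z (sphere_subset_closedBall hz)]; exact hB z hz)
  have h2 : ‖F c‖ ≤ r ^ Multiset.card S * ‖g c‖ := by
    rw [hF c (mem_closedBall_self hR0.le), norm_mul]
    gcongr
    exact norm_rootProd_le (fun ρ hρ => by
      have := hS ρ hρ; rwa [mem_closedBall, dist_comm, dist_eq] at this)
  have hFp : 0 < ‖F c‖ := norm_pos_iff.2 hFc
  rw [← Real.log_pow]
  apply Real.log_le_log (by positivity)
  rw [div_pow, div_le_div_iff₀ (by positivity) hFp]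
  calc R ^ Multiset.card S * ‖F c‖ ≤ R ^ Multiset.card S * (r ^ Multiset.card S * ‖g c‖) := by gcongr
    _ = R ^ Multiset.card S * ‖g c‖ * r ^ Multiset.card S := by ring
    _ ≤ B * r ^ Multiset.card S := by gcongr

/-- Splitting off all zeros in a disc. -/
theorem exists_eq_rootProd_mul {U : Set ℂ} (hU : IsOpen U) {F : ℂ → ℂ}
    (hF : DifferentiableOn ℂ F U) {c : ℂ} {r R : ℝ} (hr : 0 < r) (hR : r < R)
    (hRU : closedBall c R ⊆ U) (hFc : F c ≠ 0) :
    ∃ (S : Multiset ℂ) (g : ℂ → ℂ), DifferentiableOn ℂ g U ∧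
      (∀ z ∈ U, F z = rootProd S z * g z) ∧ (∀ z ∈ closedBall c r, g z ≠ 0) ∧
      ∀ ρ ∈ S, ρ ∈ closedBall c r := by
  obtain ⟨B, hB⟩ := (isCompact_closedBall c R).exists_bound_of_continuousOn
    (hF.continuousOn.mono hRU)
  let P : ℕ → Prop := fun n => ∃ (S : Multiset ℂ) (g : ℂ → ℂ), Multiset.card S = n ∧
    DifferentiableOn ℂ g U ∧ (∀ z ∈ U, F z = rootProd S z * g z) ∧
    ∀ ρ ∈ S, ρ ∈ closedBall c r
  have hP0 : P 0 := ⟨0, F, by simp, hF, by simp, by simp⟩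
  have hlog : 0 < Real.log (R / r) := Real.log_pos ((one_lt_div hr).2 hR)
  have hbound : ∀ n, P n → n ≤ ⌊Real.log (B / ‖F c‖) / Real.log (R / r)⌋₊ := by
    rintro n ⟨S, g, rfl, hg, hFg, hS⟩
    apply Nat.le_floor
    rw [le_div_iff₀ hlog]
    exact card_mul_log_le hr hR (hg.mono hRU) (fun z hz => hFg z (hRU hz)) hFc hS
      (fun z hz => hB z (sphere_subset_closedBall hz))
  classical
  -- Jensen's bound caps the number of roots that can be split off, so a maximal choice exists. A
  -- remaining zero of the cofactor could be divided out by `dslope`, contradicting maximality.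
  obtain ⟨n, hn, hmax⟩ : ∃ n, P n ∧ ∀ m, P m → m ≤ n :=
    ⟨Nat.findGreatest P _, Nat.findGreatest_spec (hbound 0 hP0) hP0,
      fun m hm => Nat.le_findGreatest (hbound m hm) hm⟩
  obtain ⟨S, g, hSn, hg, hFg, hS⟩ := hn
  refine ⟨S, g, hg, hFg, fun z hz hgz => ?_, hS⟩
  have hzU : z ∈ U := hRU (closedBall_subset_closedBall hR.le hz)
  have hP : P (n + 1) := by
    refine ⟨z ::ₘ S, dslope g z, by simp [hSn], ?_, fun w hw => ?_, fun ρ hρ => ?_⟩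
    · exact (differentiableOn_dslope (hU.mem_nhds hzU)).2 hg
    · rw [hFg w hw, rootProd_cons]
      have := sub_smul_dslope g z w
      rw [hgz, sub_zero, smul_eq_mul] at this
      rw [← this]; ring
    · rcases Multiset.mem_cons.1 hρ with rfl | h
      exacts [hz, hS ρ h]
  exact absurd (hmax _ hP) (by omega)

/-- A zero-free function of moderate growth has moderate logarithmic derivative. -/
theorem norm_deriv_div_le {c : ℂ} {r R M : ℝ} (hr : 0 ≤ r) (hR : r < R) (hM : 0 < M) {g : ℂ → ℂ}
    (hg : DifferentiableOn ℂ g (ball c R)) (h0 : ∀ z ∈ ball c R, g z ≠ 0)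
    (hgM : ∀ z ∈ ball c R, ‖g z‖ ≤ Real.exp M * ‖g c‖) {z : ℂ} (hz : z ∈ closedBall c r) :
    ‖deriv g z / g z‖ ≤ 8 * M * R / (R - r) ^ 2 := by
  have hR0 : 0 < R := hr.trans_lt hR
  have hcb : c ∈ ball c R := mem_ball_self hR0
  have hq : DifferentiableOn ℂ (fun z => deriv g z / g z) (ball c R) :=
    (hg.deriv isOpen_ball).div hg h0
  obtain ⟨f, hf⟩ := hq.isExactOn_ball.with_val_at c 0
  obtain ⟨hfc, hf⟩ := hf
  -- A primitive f of g'/g with f(c) = 0 serves as a logarithm, because g·e^(-f) has derivative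
  -- zero.
  have hexp : ∀ w ∈ ball c R, g w = g c * exp (f w) := by
    have hconst : ∀ w ∈ ball c R, HasDerivAt (fun w => g w * exp (-f w)) 0 w := by
      intro w hw
      have h1 := (hg.differentiableAt (isOpen_ball.mem_nhds hw)).hasDerivAt
      have h2 := (hf w hw).neg.cexp
      refine (h1.fun_mul h2).congr_deriv ?_
      have := h0 w hw
      have h3 : g w * (deriv g w / g w) = deriv g w := mul_div_cancel₀ _ this
      linear_combination -(exp (-f w)) * h3
    intro w hw
    have := (convex_ball c R).is_const_of_fderivWithin_eq_zero (𝕜 := ℂ)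
      (f := fun w => g w * exp (-f w))
      (fun w hw => (hconst w hw).differentiableAt.differentiableWithinAt)
      (fun w hw => by
        rw [fderivWithin_of_isOpen isOpen_ball hw]
        ext; simp [(hconst w hw).deriv]) hw hcb
    simp only [hfc, neg_zero, exp_zero, mul_one] at this
    rw [← this, mul_assoc, ← exp_add]; simp
  have hre : ∀ w ∈ ball c R, (f w).re ≤ M := by
    intro w hw
    have h1 := hgM w hw
    rw [hexp w hw, norm_mul, norm_exp, mul_comm] at h1
    have := le_of_mul_le_mul_right h1 (norm_pos_iff.2 (h0 c hcb))
    exact Real.exp_le_exp.1 this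
  -- The radius midway between r and R leaves (R-r)/2 for Borel–Carathéodory and (R-r)/2 for
  -- Cauchy's estimate, whence 8MR/(R-r)².
  have hbc : ∀ w ∈ closedBall c ((R + r) / 2), ‖f w‖ ≤ 4 * M * R / (R - r) := by
    intro w hw
    have hw' : ‖w - c‖ ≤ (R + r) / 2 := by simpa [dist_eq] using hw
    have h3 := borelCaratheodory_zero (f := fun u => f (c + u)) (R := R) (z := w - c) hM
      (by
        intro u hu
        have : c + u ∈ ball c R := by simpa using hu
        exact ((hf _ this).differentiableAt.comp u (by fun_prop)).differentiableWithinAt)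
      (fun u hu => hre _ (by simpa using hu)) hR0 (by simp; linarith) (by simpa using hfc)
    simp only [add_sub_cancel] at h3
    refine h3.trans ?_
    rw [div_le_div_iff₀ (by linarith) (by linarith)]
    have : 2 * M * ‖w - c‖ * (R - r) ≤ 2 * M * R * (R - r) := by
      gcongr
      linarith
    nlinarith [mul_pos hM hR0]
  have hz' : ‖z - c‖ ≤ r := by simpa [dist_eq] using hz
  have hzb : z ∈ ball c R := by rw [mem_ball, dist_eq]; linarith
  rw [← (hf z hzb).deriv]
  have hsub : closedBall z ((R - r) / 2) ⊆ closedBall c ((R + r) / 2) := by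
    apply closedBall_subset_closedBall'
    rw [dist_eq]; linarith
  have h4 := norm_deriv_le_of_forall_mem_sphere_norm_le (c := z) (R := (R - r) / 2) (f := f)
    (C := 4 * M * R / (R - r)) (by linarith) ?_
    (fun w hw => hbc w (hsub (sphere_subset_closedBall hw)))
  · refine h4.trans (le_of_eq ?_)
    have : R - r ≠ 0 := by linarith
    field_simp
    ring
  · apply DifferentiableOn.diffContOnCl
    rw [closure_ball z (by linarith)]
    intro w hw
    have h5 := hsub hw
    rw [mem_closedBall] at h5
    exact (hf w (by rw [mem_ball]; linarith)).differentiableAt.differentiableWithinAt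

end ComplexAnalysis

/-! ### Compactly supported probability measures and their Laplace transforms. -/

section KernelMeasures

open MeasureTheory Set Complex

/-- `μ` is a probability measure carried by `[a, b]`, with two-sided Laplace transform `Ψ`. -/
structure IsKernelMeasure (μ : Measure ℝ) (a b : ℝ) (Ψ : ℂ → ℂ) : Prop where
  isProb : IsProbabilityMeasure μ
  mem_Icc : ∀ᵐ t ∂μ, t ∈ Icc a b
  laplace : ∀ z : ℂ, ∫ t, cexp (z * t) ∂μ = Ψ z

namespace IsKernelMeasure

variable {μ μ' : Measure ℝ} {a b a' b' : ℝ} {Ψ Ψ' : ℂ → ℂ}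

theorem integrable_of_continuous {E : Type*} [NormedAddCommGroup E]
    (h : IsKernelMeasure μ a b Ψ) {f : ℝ → E} (hf : Continuous f) : Integrable f μ := by
  have := h.isProb
  obtain ⟨C, hC⟩ := (isCompact_Icc (a := a) (b := b)).exists_bound_of_continuousOn hf.continuousOn
  refine Integrable.of_bound hf.aestronglyMeasurable C ?_
  filter_upwards [h.mem_Icc] with t ht using hC t ht

theorem integral_conv_eq {E : Type*} [NormedAddCommGroup E] [NormedSpace ℝ E]
    (h : IsKernelMeasure μ a b Ψ) (h' : IsKernelMeasure μ' a' b' Ψ') {f : ℝ → E}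
    (hfi : Integrable f (μ ∗ μ')) :
    ∫ t, f t ∂(μ ∗ μ') = ∫ s, ∫ t, f (s + t) ∂μ' ∂μ := by
  have := h.isProb
  have := h'.isProb
  exact integral_conv hfi

theorem ae_conv (h : IsKernelMeasure μ a b Ψ) (h' : IsKernelMeasure μ' a' b' Ψ') :
    ∀ᵐ t ∂(μ ∗ μ'), t ∈ Icc (a + a') (b + b') := by
  have := h.isProb
  have := h'.isProb
  rw [Measure.conv]
  refine (ae_map_iff (by fun_prop) measurableSet_Icc).2 ?_
  have h1 : ∀ᵐ p ∂(μ.prod μ'), p.1 ∈ Icc a b := Measure.quasiMeasurePreserving_fst.ae h.mem_Icc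
  have h2 : ∀ᵐ p ∂(μ.prod μ'), p.2 ∈ Icc a' b' := Measure.quasiMeasurePreserving_snd.ae h'.mem_Icc
  filter_upwards [h1, h2] with p hp hp'
  exact ⟨add_le_add hp.1 hp'.1, add_le_add hp.2 hp'.2⟩

theorem integrable_conv (h : IsKernelMeasure μ a b Ψ) (h' : IsKernelMeasure μ' a' b' Ψ')
    {E : Type*} [NormedAddCommGroup E] {f : ℝ → E} (hf : Continuous f) :
    Integrable f (μ ∗ μ') := by
  have := h.isProb
  have := h'.isProb
  obtain ⟨C, hC⟩ := (isCompact_Icc (a := a + a') (b := b + b')).exists_bound_of_continuousOn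
    hf.continuousOn
  refine Integrable.of_bound hf.aestronglyMeasurable C ?_
  filter_upwards [h.ae_conv h'] with t ht using hC t ht

theorem conv (h : IsKernelMeasure μ a b Ψ) (h' : IsKernelMeasure μ' a' b' Ψ') :
    IsKernelMeasure (μ ∗ μ') (a + a') (b + b') (fun z => Ψ z * Ψ' z) where
  isProb := by
    have := h.isProb
    have := h'.isProb
    infer_instance
  mem_Icc := h.ae_conv h'
  laplace z := by
    rw [h.integral_conv_eq h' (h.integrable_conv h' (by fun_prop))]
    simp only [ofReal_add, mul_add, exp_add, integral_const_mul, integral_mul_const, h.laplace,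
      h'.laplace]

theorem dirac (m : ℝ) : IsKernelMeasure (Measure.dirac m) m m (fun z => cexp (z * m)) where
  isProb := inferInstance
  mem_Icc := by simp [ae_dirac_eq]
  laplace z := by simp

theorem exists_iterate (h : IsKernelMeasure μ a b Ψ) (n : ℕ) :
    ∃ μn, IsKernelMeasure μn (n * a) (n * b) (fun z => Ψ z ^ n) := by
  induction n with
  | zero => exact ⟨Measure.dirac 0, by simpa using dirac 0⟩
  | succ n ih =>
    obtain ⟨μn, hn⟩ := ih
    refine ⟨μn ∗ μ, ?_⟩
    convert hn.conv h using 1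
    · push_cast; ring
    · push_cast; ring
    · funext z; ring

theorem apply_zero (h : IsKernelMeasure μ a b Ψ) : Ψ 0 = 1 := by
  have := h.isProb
  rw [← h.laplace]; simp

theorem norm_le (h : IsKernelMeasure μ a b Ψ) {z : ℂ} {C : ℝ}
    (hC : ∀ t ∈ Icc a b, z.re * t ≤ C) : ‖Ψ z‖ ≤ Real.exp C := by
  have := h.isProb
  rw [← h.laplace]
  have := norm_integral_le_of_norm_le_const (μ := μ) (f := fun t : ℝ => cexp (z * t))
    (C := Real.exp C) (by
      filter_upwards [h.mem_Icc] with t ht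
      rw [norm_exp]
      simpa using hC t ht)
  simpa using this

/-- Compact support makes every exponential moment finite, so the complex moment generating function
is entire. -/
theorem differentiable (h : IsKernelMeasure μ a b Ψ) : Differentiable ℂ Ψ := by
  have hΨ : Ψ = ProbabilityTheory.complexMGF id μ := by
    ext z; rw [← h.laplace]; rfl
  have huniv : ProbabilityTheory.integrableExpSet id μ = univ := by
    ext t
    simp only [mem_univ, iff_true]
    exact h.integrable_of_continuous (by fun_prop)
  rw [hΨ]
  intro z
  exact (ProbabilityTheory.hasDerivAt_complexMGF (by simp [huniv])).differentiableAt

end IsKernelMeasure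

/-- The uniform distribution on `[-h, h]`. -/
noncomputable def uniformKernel (h : ℝ) : Measure ℝ :=
  (ENNReal.ofReal (2 * h))⁻¹ • volume.restrict (Icc (-h) h)

theorem integral_uniformKernel {E : Type*} [NormedAddCommGroup E] [NormedSpace ℝ E] {h : ℝ}
    (hh : 0 < h) (f : ℝ → E) :
    ∫ t, f t ∂(uniformKernel h) = (2 * h)⁻¹ • ∫ t in (-h)..h, f t := by
  rw [uniformKernel, integral_smul_measure, intervalIntegral.integral_of_le (by linarith),
    integral_Icc_eq_integral_Ioc, ENNReal.toReal_inv, ENNReal.toReal_ofReal (by positivity)]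

theorem isKernelMeasure_uniformKernel {h : ℝ} (hh : 0 < h) :
    IsKernelMeasure (uniformKernel h) (-h) h
      (fun z => ((2 * h)⁻¹ : ℝ) • ∫ t in (-h)..h, cexp (z * t)) where
  isProb := ⟨by
    rw [uniformKernel]
    simp only [Measure.smul_apply, MeasurableSet.univ, Measure.restrict_apply, univ_inter,
      Real.volume_Icc, smul_eq_mul]
    rw [sub_neg_eq_add, ← two_mul]
    exact ENNReal.inv_mul_cancel (by simpa using hh) ENNReal.ofReal_ne_top⟩
  mem_Icc := by
    rw [uniformKernel]
    exact Measure.ae_smul_measure (ae_restrict_mem measurableSet_Icc) _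
  laplace z := integral_uniformKernel hh _

/-- Each uniform factor contributes one power of 1/|z|. With h = 1 and ⌈y⌉ factors this is the
source of the vertical decay of Φ. -/
theorem norm_uniform_laplace_le {h : ℝ} (hh : 0 < h) {z : ℂ} (hz : z ≠ 0) :
    ‖((2 * h)⁻¹ : ℝ) • ∫ t in (-h)..h, cexp (z * t)‖ ≤ Real.exp (h * |z.re|) / (h * ‖z‖) := by
  rw [integral_exp_mul_complex hz, norm_smul, norm_div]
  have h1 : ‖cexp (z * (h : ℝ)) - cexp (z * ((-h : ℝ) : ℂ))‖ ≤ 2 * Real.exp (h * |z.re|) := by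
    refine (norm_sub_le _ _).trans ?_
    rw [norm_exp, norm_exp, two_mul]
    have e1 := le_abs_self z.re
    have e2 := neg_abs_le z.re
    gcongr
    · simp; nlinarith
    · simp; nlinarith
  have hz' : 0 < ‖z‖ := norm_pos_iff.2 hz
  rw [Real.norm_of_nonneg (by positivity)]
  calc (2 * h)⁻¹ * (‖cexp (z * (h : ℝ)) - cexp (z * ((-h : ℝ) : ℂ))‖ / ‖z‖)
      ≤ (2 * h)⁻¹ * (2 * Real.exp (h * |z.re|) / ‖z‖) := by gcongr
    _ = _ := by field_simp

/-- Averages of `|Re (e^{-iγt} w)|` against `μ` are at most the mean value over a period. -/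
def IsOscAverage (μ : Measure ℝ) (γ : ℝ) : Prop :=
  ∀ w : ℂ, ∫ t, |(cexp (-(I * γ * t)) * w).re| ∂μ ≤ 2 / Real.pi * ‖w‖

/-- The interval has length π/γ, exactly one period of |cos(γt - arg w)|, whose mean is 2/π
independently of the phase. This is the origin of the constant π/2. -/
theorem isOscAverage_uniformKernel {γ : ℝ} (hγ : 0 < γ) :
    IsOscAverage (uniformKernel (Real.pi / (2 * γ))) γ := by
  intro w
  have hpi := Real.pi_pos
  have hh : 0 < Real.pi / (2 * γ) := by positivity
  rw [integral_uniformKernel hh, smul_eq_mul]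
  have h1 : ∀ t : ℝ, |(cexp (-(I * γ * t)) * w).re| = ‖w‖ * |Real.cos (γ * t - w.arg)| := by
    intro t
    have hw : w = ‖w‖ * cexp (w.arg * I) := (norm_mul_exp_arg_mul_I w).symm
    have : cexp (-(I * γ * t)) * w = ‖w‖ * cexp (((w.arg - γ * t : ℝ) : ℂ) * I) := by
      conv_lhs => rw [hw]
      rw [mul_left_comm, ← exp_add]
      congr 2
      push_cast; ring
    rw [this, re_ofReal_mul, exp_ofReal_mul_I_re, abs_mul, abs_norm, ← Real.cos_neg, neg_sub]
  have h2 : ∫ t in (-(Real.pi / (2 * γ)))..(Real.pi / (2 * γ)), |Real.cos (γ * t - w.arg)|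
      = γ⁻¹ * 2 := by
    rw [intervalIntegral.integral_comp_mul_sub (fun x => |Real.cos x|) hγ.ne' w.arg, smul_eq_mul]
    congr 1
    have e1 : γ * -(Real.pi / (2 * γ)) - w.arg = -(Real.pi / 2) - w.arg := by field_simp
    have e2 : γ * (Real.pi / (2 * γ)) - w.arg = (-(Real.pi / 2) - w.arg) + Real.pi := by
      field_simp; ring
    have hper : Function.Periodic (fun x => |Real.cos x|) Real.pi := by
      intro x; simp [Real.cos_add_pi]
    rw [e1, e2, hper.intervalIntegral_add_eq _ (-(Real.pi / 2)),
      show -(Real.pi / 2) + Real.pi = Real.pi / 2 by ring]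
    rw [intervalIntegral.integral_congr (g := Real.cos)]
    · rw [integral_cos]; simp; norm_num
    · intro x hx
      rw [uIcc_of_le (by linarith)] at hx
      exact abs_of_nonneg (Real.cos_nonneg_of_mem_Icc hx)
  simp only [h1, intervalIntegral.integral_const_mul, h2]
  apply le_of_eq
  field_simp

/-- Translation by s only multiplies w by a unimodular factor, so the bound holds for every
translate of μ' and hence for their average. -/
theorem IsOscAverage.conv {μ μ' : Measure ℝ} {a b a' b' γ : ℝ} {Ψ Ψ' : ℂ → ℂ}
    (h : IsKernelMeasure μ a b Ψ) (h' : IsKernelMeasure μ' a' b' Ψ') (ho : IsOscAverage μ' γ) :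
    IsOscAverage (μ ∗ μ') γ := by
  intro w
  have := h.isProb
  rw [h.integral_conv_eq h' (h.integrable_conv h' (by fun_prop))]
  have hle : ∀ s : ℝ, ∫ t, |(cexp (-(I * γ * ((s + t : ℝ) : ℂ))) * w).re| ∂μ'
      ≤ 2 / Real.pi * ‖w‖ := by
    intro s
    have h1 := ho (cexp (-(I * γ * s)) * w)
    have h2 : ‖cexp (-(I * γ * s)) * w‖ = ‖w‖ := by
      rw [norm_mul, norm_exp]; simp
    rw [h2] at h1
    convert h1 using 4 with t
    rw [← mul_assoc, ← exp_add]
    congr 3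
    push_cast; ring
  calc _ ≤ ∫ s, 2 / Real.pi * ‖w‖ ∂μ :=
        integral_mono_of_nonneg (Filter.Eventually.of_forall fun s => integral_nonneg fun t => abs_nonneg _)
          (integrable_const _) (Filter.Eventually.of_forall hle)
    _ = _ := by simp

end KernelMeasures

/-! ### A C¹ bump with a small first-order cost. -/

section Bump

open MeasureTheory Set Complex

/-- The `C¹` bump `15/(16 w) (1 - (u/w)²)₊²`, a probability density on `[-w, w]`. -/
noncomputable def bump (w u : ℝ) : ℝ := 15 / (16 * w) * max 0 (1 - (u / w) ^ 2) ^ 2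

/-- The derivative of `bump`. -/
noncomputable def bumpDeriv (w u : ℝ) : ℝ :=
  15 / (16 * w) * (2 * max 0 (1 - (u / w) ^ 2) * (-(2 * u / w ^ 2)))

theorem hasDerivAt_max_zero_sq (x : ℝ) :
    HasDerivAt (fun x : ℝ => max 0 x ^ 2) (2 * max 0 x) x := by
  rcases lt_trichotomy x 0 with hx | rfl | hx
  · rw [max_eq_left hx.le, mul_zero]
    refine (hasDerivAt_const x (0 : ℝ)).congr_of_eventuallyEq ?_
    filter_upwards [Iio_mem_nhds hx] with t ht
    simp [max_eq_left (le_of_lt (mem_Iio.1 ht))]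
  · simp only [max_self, mul_zero]
    rw [hasDerivAt_iff_isLittleO_nhds_zero]
    have : (fun h : ℝ => h ^ 2) =o[nhds 0] fun h => h := by
      simpa using Asymptotics.isLittleO_pow_id (𝕜 := ℝ) (one_lt_two)
    refine (Asymptotics.IsBigO.of_bound 1 (Filter.Eventually.of_forall fun h => ?_)).trans_isLittleO this
    simp only [zero_add, max_self, smul_zero, sub_zero, one_mul, Real.norm_eq_abs, abs_pow,
      ne_eq, OfNat.ofNat_ne_zero, not_false_eq_true, zero_pow]
    refine pow_le_pow_left₀ (abs_nonneg _) ?_ 2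
    rcases le_total h 0 with h0 | h0
    · simp [max_eq_left h0]
    · simp [max_eq_right h0]
  · rw [max_eq_right hx.le]
    have : HasDerivAt (fun x : ℝ => x ^ 2) (2 * x) x := by simpa using hasDerivAt_pow 2 x
    refine this.congr_of_eventuallyEq ?_
    filter_upwards [Ioi_mem_nhds hx] with t ht
    simp [max_eq_right (le_of_lt (mem_Ioi.1 ht))]

theorem hasDerivAt_bump (w u : ℝ) : HasDerivAt (bump w) (bumpDeriv w u) u := by
  have h1 : HasDerivAt (fun u : ℝ => 1 - (u / w) ^ 2) (-(2 * u / w ^ 2)) u := by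
    have := (((hasDerivAt_id u).div_const w).pow 2).const_sub 1
    refine this.congr_deriv ?_
    simp; ring
  exact ((hasDerivAt_max_zero_sq _).comp u h1).const_mul _

theorem continuous_bump (w : ℝ) : Continuous (bump w) := by unfold bump; fun_prop

theorem continuous_bumpDeriv (w : ℝ) : Continuous (bumpDeriv w) := by unfold bumpDeriv; fun_prop

theorem bump_nonneg {w : ℝ} (hw : 0 < w) (u : ℝ) : 0 ≤ bump w u := by unfold bump; positivity

theorem max_bump_eq_zero {w u : ℝ} (hw : 0 < w) (hu : u ∉ Icc (-w) w) :
    max 0 (1 - (u / w) ^ 2) = 0 := by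
  apply max_eq_left
  have : w < |u| := by
    by_contra! h
    exact hu (abs_le.1 h)
  have : 1 ≤ (u / w) ^ 2 := by
    rw [div_pow, one_le_div (by positivity), ← sq_abs u]
    gcongr
  linarith

theorem bump_eq_zero {w u : ℝ} (hw : 0 < w) (hu : u ∉ Icc (-w) w) : bump w u = 0 := by
  simp [bump, max_bump_eq_zero hw hu]

theorem bumpDeriv_eq_zero {w u : ℝ} (hw : 0 < w) (hu : u ∉ Icc (-w) w) : bumpDeriv w u = 0 := by
  simp [bumpDeriv, max_bump_eq_zero hw hu]

theorem hasCompactSupport_bump {w : ℝ} (hw : 0 < w) : HasCompactSupport (bump w) :=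
  HasCompactSupport.intro isCompact_Icc fun _ hu => bump_eq_zero hw hu

theorem hasCompactSupport_bumpDeriv {w : ℝ} (hw : 0 < w) : HasCompactSupport (bumpDeriv w) :=
  HasCompactSupport.intro isCompact_Icc fun _ hu => bumpDeriv_eq_zero hw hu

theorem integral_eq_intervalIntegral_of_support {E : Type*} [NormedAddCommGroup E]
    [NormedSpace ℝ E] {f : ℝ → E} {a b : ℝ} (hab : a ≤ b) (hf : ∀ u, u ∉ Icc a b → f u = 0) :
    ∫ u, f u = ∫ u in a..b, f u := by
  rw [intervalIntegral.integral_of_le hab, ← integral_Icc_eq_integral_Ioc,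
    setIntegral_eq_integral_of_forall_compl_eq_zero hf]

theorem integral_bump {w : ℝ} (hw : 0 < w) : ∫ u, bump w u = 1 := by
  rw [integral_eq_intervalIntegral_of_support (by linarith) (fun u hu => bump_eq_zero hw hu)]
  have h1 : ∫ u in (-w)..w, bump w u
      = ∫ u in (-w)..w, 15 / (16 * w) * (1 - (u / w) ^ 2) ^ 2 := by
    apply intervalIntegral.integral_congr
    intro u hu
    rw [uIcc_of_le (by linarith)] at hu
    have : (u / w) ^ 2 ≤ 1 := by
      rw [div_pow, div_le_one (by positivity)]
      exact sq_le_sq' hu.1 hu.2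
    simp only [bump]
    rw [max_eq_right (by linarith)]
  have h2 : ∀ u ∈ uIcc (-w) w, HasDerivAt (fun u : ℝ => 15 / (16 * w) *
      (u - 2 * u ^ 3 / (3 * w ^ 2) + u ^ 5 / (5 * w ^ 4)))
      (15 / (16 * w) * (1 - (u / w) ^ 2) ^ 2) u := by
    intro u _
    have e3 : HasDerivAt (fun u : ℝ => 2 * u ^ 3 / (3 * w ^ 2)) (2 * (3 * u ^ 2) / (3 * w ^ 2)) u := by
      simpa using ((hasDerivAt_pow 3 u).const_mul 2).div_const (3 * w ^ 2)
    have e5 : HasDerivAt (fun u : ℝ => u ^ 5 / (5 * w ^ 4)) (5 * u ^ 4 / (5 * w ^ 4)) u := by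
      simpa using (hasDerivAt_pow 5 u).div_const (5 * w ^ 4)
    refine ((((hasDerivAt_id u).sub e3).add e5).const_mul (15 / (16 * w))).congr_deriv ?_
    field_simp
    ring
  rw [h1, intervalIntegral.integral_eq_sub_of_hasDerivAt h2
    (Continuous.intervalIntegrable (by fun_prop) _ _)]
  field_simp
  ring

theorem integral_bumpDeriv {w : ℝ} (hw : 0 < w) : ∫ u, bumpDeriv w u = 0 := by
  rw [integral_eq_intervalIntegral_of_support (by linarith) (fun u hu => bumpDeriv_eq_zero hw hu),
    intervalIntegral.integral_eq_sub_of_hasDerivAt (fun u _ => hasDerivAt_bump w u)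
      ((continuous_bumpDeriv w).intervalIntegrable _ _)]
  have : ∀ u : ℝ, u ^ 2 = w ^ 2 → bump w u = 0 := by
    intro u hu
    rw [bump, div_pow, hu, div_self (by positivity)]; simp
  rw [this w rfl, this (-w) (by ring)]; simp

/-- With k the normalizing constant, p the positive part and x = 4u/w², one has q = kp², q' = -kpx
and ρq - q' = kp(ρp + x). The arithmetic-geometric mean inequality for |ρ|p·|ρp + x| avoids division
by p. The cross term is a multiple of q', which will integrate to zero, and only x² remains as
error. -/
theorem norm_bump_le {w : ℝ} (hw : 0 < w) {ρ : ℂ} (hρ : ρ ≠ 0) (u : ℝ) :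
    ‖ρ * bump w u - bumpDeriv w u‖ ≤ ‖ρ‖ * bump w u - ρ.re / ‖ρ‖ * bumpDeriv w u +
      (Icc (-w) w).indicator (fun _ => 15 / (2 * w ^ 3 * ‖ρ‖)) u := by
  by_cases hu : u ∈ Icc (-w) w
  swap
  · simp [bump_eq_zero hw hu, bumpDeriv_eq_zero hw hu, indicator_of_notMem hu]
  have hr : 0 < ‖ρ‖ := norm_pos_iff.2 hρ
  rw [indicator_of_mem hu, bump, bumpDeriv]
  have hs : u ^ 2 ≤ w ^ 2 := sq_le_sq' hu.1 hu.2
  set p := max 0 (1 - (u / w) ^ 2) with hp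
  have hp0 : 0 ≤ p := le_max_left _ _
  set k := 15 / (16 * w) with hk
  have hk0 : 0 < k := by positivity
  set x := 4 * u / w ^ 2 with hx
  have e1 : ρ * ((k * p ^ 2 : ℝ) : ℂ) - ((k * (2 * p * (-(2 * u / w ^ 2))) : ℝ) : ℂ)
      = ((k * p : ℝ) : ℂ) * (ρ * p + x) := by
    rw [hx]; push_cast; ring
  have e2 : k * (2 * p * (-(2 * u / w ^ 2))) = -(k * p * x) := by rw [hx]; ring
  rw [e1, norm_mul, norm_real, Real.norm_of_nonneg (by positivity), e2]
  have hsq : ‖ρ * p + x‖ ^ 2 = (‖ρ‖ * p) ^ 2 + 2 * ρ.re * p * x + x ^ 2 := by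
    rw [mul_pow, Complex.sq_norm, Complex.sq_norm, normSq_apply, normSq_apply]
    simp; ring
  have ham : ‖ρ‖ * p * ‖ρ * p + x‖ ≤ (‖ρ‖ * p) ^ 2 + ρ.re * p * x + x ^ 2 / 2 := by
    nlinarith [sq_nonneg (‖ρ‖ * p - ‖ρ * p + x‖)]
  have h3 : k * x ^ 2 / (2 * ‖ρ‖) ≤ 15 / (2 * w ^ 3 * ‖ρ‖) := by
    have : k * x ^ 2 / (2 * ‖ρ‖) = 15 / (2 * w ^ 3 * ‖ρ‖) * (u ^ 2 / w ^ 2) := by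
      rw [hk, hx]; field_simp; norm_num
    rw [this]
    apply mul_le_of_le_one_right (by positivity)
    rw [div_le_one (by positivity)]; exact hs
  have h4 : k * p * ‖ρ * p + x‖ ≤ ‖ρ‖ * (k * p ^ 2) + ρ.re / ‖ρ‖ * (k * p * x)
      + k * x ^ 2 / (2 * ‖ρ‖) := by
    have : k * p * ‖ρ * p + x‖ = k / ‖ρ‖ * (‖ρ‖ * p * ‖ρ * p + x‖) := by field_simp
    rw [this]
    calc _ ≤ k / ‖ρ‖ * ((‖ρ‖ * p) ^ 2 + ρ.re * p * x + x ^ 2 / 2) := by gcongr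
      _ = _ := by field_simp
  linarith

/-- The Fisher-information bound: `∫ |ρ q - q'|` exceeds `|ρ|` only to second order in `1/w`. -/
theorem integral_norm_bump_le {w : ℝ} (hw : 0 < w) {ρ : ℂ} (hρ : ρ ≠ 0) :
    ∫ u, ‖ρ * bump w u - bumpDeriv w u‖ ≤ ‖ρ‖ + 15 / (w ^ 2 * ‖ρ‖) := by
  have hr : 0 < ‖ρ‖ := norm_pos_iff.2 hρ
  have i1 : Integrable (bump w) :=
    (continuous_bump w).integrable_of_hasCompactSupport (hasCompactSupport_bump hw)
  have i2 : Integrable (bumpDeriv w) :=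
    (continuous_bumpDeriv w).integrable_of_hasCompactSupport (hasCompactSupport_bumpDeriv hw)
  have i3 : Integrable ((Icc (-w) w).indicator (fun _ : ℝ => 15 / (2 * w ^ 3 * ‖ρ‖))) :=
    (integrable_indicator_iff measurableSet_Icc).2 (integrableOn_const (by simp))
  have i12 : Integrable (fun u => ‖ρ‖ * bump w u - ρ.re / ‖ρ‖ * bumpDeriv w u) :=
    (i1.const_mul _).sub (i2.const_mul _)
  calc _ ≤ ∫ u, (‖ρ‖ * bump w u - ρ.re / ‖ρ‖ * bumpDeriv w u +
        (Icc (-w) w).indicator (fun _ => 15 / (2 * w ^ 3 * ‖ρ‖)) u) :=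
        integral_mono_of_nonneg (Filter.Eventually.of_forall fun u => norm_nonneg _)
          (i12.add i3)
          (Filter.Eventually.of_forall (norm_bump_le hw hρ))
    _ = _ := by
      -- The term in q' vanishes, and the indicator contributes 2w · 15/(2w³|ρ|) = 15/(w²|ρ|).
      rw [integral_add i12 i3,
        integral_sub (i1.const_mul _) (i2.const_mul _), integral_const_mul, integral_const_mul,
        integral_bump hw, integral_bumpDeriv hw, integral_indicator measurableSet_Icc,
        setIntegral_const, measureReal_def, Real.volume_Icc,
        ENNReal.toReal_ofReal (by linarith), smul_eq_mul]
      field_simp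
      ring

/-- The probability measure with density `bump w`. -/
noncomputable def bumpKernel (w : ℝ) : Measure ℝ :=
  volume.withDensity fun u => ENNReal.ofReal (bump w u)

theorem isKernelMeasure_bumpKernel {w : ℝ} (hw : 0 < w) :
    IsKernelMeasure (bumpKernel w) (-w) w (fun z => ∫ u, (bump w u : ℂ) * cexp (z * u)) where
  isProb := ⟨by
    rw [bumpKernel, withDensity_apply _ MeasurableSet.univ, Measure.restrict_univ,
      ← ofReal_integral_eq_lintegral_ofReal
        ((continuous_bump w).integrable_of_hasCompactSupport (hasCompactSupport_bump hw))
        (Filter.Eventually.of_forall (bump_nonneg hw)), integral_bump hw, ENNReal.ofReal_one]⟩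
  mem_Icc := by
    rw [bumpKernel, ae_withDensity_iff (by have := continuous_bump w; fun_prop)]
    refine Filter.Eventually.of_forall fun u hu => ?_
    by_contra h
    exact hu (by simp [bump_eq_zero hw h])
  laplace z := by
    rw [bumpKernel, integral_withDensity_eq_integral_toReal_smul
      (by have := continuous_bump w; fun_prop) (by simp)]
    congr 1
    ext u
    rw [ENNReal.toReal_ofReal (bump_nonneg hw u), real_smul]

end Bump

/-! ### Smoothed kernels and the oscillation bound. -/

section Smoothing

open MeasureTheory Set Complex

/-- The convolution of a function with a measure. -/
noncomputable def smoothing (μ : Measure ℝ) (f : ℝ → ℝ) (u : ℝ) : ℝ := ∫ t, f (u - t) ∂μ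

variable {μ : Measure ℝ} {a b w : ℝ} {Ψ : ℂ → ℂ} {f f' : ℝ → ℝ}

theorem continuous_smoothing (h : IsKernelMeasure μ a b Ψ) (hf : Continuous f)
    (hc : HasCompactSupport f) : Continuous (smoothing μ f) := by
  have := h.isProb
  obtain ⟨C, hC⟩ := hf.bounded_above_of_compact_support hc
  exact continuous_of_dominated (bound := fun _ => C)
    (fun u => (Continuous.aestronglyMeasurable (by fun_prop)))
    (fun u => Filter.Eventually.of_forall fun t => hC _) (integrable_const C)
    (Filter.Eventually.of_forall fun t => by fun_prop)

theorem hasDerivAt_smoothing (h : IsKernelMeasure μ a b Ψ) (hf : ∀ u, HasDerivAt f (f' u) u)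
    (hf' : Continuous f') (hc' : HasCompactSupport f') (u : ℝ) :
    HasDerivAt (smoothing μ f) (smoothing μ f' u) u := by
  have := h.isProb
  have hfc : Continuous f := continuous_iff_continuousAt.2 fun u => (hf u).continuousAt
  obtain ⟨C, hC⟩ := hf'.bounded_above_of_compact_support hc'
  refine (hasDerivAt_integral_of_dominated_loc_of_deriv_le (μ := μ) (F := fun u t => f (u - t))
    (F' := fun u t => f' (u - t)) (bound := fun _ => C) Filter.univ_mem
    (Filter.Eventually.of_forall fun u => (Continuous.aestronglyMeasurable (by fun_prop)))
    (h.integrable_of_continuous (by fun_prop)) (Continuous.aestronglyMeasurable (by fun_prop))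
    (Filter.Eventually.of_forall fun t v _ => hC _) (integrable_const C)
    (Filter.Eventually.of_forall fun t v _ => ?_)).2
  exact ((hf (v - t)).comp v ((hasDerivAt_id v).sub_const t)).congr_deriv (mul_one _)

theorem smoothing_eq_zero (h : IsKernelMeasure μ a b Ψ) (hf : ∀ u, u ∉ Icc (-w) w → f u = 0)
    {u : ℝ} (hu : u ∉ Icc (a - w) (b + w)) : smoothing μ f u = 0 := by
  apply integral_eq_zero_of_ae
  filter_upwards [h.mem_Icc] with t ht
  apply hf
  intro h'
  exact hu ⟨by linarith [h'.1, ht.1], by linarith [h'.2, ht.2]⟩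

theorem integrable_prod_of_support (h : IsKernelMeasure μ a b Ψ) {E : Type*}
    [NormedAddCommGroup E] {k : ℝ × ℝ → E} (hk : Continuous k) {A B : ℝ}
    (h0 : ∀ p : ℝ × ℝ, p.2 ∈ Icc a b → p.1 ∉ Icc A B → k p = 0) :
    Integrable k ((volume : Measure ℝ).prod μ) := by
  have := h.isProb
  have hintegrable : IntegrableOn k (Icc A B ×ˢ Icc a b) ((volume : Measure ℝ).prod μ) :=
    hk.continuousOn.integrableOn_compact (isCompact_Icc.prod isCompact_Icc)
  have hind := (integrable_indicator_iff (measurableSet_Icc.prod measurableSet_Icc)).2 hintegrable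
  refine hind.congr ?_
  have h2 : ∀ᵐ p ∂((volume : Measure ℝ).prod μ), p.2 ∈ Icc a b :=
    Measure.quasiMeasurePreserving_snd.ae h.mem_Icc
  filter_upwards [h2] with p hp
  by_cases h1 : p.1 ∈ Icc A B
  · rw [indicator_of_mem (by exact ⟨h1, hp⟩)]
  · rw [indicator_of_notMem (by exact fun h' => h1 h'.1), h0 p hp h1]

theorem laplace_smoothing (h : IsKernelMeasure μ a b Ψ) (hf : Continuous f)
    (h0 : ∀ u, u ∉ Icc (-w) w → f u = 0) (z : ℂ) :
    ∫ u, (smoothing μ f u : ℂ) * cexp (z * u) = (∫ u, (f u : ℂ) * cexp (z * u)) * Ψ z := by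
  have := h.isProb
  have h1 : ∀ u : ℝ, (smoothing μ f u : ℂ) * cexp (z * u)
      = ∫ t, (f (u - t) : ℂ) * cexp (z * u) ∂μ := by
    intro u
    rw [integral_mul_const, smoothing, integral_complex_ofReal]
  simp only [h1]
  rw [integral_integral_swap]
  · have h2 : ∀ t : ℝ, ∫ u, (f (u - t) : ℂ) * cexp (z * u)
        = cexp (z * t) * ∫ u, (f u : ℂ) * cexp (z * u) := by
      intro t
      rw [← integral_add_right_eq_self _ t, ← integral_const_mul]
      congr 1
      ext u
      rw [add_sub_cancel_right]
      push_cast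
      rw [mul_add, exp_add]; ring
    simp only [h2, integral_mul_const, h.laplace]
    ring
  · refine integrable_prod_of_support h (A := a - w) (B := b + w)
      (k := fun p : ℝ × ℝ => (f (p.1 - p.2) : ℂ) * cexp (z * p.1)) (by fun_prop) ?_
    intro p hp hp1
    rw [h0 (p.1 - p.2)]
    · simp
    · intro h'
      exact hp1 ⟨by linarith [h'.1, hp.1], by linarith [h'.2, hp.2]⟩

/-- By Fubini and the translation u ↦ u + t, the phase becomes e^(-iγ(u+t)) while F(u) = ρf(u) -
f'(u) no longer depends on t. Averaging over t first gains 2/π pointwise in u. -/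
theorem integral_abs_re_smoothing_le (h : IsKernelMeasure μ a b Ψ) {γ : ℝ} (ho : IsOscAverage μ γ)
    (hf : Continuous f) (hf' : Continuous f')
    (h0 : ∀ u, u ∉ Icc (-w) w → f u = 0) (h0' : ∀ u, u ∉ Icc (-w) w → f' u = 0)
    (ρ : ℂ) {c : ℂ} (hc : ‖c‖ = 1) :
    ∫ u : ℝ, |(c * cexp (-(I * γ * u)) * (ρ * smoothing μ f u - smoothing μ f' u)).re|
      ≤ 2 / Real.pi * ∫ u, ‖ρ * f u - f' u‖ := by
  have := h.isProb
  set F : ℝ → ℂ := fun u => ρ * f u - f' u with hF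
  have hFc : Continuous F := by fun_prop
  have hF0 : ∀ u, u ∉ Icc (-w) w → F u = 0 := fun u hu => by simp [hF, h0 u hu, h0' u hu]
  have hprod : ∀ p : ℝ × ℝ, p.2 ∈ Icc a b → p.1 ∉ Icc (a - w) (b + w) → F (p.1 - p.2) = 0 := by
    intro p hp hp1
    apply hF0
    intro h'
    exact hp1 ⟨by linarith [h'.1, hp.1], by linarith [h'.2, hp.2]⟩
  have hsm : ∀ u : ℝ, ρ * smoothing μ f u - smoothing μ f' u = ∫ t, F (u - t) ∂μ := by
    intro u
    rw [hF, integral_sub (h.integrable_of_continuous (by fun_prop))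
      (h.integrable_of_continuous (by fun_prop)), integral_const_mul, smoothing, smoothing,
      integral_complex_ofReal, integral_complex_ofReal]
  have hpt : ∀ u : ℝ, |(c * cexp (-(I * γ * u)) * (ρ * smoothing μ f u - smoothing μ f' u)).re|
      ≤ ∫ t, |(c * cexp (-(I * γ * u)) * F (u - t)).re| ∂μ := by
    intro u
    rw [hsm, ← integral_const_mul]
    have hi : Integrable (fun t => c * cexp (-(I * γ * u)) * F (u - t)) μ :=
      h.integrable_of_continuous (by fun_prop)
    have : (∫ t, c * cexp (-(I * γ * u)) * F (u - t) ∂μ).re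
        = ∫ t, (c * cexp (-(I * γ * u)) * F (u - t)).re ∂μ := (integral_re hi).symm
    rw [this]
    exact abs_integral_le_integral_abs
  have hintegrable : Integrable (fun p : ℝ × ℝ => |(c * cexp (-(I * γ * p.1)) * F (p.1 - p.2)).re|)
      ((volume : Measure ℝ).prod μ) :=
    integrable_prod_of_support h (A := a - w) (B := b + w) (by fun_prop) (fun p hp hp1 => by
      simp [hprod p hp hp1])
  have hint2 : Integrable (fun p : ℝ × ℝ =>
      |(c * cexp (-(I * γ * ((p.1 + p.2 : ℝ) : ℂ))) * F p.1).re|)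
      ((volume : Measure ℝ).prod μ) :=
    integrable_prod_of_support h (A := -w) (B := w) (by fun_prop) (fun p hp hp1 => by
      simp [hF0 _ hp1])
  have hFn : Integrable (fun u => ‖F u‖) :=
    ((hFc.integrable_of_hasCompactSupport (HasCompactSupport.intro isCompact_Icc hF0))).norm
  calc _ ≤ ∫ u : ℝ, ∫ t, |(c * cexp (-(I * γ * u)) * F (u - t)).re| ∂μ :=
        integral_mono_of_nonneg (Filter.Eventually.of_forall fun u => abs_nonneg _)
          hintegrable.integral_prod_left (Filter.Eventually.of_forall hpt)
    _ = ∫ t, (∫ u : ℝ, |(c * cexp (-(I * γ * u)) * F (u - t)).re|) ∂μ :=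
        integral_integral_swap hintegrable
    _ = ∫ t, (∫ u : ℝ, |(c * cexp (-(I * γ * ((u + t : ℝ) : ℂ))) * F u).re|) ∂μ := by
        congr 1
        ext t
        rw [← integral_add_right_eq_self _ t]
        simp only [add_sub_cancel_right]
    _ = ∫ u : ℝ, ∫ t, |(c * cexp (-(I * γ * ((u + t : ℝ) : ℂ))) * F u).re| ∂μ :=
        (integral_integral_swap hint2).symm
    _ ≤ ∫ u, 2 / Real.pi * ‖F u‖ := by
        refine integral_mono_of_nonneg
          (Filter.Eventually.of_forall fun u => integral_nonneg fun t => abs_nonneg _)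
          (hFn.const_mul _) (Filter.Eventually.of_forall fun u => ?_)
        have h1 := ho (c * cexp (-(I * γ * u)) * F u)
        have h2 : ‖c * cexp (-(I * γ * u)) * F u‖ = ‖F u‖ := by
          rw [norm_mul, norm_mul, hc, norm_exp]; simp
        rw [h2] at h1
        refine le_of_eq_of_le ?_ h1
        refine integral_congr_ae (Filter.Eventually.of_forall fun t => ?_)
        dsimp only
        congr 2
        rw [ofReal_add, mul_add, neg_add, exp_add]
        ring
    _ = _ := by rw [integral_const_mul]

/-- A `C¹` kernel carried by `[a, b]` with Laplace transform `Φ`; the average of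
`|Re (c e^{-iγu} (ρ G - G'))|` is at most `2/π (|ρ| + 15/(w²|ρ|))`. -/
structure IsOscKernel (G G' : ℝ → ℝ) (a b w γ : ℝ) (Φ : ℂ → ℂ) : Prop where
  hasDerivAt : ∀ u, HasDerivAt G (G' u) u
  continuous_deriv : Continuous G'
  eq_zero : ∀ u, u ∉ Icc a b → G u = 0
  deriv_eq_zero : ∀ u, u ∉ Icc a b → G' u = 0
  laplace : ∀ z : ℂ, ∫ u, (G u : ℂ) * cexp (z * u) = Φ z
  osc : ∀ ρ : ℂ, ρ ≠ 0 → ∀ c : ℂ, ‖c‖ = 1 →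
    ∫ u : ℝ, |(c * cexp (-(I * γ * u)) * (ρ * G u - G' u)).re|
      ≤ 2 / Real.pi * (‖ρ‖ + 15 / (w ^ 2 * ‖ρ‖))

theorem IsKernelMeasure.mono (h : IsKernelMeasure μ a b Ψ) {a' b' : ℝ} (ha : a' ≤ a) (hb : b ≤ b') :
    IsKernelMeasure μ a' b' Ψ :=
  ⟨h.isProb, h.mem_Icc.mono fun _ ht => ⟨ha.trans ht.1, ht.2.trans hb⟩, h.laplace⟩

theorem isOscKernel_smoothing (h : IsKernelMeasure μ a b Ψ) {γ : ℝ} (ho : IsOscAverage μ γ)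
    (hw : 0 < w) : IsOscKernel (smoothing μ (bump w)) (smoothing μ (bumpDeriv w)) (a - w) (b + w)
      w γ (fun z => (∫ u, (bump w u : ℂ) * cexp (z * u)) * Ψ z) where
  hasDerivAt := hasDerivAt_smoothing h (hasDerivAt_bump w) (continuous_bumpDeriv w)
    (hasCompactSupport_bumpDeriv hw)
  continuous_deriv := continuous_smoothing h (continuous_bumpDeriv w)
    (hasCompactSupport_bumpDeriv hw)
  eq_zero _ hu := smoothing_eq_zero h (fun _ => bump_eq_zero hw) hu
  deriv_eq_zero _ hu := smoothing_eq_zero h (fun _ => bumpDeriv_eq_zero hw) hu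
  laplace := laplace_smoothing h (continuous_bump w) (fun _ => bump_eq_zero hw)
  osc ρ hρ c hc := (integral_abs_re_smoothing_le h ho (continuous_bump w) (continuous_bumpDeriv w)
    (fun _ => bump_eq_zero hw) (fun _ => bumpDeriv_eq_zero hw) ρ hc).trans (by
      have := integral_norm_bump_le hw hρ
      gcongr)

/-- The kernels of the oscillation argument: all powers of one entire function `Φ` are Laplace
transforms of oscillation kernels. -/
theorem exists_oscKernels {y γ : ℝ} (hy : 1 ≤ y) (hγ : 0 < γ) (hh : Real.pi / (2 * γ) ≤ y) :
    ∃ Φ : ℂ → ℂ, Differentiable ℂ Φ ∧ Φ 0 = 1 ∧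
      (∀ z : ℂ, z.re ≤ 0 → ‖Φ z‖ ≤ Real.exp (14 * y * z.re)) ∧
      (∀ z : ℂ, |z.re| ≤ 2 → z ≠ 0 → ‖Φ z‖ ≤ Real.exp (44 * y) / ‖z‖ ^ ⌈y⌉₊) ∧
      ∀ ν : ℕ, 1 ≤ ν → ∃ G G' : ℝ → ℝ,
        IsOscKernel G G' (14 * y * ν) (22 * y * ν) y γ (fun z => Φ z ^ ν) := by
  have hy0 : 0 < y := by linarith
  have hpi := Real.pi_pos
  set h := Real.pi / (2 * γ) with hdef
  have hh0 : 0 < h := by positivity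
  set r := ⌈y⌉₊ with hr
  have hr1 : (r : ℝ) ≤ 2 * y := by
    have := Nat.ceil_lt_add_one hy0.le
    rw [← hr] at this; linarith
  have kq := isKernelMeasure_bumpKernel hy0
  have kh := isKernelMeasure_uniformKernel hh0
  have k1 := isKernelMeasure_uniformKernel one_pos
  obtain ⟨μr, kr⟩ := k1.exists_iterate r
  -- The factors have separate roles: the shift by 18y places the support, the ⌈y⌉ copies of the
  -- uniform law on [-1,1] give vertical decay, and the uniform law on [-h,h] gives the oscillation
  -- average.
  have km := ((IsKernelMeasure.dirac (18 * y)).conv kr).conv kh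
  have om := IsOscAverage.conv ((IsKernelMeasure.dirac (18 * y)).conv kr) kh
    (isOscAverage_uniformKernel hγ)
  set m1 := (Measure.dirac (18 * y) ∗ μr) ∗ uniformKernel h with hm1
  set Q : ℂ → ℂ := fun z => ∫ u, (bump y u : ℂ) * cexp (z * u) with hQ
  set Ψ : ℂ → ℂ := _ with hΨ
  change IsKernelMeasure m1 _ _ Ψ at km
  -- Since r ≤ 2y and h ≤ y, the support lies within 3y of 18y. The bump of width y then enlarges it
  -- to [14y, 22y].
  replace km := km.mono (a' := 15 * y) (b' := 21 * y) (by linarith) (by linarith)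
  have kΦ := (kq.conv km).mono (a' := 14 * y) (b' := 22 * y) (by linarith) (by linarith)
  refine ⟨fun z => Q z * Ψ z, kΦ.differentiable, kΦ.apply_zero, ?_, ?_, ?_⟩
  · intro z hz
    exact kΦ.norm_le (fun t ht => by nlinarith [ht.1])
  · intro z hz hz0
    obtain ⟨hz1, hz2⟩ := abs_le.1 hz
    have hzp : 0 < ‖z‖ := norm_pos_iff.2 hz0
    have b1 : ‖Q z‖ ≤ Real.exp (2 * y) := kq.norm_le (fun t ht => by
      have : |t| ≤ y := abs_le.2 ht
      calc z.re * t ≤ |z.re * t| := le_abs_self _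
        _ = |z.re| * |t| := abs_mul _ _
        _ ≤ 2 * y := by gcongr)
    have b2 : ‖((2 * h)⁻¹ : ℝ) • ∫ t in (-h)..h, cexp (z * t)‖ ≤ Real.exp (2 * y) :=
      kh.norm_le (fun t ht => by
      have : |t| ≤ h := abs_le.2 ht
      calc z.re * t ≤ |z.re * t| := le_abs_self _
        _ = |z.re| * |t| := abs_mul _ _
        _ ≤ 2 * y := by gcongr; linarith)
    have b3 : ‖((2 * 1)⁻¹ : ℝ) • ∫ t in (-1 : ℝ)..1, cexp (z * t)‖ ≤ Real.exp 2 / ‖z‖ := by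
      refine (norm_uniform_laplace_le one_pos hz0).trans ?_
      rw [one_mul, one_mul]
      gcongr
    have b4 : ‖cexp (z * ((18 * y : ℝ) : ℂ))‖ ≤ Real.exp (36 * y) := by
      rw [norm_exp]
      gcongr
      simp
      nlinarith
    have hΨz : Ψ z = cexp (z * ((18 * y : ℝ) : ℂ)) *
        (((2 * 1)⁻¹ : ℝ) • ∫ t in (-1 : ℝ)..1, cexp (z * t)) ^ r *
        (((2 * h)⁻¹ : ℝ) • ∫ t in (-h)..h, cexp (z * t)) := rfl
    rw [norm_mul, hΨz, norm_mul, norm_mul, norm_pow]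
    -- For |Re z| ≤ 2 the bump, the shift and the uniform law on [-h,h] cost 2y + 36y + 2y in the
    -- exponent. The r factors cost 2r ≤ 4y, for a total of 44y.
    calc _ ≤ Real.exp (2 * y) * (Real.exp (36 * y) * (Real.exp 2 / ‖z‖) ^ r * Real.exp (2 * y)) := by
          gcongr
      _ = Real.exp (40 * y + r * 2) / ‖z‖ ^ r := by
          rw [div_pow, ← Real.exp_nat_mul, show 40 * y + r * 2 = 2 * y + 36 * y + r * 2 + 2 * y by ring,
            Real.exp_add, Real.exp_add, Real.exp_add]
          ring
      _ ≤ _ := by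
          gcongr
          linarith
  · intro ν hν
    obtain ⟨n, rfl⟩ := Nat.exists_eq_add_of_le' hν
    -- For the power ν = n+1 one bump is kept as the smooth density and one copy of m1 supplies the
    -- oscillation average. The other n copies of each are absorbed in the convolving measure.
    obtain ⟨μq, hμq⟩ := kq.exists_iterate n
    obtain ⟨μm, hμm⟩ := km.exists_iterate n
    have kk := (hμq.conv hμm).conv km
    have oo := IsOscAverage.conv (hμq.conv hμm) km om
    refine ⟨smoothing ((μq ∗ μm) ∗ m1) (bump y), smoothing ((μq ∗ μm) ∗ m1) (bumpDeriv y), ?_⟩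
    convert isOscKernel_smoothing kk oo hy0 using 1
    · push_cast; ring
    · push_cast; ring
    · ext z; simp only [hQ]; ring

end Smoothing

/-! ### Arithmetic of the free monoid and the von Mangoldt function. -/

namespace BeurlingSystem

open Set

variable {G : Type u} [CommMonoid G] (B : BeurlingSystem G)

/-- The factorization bijection. -/
noncomputable def factorEquiv : Multiset B.primes ≃ G := Equiv.ofBijective _ B.free

theorem factorEquiv_apply (s : Multiset B.primes) :
    B.factorEquiv s = (s.map (fun p : B.primes => (p : G))).prod := rfl

theorem factorEquiv_add (s t : Multiset B.primes) :
    B.factorEquiv (s + t) = B.factorEquiv s * B.factorEquiv t := by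
  simp [factorEquiv_apply]

theorem factorEquiv_replicate (p : B.primes) (k : ℕ) :
    B.factorEquiv (Multiset.replicate k p) = (p : G) ^ k := by
  simp [factorEquiv_apply]

/-- Otherwise the infinitely many distinct powers of p would all have norm at most 1, against
finiteness. -/
theorem one_lt_norm_prime (p : B.primes) : 1 < B.norm p := by
  by_contra! h
  have hinj : Function.Injective (fun k : ℕ => (p : G) ^ k) := by
    intro j k hjk
    simp only [← B.factorEquiv_replicate] at hjk
    simpa using congrArg Multiset.card (B.factorEquiv.injective hjk)
  refine Set.infinite_range_of_injective hinj ((B.finite_norm_le 1).subset ?_)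
  rintro _ ⟨k, rfl⟩
  simpa using pow_le_one₀ (B.norm_pos _).le h

theorem norm_factorEquiv (s : Multiset B.primes) :
    B.norm (B.factorEquiv s) = (s.map (fun p : B.primes => B.norm p)).prod := by
  rw [factorEquiv_apply, map_multiset_prod, Multiset.map_map]; rfl

theorem log_norm_factorEquiv (s : Multiset B.primes) :
    Real.log (B.norm (B.factorEquiv s)) = (s.map (fun p : B.primes => Real.log (B.norm p))).sum := by
  induction s using Multiset.induction_on with
  | empty => simp [norm_factorEquiv]
  | cons p s ih =>
    rw [← Multiset.singleton_add, factorEquiv_add, map_mul,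
      Real.log_mul (B.norm_pos _).ne' (B.norm_pos _).ne', ih, Multiset.map_add, Multiset.sum_add]
    simp [factorEquiv_apply]

theorem one_le_norm (g : G) : 1 ≤ B.norm g := by
  obtain ⟨s, rfl⟩ := B.factorEquiv.surjective g
  induction s using Multiset.induction_on with
  | empty => simp [factorEquiv_apply]
  | cons p s ih =>
    rw [factorEquiv_apply, Multiset.map_cons, Multiset.prod_cons, ← factorEquiv_apply, map_mul]
    exact one_le_mul_of_one_le_of_one_le (B.one_lt_norm_prime p).le ih

theorem one_lt_norm {g : G} (hg : g ≠ 1) : 1 < B.norm g := by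
  obtain ⟨s, rfl⟩ := B.factorEquiv.surjective g
  rcases s.empty_or_exists_mem with rfl | ⟨p, hp⟩
  · exact absurd (by simp [factorEquiv_apply]) hg
  obtain ⟨t, rfl⟩ := Multiset.exists_cons_of_mem hp
  rw [← Multiset.singleton_add, factorEquiv_add, map_mul]
  have h1 := B.one_le_norm (B.factorEquiv t)
  have h2 := B.one_lt_norm_prime p
  have h3 : B.factorEquiv {p} = p := by simp [factorEquiv_apply]
  rw [h3]
  nlinarith

theorem countable (B : BeurlingSystem G) : Countable G := by
  have : (univ : Set G) = ⋃ n : ℕ, {g : G | B.norm g ≤ n} := by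
    ext g
    simpa using exists_nat_ge (B.norm g)
  rw [← Set.countable_univ_iff, this]
  exact Set.countable_iUnion fun n => (B.finite_norm_le n).countable

theorem prime_pow_injective {p q : B.primes} {j k : ℕ} (hj : 1 ≤ j)
    (h : (p : G) ^ j = (q : G) ^ k) : p = q ∧ j = k := by
  rw [← factorEquiv_replicate, ← factorEquiv_replicate] at h
  have h1 := B.factorEquiv.injective h
  have h2 : j = k := by simpa using congrArg Multiset.card h1
  subst h2
  refine ⟨?_, rfl⟩
  have : p ∈ Multiset.replicate j q := by
    rw [← h1]; exact Multiset.mem_replicate.2 ⟨by omega, rfl⟩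
  exact Multiset.eq_of_mem_replicate this

theorem vonMangoldt_pow (p : B.primes) {k : ℕ} (hk : 1 ≤ k) :
    B.vonMangoldt ((p : G) ^ k) = Real.log (B.norm p) := by
  have h : ∃ q ∈ B.primes, ∃ j : ℕ, 1 ≤ j ∧ (p : G) ^ k = q ^ j := ⟨p, p.2, k, hk, rfl⟩
  rw [vonMangoldt, dif_pos h]
  obtain ⟨hq, j, hj, he⟩ := h.choose_spec
  have := (B.prime_pow_injective (p := p) (q := ⟨_, hq⟩) hk he).1
  rw [show h.choose = (p : G) from (congrArg Subtype.val this).symm]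

theorem vonMangoldt_eq_zero {g : G} (h : ∀ (p : B.primes) (k : ℕ), g ≠ (p : G) ^ (k + 1)) :
    B.vonMangoldt g = 0 := by
  rw [vonMangoldt, dif_neg]
  rintro ⟨p, hp, k, hk, rfl⟩
  exact h ⟨p, hp⟩ (k - 1) (by simp [Nat.sub_add_cancel hk])

theorem vonMangoldt_nonneg (g : G) : 0 ≤ B.vonMangoldt g := by
  by_cases h : ∀ (p : B.primes) (k : ℕ), g ≠ (p : G) ^ (k + 1)
  · exact (B.vonMangoldt_eq_zero h).ge
  push Not at h
  obtain ⟨p, k, rfl⟩ := h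
  rw [B.vonMangoldt_pow p (by omega)]
  exact Real.log_nonneg (B.one_le_norm _)

theorem vonMangoldt_le_log (g : G) : B.vonMangoldt g ≤ Real.log (B.norm g) := by
  by_cases h : ∀ (p : B.primes) (k : ℕ), g ≠ (p : G) ^ (k + 1)
  · exact (B.vonMangoldt_eq_zero h).le.trans (Real.log_nonneg (B.one_le_norm _))
  push Not at h
  obtain ⟨p, k, rfl⟩ := h
  rw [B.vonMangoldt_pow p (by omega), map_pow, Real.log_pow]
  have := Real.log_nonneg (B.one_le_norm p)
  push_cast
  nlinarith [(Nat.cast_nonneg k : (0 : ℝ) ≤ k)]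

theorem pow_dvd_factorEquiv_iff [DecidableEq B.primes] (p : B.primes) (k : ℕ)
    (s : Multiset B.primes) : (p : G) ^ k ∣ B.factorEquiv s ↔ k ≤ s.count p := by
  rw [Multiset.le_count_iff_replicate_le, ← factorEquiv_replicate]
  constructor
  · rintro ⟨g, hg⟩
    obtain ⟨t, rfl⟩ := B.factorEquiv.surjective g
    rw [← factorEquiv_add] at hg
    rw [B.factorEquiv.injective hg]
    exact Multiset.le_add_right _ _
  · intro h
    obtain ⟨t, rfl⟩ := Multiset.le_iff_exists_add.1 h
    exact ⟨B.factorEquiv t, B.factorEquiv_add _ _⟩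

theorem mul_left_injective (B : BeurlingSystem G) (g : G) : Function.Injective (fun x : G => g * x) := by
  intro x y hxy
  obtain ⟨s, rfl⟩ := B.factorEquiv.surjective g
  obtain ⟨t, rfl⟩ := B.factorEquiv.surjective x
  obtain ⟨t', rfl⟩ := B.factorEquiv.surjective y
  simp only [← factorEquiv_add] at hxy
  rw [add_left_cancel (B.factorEquiv.injective hxy)]

open Classical in
/-- `∑_{p^k ∣ g} log |p| = log |g|`. -/
theorem hasSum_log_prime_dvd {R : Type*} [NormedRing R] (φ : ℝ →+ R) (g : G) :
    HasSum (fun q : B.primes × ℕ => if (q.1 : G) ^ (q.2 + 1) ∣ g then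
      φ (Real.log (B.norm q.1)) else 0) (φ (Real.log (B.norm g))) := by
  obtain ⟨s, rfl⟩ := B.factorEquiv.surjective g
  -- The pair (p, k) stands for p^(k+1). It contributes only if k is below the multiplicity of p, so
  -- a finite box of pairs suffices.
  have h : ∀ q ∉ s.toFinset ×ˢ Finset.range (Multiset.card s),
      (if (q.1 : G) ^ (q.2 + 1) ∣ B.factorEquiv s then φ (Real.log (B.norm q.1)) else 0) = 0 := by
    rintro ⟨p, k⟩ hq
    rw [if_neg]
    intro hd
    rw [pow_dvd_factorEquiv_iff] at hd
    apply hq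
    rw [Finset.mem_product, Multiset.mem_toFinset, Finset.mem_range]
    refine ⟨Multiset.count_pos.1 (by dsimp only at hd ⊢; omega), ?_⟩
    have := Multiset.count_le_card p s
    dsimp only at hd ⊢
    omega
  have key := hasSum_sum_of_ne_finset_zero (L := .unconditional _) h
  convert key using 1
  rw [log_norm_factorEquiv, Finset.sum_product, Finset.sum_multiset_map_count, map_sum]
  refine Finset.sum_congr rfl fun p hp => ?_
  simp only [pow_dvd_factorEquiv_iff, Nat.add_one_le_iff]
  rw [← Finset.sum_filter, Finset.sum_const]
  have : (Finset.range (Multiset.card s)).filter (fun k => k < Multiset.count p s)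
      = Finset.range (Multiset.count p s) := by
    ext k
    have := Multiset.count_le_card p s
    simp; omega
  rw [this, Finset.card_range, map_nsmul]

end BeurlingSystem

/-! ### Mellin integrals over (1, ∞). -/

section TailMellin

open MeasureTheory Set Complex

/-- The Mellin-type integral `∫_1^∞ r(x) x^{-s-1} dx`. -/
noncomputable def tailMellin (r : ℝ → ℝ) (s : ℂ) : ℂ :=
  ∫ x in Ioi (1 : ℝ), (r x : ℂ) * (x : ℂ) ^ (-s - 1)

variable {r : ℝ → ℝ} {C τ : ℝ} {s : ℂ}

theorem norm_tailMellin_integrand_le (hb : ∀ x, 1 < x → |r x| ≤ C * x ^ τ) {x : ℝ} (hx : 1 < x) :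
    ‖(r x : ℂ) * (x : ℂ) ^ (-s - 1)‖ ≤ C * x ^ (τ - s.re - 1) := by
  have hx0 : 0 < x := by linarith
  rw [norm_mul, norm_real, Real.norm_eq_abs, norm_cpow_eq_rpow_re_of_pos hx0]
  calc _ ≤ C * x ^ τ * x ^ (-s - 1).re := by gcongr; exact hb x hx
    _ = _ := by
      rw [mul_assoc, ← Real.rpow_add hx0]
      congr 2
      simp; ring

theorem integrableOn_tailMellin (hr : Measurable r) (hb : ∀ x, 1 < x → |r x| ≤ C * x ^ τ)
    (hs : τ < s.re) : IntegrableOn (fun x : ℝ => (r x : ℂ) * (x : ℂ) ^ (-s - 1)) (Ioi 1) := by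
  have hi : IntegrableOn (fun x : ℝ => C * x ^ (τ - s.re - 1)) (Ioi 1) :=
    (integrableOn_Ioi_rpow_of_lt (by linarith) one_pos).const_mul C
  refine Integrable.mono' hi ?_ ?_
  · apply Measurable.aestronglyMeasurable
    fun_prop
  · filter_upwards [ae_restrict_mem measurableSet_Ioi] with x hx
    exact norm_tailMellin_integrand_le hb hx

theorem norm_tailMellin_le (hb : ∀ x, 1 < x → |r x| ≤ C * x ^ τ)
    (hs : τ < s.re) : ‖tailMellin r s‖ ≤ C / (s.re - τ) := by
  have hi : IntegrableOn (fun x : ℝ => C * x ^ (τ - s.re - 1)) (Ioi 1) :=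
    (integrableOn_Ioi_rpow_of_lt (by linarith) one_pos).const_mul C
  refine (norm_integral_le_of_norm_le hi ?_).trans (le_of_eq ?_)
  · filter_upwards [ae_restrict_mem measurableSet_Ioi] with x hx
    exact norm_tailMellin_integrand_le hb hx
  · rw [integral_const_mul, integral_Ioi_rpow_of_lt (by linarith) one_pos]
    simp only [sub_add_cancel, Real.one_rpow]
    rw [← neg_sub s.re τ, neg_div_neg_eq, mul_one_div]

/-- Extended by zero to (0,1], r turns the integral into an ordinary Mellin transform at -s. -/
theorem differentiableAt_tailMellin (hr : Measurable r) (hb : ∀ x, 1 < x → |r x| ≤ C * x ^ τ)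
    (hs : τ < s.re) : DifferentiableAt ℂ (tailMellin r) s := by
  set f : ℝ → ℂ := (Ioi (1 : ℝ)).indicator (fun x => (r x : ℂ)) with hf
  have hmel : tailMellin r = fun s => mellin f (-s) := by
    ext s
    rw [tailMellin, mellin, hf]
    have : ∀ t : ℝ, (t : ℂ) ^ (-s - 1) • (Ioi (1 : ℝ)).indicator (fun x => (r x : ℂ)) t
        = (Ioi (1 : ℝ)).indicator (fun x => (r x : ℂ) * (x : ℂ) ^ (-s - 1)) t := by
      intro t
      by_cases ht : t ∈ Ioi (1 : ℝ)
      · simp [indicator_of_mem ht, mul_comm]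
      · simp [indicator_of_notMem ht]
    simp only [this]
    rw [setIntegral_indicator measurableSet_Ioi]
    congr 2
    ext x
    simp only [mem_Ioi, mem_inter_iff]
    constructor
    · intro h; exact ⟨by linarith, h⟩
    · exact fun h => h.2
  have hfm : Measurable f := by
    have : Measurable fun x => (r x : ℂ) := by fun_prop
    exact this.indicator measurableSet_Ioi
  rw [hmel]
  have hd : DifferentiableAt ℂ (mellin f) (-s) := by
    -- The function vanishes near 0, so any exponent b below Re(-s) serves; only a = -τ is a real
    -- constraint.
    refine mellin_differentiableAt_of_isBigO_rpow (a := -τ) (b := (-s).re - 1) ?_ ?_ ?_ ?_ ?_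
    · have hloc : LocallyIntegrableOn (fun x : ℝ => C * x ^ τ) (Ioi 0) := by
        refine ContinuousOn.locallyIntegrableOn ?_ measurableSet_Ioi
        exact continuousOn_const.mul (continuousOn_id.rpow_const fun x hx => Or.inl (ne_of_gt hx))
      refine hloc.mono hfm.aestronglyMeasurable (Filter.Eventually.of_forall fun x => ?_)
      by_cases hx : x ∈ Ioi (1 : ℝ)
      · rw [hf, indicator_of_mem hx, norm_real]
        exact (hb x hx).trans (le_abs_self _)
      · rw [hf, indicator_of_notMem hx]; simp; positivity
    · refine Asymptotics.IsBigO.of_bound C ?_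
      filter_upwards [Filter.eventually_gt_atTop 1] with x hx
      rw [hf, indicator_of_mem (mem_Ioi.2 hx), norm_real, neg_neg,
        Real.norm_of_nonneg (Real.rpow_nonneg (by linarith) _)]
      exact hb x hx
    · simpa using hs
    · refine Asymptotics.IsBigO.of_bound 0 ?_
      filter_upwards [mem_nhdsWithin_of_mem_nhds (Iio_mem_nhds one_pos)] with x hx
      rw [hf, indicator_of_notMem (by simpa using (le_of_lt hx))]
      simp
    · simp
  exact hd.comp s differentiable_neg.differentiableAt

end TailMellin

/-! ### Dirichlet series as Mellin transforms of summatory functions. -/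

namespace BeurlingSystem

open MeasureTheory Set Complex

variable {G : Type u} [CommMonoid G] (B : BeurlingSystem G)

/-- The summatory function `∑_{|g| ≤ x} a(g)`. -/
noncomputable def summatory (a : G → ℝ) (x : ℝ) : ℝ := ∑ g ∈ (B.finite_norm_le x).toFinset, a g

theorem count_eq_summatory (x : ℝ) : (B.count x : ℝ) = B.summatory (fun _ => 1) x := by
  simp [count, summatory]

variable {B} {a : G → ℝ} {C τ : ℝ}

theorem monotone_summatory (ha : ∀ g, 0 ≤ a g) : Monotone (B.summatory a) := by
  intro x y hxy
  refine Finset.sum_le_sum_of_subset_of_nonneg ?_ fun g _ _ => ha g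
  intro g
  simpa using fun h => h.trans hxy

theorem hasSum_summatory (a : G → ℝ) (x : ℝ) (w : ℂ) :
    HasSum (fun g => (Ici (B.norm g)).indicator (fun _ => (a g : ℂ) * w) x)
      (B.summatory a x * w) := by
  have h : ∀ g ∉ (B.finite_norm_le x).toFinset,
      (Ici (B.norm g)).indicator (fun _ => (a g : ℂ) * w) x = 0 := by
    intro g hg
    exact indicator_of_notMem (by simpa using hg) _
  have key := hasSum_sum_of_ne_finset_zero (L := .unconditional _) h
  convert key using 1
  rw [summatory, ofReal_sum, Finset.sum_mul]
  refine Finset.sum_congr rfl fun g hg => ?_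
  rw [indicator_of_mem (by simpa using hg)]

theorem integral_indicator_cpow (g : G) {s : ℂ} (hs : 0 < s.re) (c : ℂ) :
    ∫ x in Ici (1 : ℝ), (Ici (B.norm g)).indicator (fun x : ℝ => c * (x : ℂ) ^ (-s - 1)) x
      = c * ((B.norm g : ℂ) ^ (-s) / s) := by
  have h1 := B.one_le_norm g
  rw [setIntegral_indicator measurableSet_Ici, Ici_inter_Ici, max_eq_right h1,
    integral_Ici_eq_integral_Ioi, integral_const_mul,
    integral_Ioi_cpow_of_lt (by simp; linarith) (B.norm_pos g)]
  simp

theorem integrable_indicator_cpow (g : G) {s : ℂ} (hs : 0 < s.re) (c : ℂ) :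
    Integrable (fun x : ℝ => (Ici (B.norm g)).indicator (fun x : ℝ => c * (x : ℂ) ^ (-s - 1)) x)
      (volume.restrict (Ici 1)) := by
  have h1 := B.one_le_norm g
  rw [integrable_indicator_iff measurableSet_Ici]
  have : IntegrableOn (fun x : ℝ => c * (x : ℂ) ^ (-s - 1)) (Ici (B.norm g)) := by
    rw [integrableOn_Ici_iff_integrableOn_Ioi]
    exact (integrableOn_Ioi_cpow_of_lt (by simp; linarith) (B.norm_pos g)).const_mul c
  rw [IntegrableOn, Measure.restrict_restrict measurableSet_Ici]
  exact this.mono_set inter_subset_left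

theorem integral_norm_indicator_cpow (g : G) {s : ℂ} (hs : 0 < s.re) {c : ℝ} (hc : 0 ≤ c) :
    ∫ x in Ici (1 : ℝ), ‖(Ici (B.norm g)).indicator (fun x : ℝ => (c : ℂ) * (x : ℂ) ^ (-s - 1)) x‖
      = c * B.norm g ^ (-s.re) / s.re := by
  have h1 := B.one_le_norm g
  simp only [norm_indicator_eq_indicator_norm]
  rw [setIntegral_indicator measurableSet_Ici, Ici_inter_Ici, max_eq_right h1,
    integral_Ici_eq_integral_Ioi]
  have : ∀ x ∈ Ioi (B.norm g), ‖(c : ℂ) * (x : ℂ) ^ (-s - 1)‖ = c * x ^ (-s.re - 1) := by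
    intro x hx
    have hx0 : 0 < x := (B.norm_pos g).trans hx
    rw [norm_mul, norm_real, Real.norm_of_nonneg hc, norm_cpow_eq_rpow_re_of_pos hx0]
    simp
  rw [setIntegral_congr_fun measurableSet_Ioi this, integral_const_mul,
    integral_Ioi_rpow_of_lt (by linarith) (B.norm_pos g)]
  simp
  ring

/-- Each term divided by σ is ∫_{|g|}^∞ a(g)x^(-σ-1) dx. Finite sums of these integrands are
dominated by the summatory function, hence by C x^(τ-σ-1). -/
theorem summable_dirichlet (ha : ∀ g, 0 ≤ a g) (hC : ∀ x, 1 ≤ x → B.summatory a x ≤ C * x ^ τ)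
    (hτ : 0 ≤ τ) {σ : ℝ} (hσ : τ < σ) : Summable fun g => a g * B.norm g ^ (-σ) := by
  have hσ0 : 0 < σ := hτ.trans_lt hσ
  have hs : 0 < (σ : ℂ).re := by simpa using hσ0
  have hC0 : 0 ≤ C := by
    have := hC 1 le_rfl
    rw [Real.one_rpow, mul_one] at this
    exact le_trans (Finset.sum_nonneg fun g _ => ha g) this
  have hi : IntegrableOn (fun x : ℝ => C * x ^ (τ - σ - 1)) (Ici 1) := by
    rw [integrableOn_Ici_iff_integrableOn_Ioi]
    exact (integrableOn_Ioi_rpow_of_lt (by linarith) one_pos).const_mul C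
  have hmain : Summable fun g => a g * B.norm g ^ (-σ) / σ := by
    refine summable_of_sum_le (c := ∫ x in Ici (1 : ℝ), C * x ^ (τ - σ - 1))
      (fun g => div_nonneg (mul_nonneg (ha g) (Real.rpow_nonneg (B.norm_pos g).le _)) hσ0.le) ?_
    intro t
    have e1 : ∀ g, a g * B.norm g ^ (-σ) / σ = ∫ x in Ici (1 : ℝ),
        ‖(Ici (B.norm g)).indicator (fun x : ℝ => (a g : ℂ) * (x : ℂ) ^ (-(σ : ℂ) - 1)) x‖ := by
      intro g
      rw [integral_norm_indicator_cpow g hs (ha g)]; simp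
    simp only [e1]
    rw [← integral_finsetSum _ fun g _ => (integrable_indicator_cpow g hs _).norm]
    refine setIntegral_mono_on
      (integrable_finsetSum _ fun g _ => (integrable_indicator_cpow g hs _).norm) hi
      measurableSet_Ici ?_
    intro x hx
    have hx0 : 0 < x := one_pos.trans_le hx
    have e2 : ∀ g, ‖(Ici (B.norm g)).indicator (fun x : ℝ => (a g : ℂ) * (x : ℂ) ^ (-(σ : ℂ) - 1)) x‖
        = (Ici (B.norm g)).indicator (fun _ => a g) x * x ^ (-σ - 1) := by
      intro g
      by_cases hg : x ∈ Ici (B.norm g)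
      · rw [indicator_of_mem hg, indicator_of_mem hg, norm_mul, norm_real,
          Real.norm_of_nonneg (ha g), norm_cpow_eq_rpow_re_of_pos hx0]
        simp
      · simp [indicator_of_notMem hg]
    simp only [e2]
    rw [← Finset.sum_mul]
    have e3 : ∑ g ∈ t, (Ici (B.norm g)).indicator (fun _ => a g) x ≤ B.summatory a x := by
      classical
      have : ∑ g ∈ t, (Ici (B.norm g)).indicator (fun _ => a g) x
          = ∑ g ∈ t.filter (fun g => B.norm g ≤ x), a g := by
        rw [Finset.sum_filter]
        refine Finset.sum_congr rfl fun g _ => ?_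
        simp [indicator_apply]
      rw [this, summatory]
      refine Finset.sum_le_sum_of_subset_of_nonneg ?_ fun g _ _ => ha g
      intro g hg
      simpa using (Finset.mem_filter.1 hg).2
    calc _ ≤ (C * x ^ τ) * x ^ (-σ - 1) := by
          gcongr
          exact e3.trans (hC x hx)
      _ = C * x ^ (τ - σ - 1) := by
          rw [mul_assoc, ← Real.rpow_add hx0]
          congr 2; ring
  simpa [div_mul_cancel₀ _ hσ0.ne'] using hmain.mul_right σ

/-- Partial summation as an interchange of sum and integral: at each x the indicators of |g| ≤ x add
up to the summatory function. -/
theorem hasSum_dirichlet (ha : ∀ g, 0 ≤ a g) (hC : ∀ x, 1 ≤ x → B.summatory a x ≤ C * x ^ τ)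
    (hτ : 0 ≤ τ) {s : ℂ} (hs : τ < s.re) :
    HasSum (fun g => (a g : ℂ) * (B.norm g : ℂ) ^ (-s)) (s * tailMellin (B.summatory a) s) := by
  have hs0 : 0 < s.re := hτ.trans_lt hs
  have hsne : s ≠ 0 := fun h => by simp [h] at hs0
  have := B.countable
  have h1 := hasSum_integral_of_summable_integral_norm
    (F := fun g (x : ℝ) => (Ici (B.norm g)).indicator (fun x : ℝ => (a g : ℂ) * (x : ℂ) ^ (-s - 1)) x)
    (μ := volume.restrict (Ici 1)) (fun g => integrable_indicator_cpow g hs0 _) (by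
      simp only [fun g => integral_norm_indicator_cpow (B := B) g hs0 (ha g)]
      exact (summable_dirichlet ha hC hτ hs).div_const _)
  simp only [fun g => integral_indicator_cpow (B := B) g hs0 (a g)] at h1
  have h2 : ∫ x in Ici (1 : ℝ), ∑' g, (Ici (B.norm g)).indicator
      (fun x : ℝ => (a g : ℂ) * (x : ℂ) ^ (-s - 1)) x = tailMellin (B.summatory a) s := by
    rw [tailMellin, ← integral_Ici_eq_integral_Ioi]
    congr 1
    ext x
    have := (hasSum_summatory (B := B) a x ((x : ℂ) ^ (-s - 1))).tsum_eq
    rw [← this]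
    congr 1
  rw [h2] at h1
  have h3 : (fun g => (a g : ℂ) * (B.norm g : ℂ) ^ (-s))
      = fun g => s * ((a g : ℂ) * ((B.norm g : ℂ) ^ (-s) / s)) := by
    funext g
    field_simp
  rw [h3]
  exact h1.mul_left s

end BeurlingSystem

/-! ### Continuation of zeta and its logarithmic derivative. -/

namespace BeurlingSystem

open MeasureTheory Set Complex Filter Topology

variable {G : Type u} [CommMonoid G] {B : BeurlingSystem G} {A κ θ : ℝ}

/-- The Dirichlet series `∑ |g|^{-s}`. -/
noncomputable def zetaSum (B : BeurlingSystem G) (s : ℂ) : ℂ := ∑' g : G, (B.norm g : ℂ) ^ (-s)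

/-- The Dirichlet series `∑ Λ(g) |g|^{-s}`. -/
noncomputable def mangoldtSum (B : BeurlingSystem G) (s : ℂ) : ℂ :=
  ∑' g : G, (B.vonMangoldt g : ℂ) * (B.norm g : ℂ) ^ (-s)

/-- The remainder `N(x) - κ (x - 1)`. -/
noncomputable def countRem (B : BeurlingSystem G) (κ x : ℝ) : ℝ := B.count x - κ * (x - 1)

/-- The continuation of `(s - 1) ζ(s)` to `Re s > θ`. -/
noncomputable def zetaReg (B : BeurlingSystem G) (κ : ℝ) (s : ℂ) : ℂ :=
  κ + s * (s - 1) * tailMellin (B.countRem κ) s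

theorem AxiomA.constant_nonneg (hA : B.AxiomA A κ θ) : 0 ≤ A := by
  have := (abs_nonneg _).trans (hA.2.2.2 1 le_rfl)
  simpa using this

theorem monotone_count : Monotone fun x => (B.count x : ℝ) := by
  simp only [count_eq_summatory]
  exact monotone_summatory fun _ => zero_le_one

theorem measurable_countRem : Measurable (B.countRem κ) := by
  have := (monotone_count (B := B)).measurable
  unfold countRem
  fun_prop

theorem AxiomA.abs_countRem_le (hA : B.AxiomA A κ θ) {x : ℝ} (hx : 1 < x) :
    |B.countRem κ x| ≤ A * x ^ θ := hA.2.2.2 x hx.le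

theorem AxiomA.count_le (hA : B.AxiomA A κ θ) {x : ℝ} (hx : 1 ≤ x) :
    (B.count x : ℝ) ≤ (κ + A) * x := by
  have h1 := (abs_le.1 (hA.2.2.2 x hx)).2
  have h2 : x ^ θ ≤ x ^ (1 : ℝ) := Real.rpow_le_rpow_of_exponent_le hx hA.2.2.1.le
  rw [Real.rpow_one] at h2
  have := mul_le_mul_of_nonneg_left h2 hA.constant_nonneg
  nlinarith [hA.1]

theorem AxiomA.summatory_one_le (hA : B.AxiomA A κ θ) (x : ℝ) (hx : 1 ≤ x) :
    B.summatory (fun _ => 1) x ≤ (κ + A) * x ^ (1 : ℝ) := by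
  rw [← count_eq_summatory, Real.rpow_one]
  exact hA.count_le hx

theorem AxiomA.summatory_log_le (hA : B.AxiomA A κ θ) {a : G → ℝ}
    (ha : ∀ g, a g ≤ Real.log (B.norm g)) {τ : ℝ} (hτ : 1 < τ) (x : ℝ) (hx : 1 ≤ x) :
    B.summatory a x ≤ (κ + A) / (τ - 1) * x ^ τ := by
  have hx0 : 0 < x := by linarith
  have h1 : B.summatory a x ≤ B.count x * Real.log x := by
    rw [summatory, count, ← nsmul_eq_mul, ← Finset.sum_const]
    refine Finset.sum_le_sum fun g hg => (ha g).trans ?_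
    exact Real.log_le_log (B.norm_pos g) (by simpa using hg)
  have h2 : Real.log x ≤ x ^ (τ - 1) / (τ - 1) := Real.log_le_rpow_div hx0.le (by linarith)
  have h3 := hA.count_le hx
  have h4 := Real.log_nonneg hx
  have h5 := hA.constant_nonneg
  have h6 := hA.1
  calc _ ≤ (κ + A) * x * (x ^ (τ - 1) / (τ - 1)) := by
        refine h1.trans ?_
        gcongr
    _ = (κ + A) / (τ - 1) * (x ^ (1 : ℝ) * x ^ (τ - 1)) := by rw [Real.rpow_one]; ring
    _ = _ := by rw [← Real.rpow_add hx0]; congr 2; ring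

theorem norm_cpow_neg (g : G) (s : ℂ) : ‖(B.norm g : ℂ) ^ (-s)‖ = B.norm g ^ (-s.re) := by
  rw [norm_cpow_eq_rpow_re_of_pos (B.norm_pos g), neg_re]

theorem AxiomA.summable_rpow (hA : B.AxiomA A κ θ) {σ : ℝ} (hσ : 1 < σ) :
    Summable fun g => B.norm g ^ (-σ) := by
  simpa using summable_dirichlet (fun _ => zero_le_one) hA.summatory_one_le zero_le_one hσ

theorem AxiomA.summable_log_rpow (hA : B.AxiomA A κ θ) {σ : ℝ} (hσ : 1 < σ) :
    Summable fun g => Real.log (B.norm g) * B.norm g ^ (-σ) :=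
  summable_dirichlet (τ := (1 + σ) / 2) (fun g => Real.log_nonneg (B.one_le_norm g))
    (hA.summatory_log_le (fun _ => le_rfl) (by linarith)) (by linarith) (by linarith)

theorem AxiomA.summable_mangoldt_rpow (hA : B.AxiomA A κ θ) {σ : ℝ} (hσ : 1 < σ) :
    Summable fun g => B.vonMangoldt g * B.norm g ^ (-σ) :=
  summable_dirichlet (τ := (1 + σ) / 2) B.vonMangoldt_nonneg
    (hA.summatory_log_le B.vonMangoldt_le_log (by linarith)) (by linarith) (by linarith)

theorem AxiomA.mangoldtSum_eq (hA : B.AxiomA A κ θ) {s : ℂ} (hs : 1 < s.re) :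
    B.mangoldtSum s = s * tailMellin B.psi s :=
  (hasSum_dirichlet (τ := (1 + s.re) / 2) B.vonMangoldt_nonneg
    (hA.summatory_log_le B.vonMangoldt_le_log (by linarith)) (by linarith) (by linarith)).tsum_eq

theorem tailMellin_linear {s : ℂ} (hs : 1 < s.re) :
    tailMellin (fun x => κ * (x - 1)) s = κ / (s * (s - 1)) ∧
      IntegrableOn (fun x : ℝ => ((κ * (x - 1) : ℝ) : ℂ) * (x : ℂ) ^ (-s - 1)) (Ioi 1) := by
  have hs0 : s ≠ 0 := fun h => by simp [h] at hs; linarith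
  have hs1 : s - 1 ≠ 0 := fun h => by
    have := congrArg re h; simp at this; linarith
  have e : EqOn (fun x : ℝ => ((κ * (x - 1) : ℝ) : ℂ) * (x : ℂ) ^ (-s - 1))
      (fun x : ℝ => κ * ((x : ℂ) ^ (-s) - (x : ℂ) ^ (-s - 1))) (Ioi 1) := by
    intro x hx
    have hx0 : (x : ℂ) ≠ 0 := by
      exact_mod_cast (one_pos.trans (mem_Ioi.1 hx)).ne'
    have : (x : ℂ) ^ (-s) = x * (x : ℂ) ^ (-s - 1) := by
      rw [cpow_sub _ _ hx0, cpow_one]; field_simp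
    dsimp only
    rw [this]; push_cast; ring
  have i1 := integrableOn_Ioi_cpow_of_lt (a := -s) (by simpa using hs) one_pos
  have i2 := integrableOn_Ioi_cpow_of_lt (a := -s - 1) (by simp; linarith) one_pos
  constructor
  · rw [tailMellin, setIntegral_congr_fun measurableSet_Ioi e, integral_const_mul,
      integral_sub i1 i2, integral_Ioi_cpow_of_lt (by simpa using hs) one_pos,
      integral_Ioi_cpow_of_lt (by simp; linarith) one_pos]
    simp only [ofReal_one, one_cpow, sub_add_cancel]
    have : -s + 1 ≠ 0 := fun h => hs1 (by linear_combination -h)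
    field_simp
    ring
  · have i3 : IntegrableOn (fun x : ℝ => κ * ((x : ℂ) ^ (-s) - (x : ℂ) ^ (-s - 1))) (Ioi 1) :=
      (i1.sub i2).const_mul (κ : ℂ)
    exact i3.congr_fun e.symm measurableSet_Ioi

/-- The main part κ(x-1) of N has the explicit transform κ/(s(s-1)). The transform of the remainder
also makes sense for Re s > θ, which motivates `zetaReg`. -/
theorem AxiomA.hasSum_zeta (hA : B.AxiomA A κ θ) {s : ℂ} (hs : 1 < s.re) :
    HasSum (fun g => (B.norm g : ℂ) ^ (-s)) (κ / (s - 1) + s * tailMellin (B.countRem κ) s) := by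
  have h1 := hasSum_dirichlet (B := B) (fun _ => zero_le_one) hA.summatory_one_le zero_le_one hs
  have hs0 : s ≠ 0 := fun h => by simp [h] at hs; linarith
  have hs1 : s - 1 ≠ 0 := fun h => by
    have := congrArg re h; simp at this; linarith
  have h2 : tailMellin (B.summatory fun _ => 1) s
      = κ / (s * (s - 1)) + tailMellin (B.countRem κ) s := by
    obtain ⟨e, i⟩ := tailMellin_linear (κ := κ) hs
    have i2 := integrableOn_tailMellin (measurable_countRem (B := B) (κ := κ))
      (fun x hx => hA.abs_countRem_le hx) (hA.2.2.1.trans hs)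
    rw [← e, tailMellin, tailMellin, tailMellin, ← integral_add i i2]
    congr 1
    ext x
    rw [← count_eq_summatory, countRem]
    push_cast; ring
  rw [h2] at h1
  convert h1 using 1
  · ext g; simp
  · field_simp

theorem AxiomA.zetaReg_eq (hA : B.AxiomA A κ θ) {s : ℂ} (hs : 1 < s.re) :
    B.zetaReg κ s = (s - 1) * B.zetaSum s := by
  have hs1 : s - 1 ≠ 0 := fun h => by
    have := congrArg re h; simp at this; linarith
  rw [zetaSum, (hA.hasSum_zeta hs).tsum_eq, zetaReg]
  field_simp

theorem AxiomA.differentiableOn_zetaReg (hA : B.AxiomA A κ θ) :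
    DifferentiableOn ℂ (B.zetaReg κ) {s | θ < s.re} := by
  intro s hs
  have := differentiableAt_tailMellin (measurable_countRem (B := B) (κ := κ))
      (fun x hx => hA.abs_countRem_le hx) hs
  unfold zetaReg
  exact DifferentiableAt.differentiableWithinAt (by fun_prop)

theorem AxiomA.norm_zetaReg_le (hA : B.AxiomA A κ θ) {s : ℂ} (hs : θ < s.re) :
    ‖B.zetaReg κ s‖ ≤ κ + ‖s‖ * ‖s - 1‖ * (A / (s.re - θ)) := by
  have h1 := norm_tailMellin_le (fun x hx => hA.abs_countRem_le hx) hs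
  rw [zetaReg]
  refine (norm_add_le _ _).trans ?_
  rw [norm_mul, norm_mul, norm_real, Real.norm_of_nonneg hA.1.le]
  gcongr

theorem isOpen_halfPlane (θ : ℝ) : IsOpen {s : ℂ | θ < s.re} :=
  isOpen_lt continuous_const continuous_re

/-- The set is a union of four convex pieces (above and below the real axis, right and left of Re s
= 1), joined through overlaps. -/
theorem isPreconnected_halfPlane_diff_one (hθ : θ < 1) :
    IsPreconnected {s : ℂ | θ < s.re ∧ s ≠ 1} := by
  have c1 : IsPreconnected ({s : ℂ | θ < s.re} ∩ {s : ℂ | 0 < s.im}) :=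
    ((convex_halfSpace_re_gt θ).inter (convex_halfSpace_im_gt 0)).isPreconnected
  have c2 : IsPreconnected {s : ℂ | 1 < s.re} := (convex_halfSpace_re_gt 1).isPreconnected
  have c3 : IsPreconnected ({s : ℂ | θ < s.re} ∩ {s : ℂ | s.im < 0}) :=
    ((convex_halfSpace_re_gt θ).inter (convex_halfSpace_im_lt 0)).isPreconnected
  have c4 : IsPreconnected ({s : ℂ | θ < s.re} ∩ {s : ℂ | s.re < 1}) :=
    ((convex_halfSpace_re_gt θ).inter (convex_halfSpace_re_lt 1)).isPreconnected
  have d1 := IsPreconnected.union (2 + I) (by simp; linarith) (by simp) c1 c2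
  have d2 := IsPreconnected.union (2 - I) (by simp) (by simp; linarith) d1 c3
  have m : ((((θ + 1) / 2 : ℝ) : ℂ) + I).re = (θ + 1) / 2 := by simp
  have m1 : ((((θ + 1) / 2 : ℝ) : ℂ) + I) ∈ {s : ℂ | θ < s.re} := by
    rw [mem_ofPred_eq, m]; linarith
  have m2 : ((((θ + 1) / 2 : ℝ) : ℂ) + I) ∈ {s : ℂ | s.re < 1} := by
    rw [mem_ofPred_eq, m]; linarith
  have d3 := IsPreconnected.union _ (mem_union_left _ (mem_union_left _ (mem_inter m1 (by simp))))
    (mem_inter m1 m2) d2 c4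
  convert d3 using 1
  ext s
  simp only [mem_ofPred_eq, mem_union, mem_inter_iff]
  constructor
  · rintro ⟨h1, h2⟩
    rcases lt_trichotomy s.im 0 with h | h | h
    · simp [h1, h]
    · rcases lt_trichotomy s.re 1 with h' | h' | h'
      · simp [h1, h']
      · exact absurd (Complex.ext h' h) h2
      · simp [h']
    · simp [h1, h]
  · rintro (((h | h) | h) | h)
    · exact ⟨h.1, fun e => by simp [e] at h⟩
    · exact ⟨by linarith, fun e => by simp [e] at h⟩
    · exact ⟨h.1, fun e => by simp [e] at h⟩
    · exact ⟨h.1, fun e => by simp [e] at h⟩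

/-- Any admissible continuation Z satisfies (s-1)Z = `zetaReg` near 2, hence on the whole connected
domain, so the choice of Z is immaterial. -/
theorem AxiomA.zetaReg_eq_zero (hA : B.AxiomA A κ θ) {ρ : ℂ} (hρ : B.IsZetaZero θ ρ) :
    B.zetaReg κ ρ = 0 := by
  obtain ⟨h1, h2, Z, ⟨hZd, hZ⟩, hZ0⟩ := hρ
  have hU : IsOpen {s : ℂ | θ < s.re ∧ s ≠ 1} :=
    (isOpen_halfPlane θ).inter isOpen_ne
  have hconn := isPreconnected_halfPlane_diff_one hA.2.2.1
  have a1 : AnalyticOnNhd ℂ (fun s => (s - 1) * Z s) {s : ℂ | θ < s.re ∧ s ≠ 1} :=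
    DifferentiableOn.analyticOnNhd (by fun_prop) hU
  have a2 : AnalyticOnNhd ℂ (B.zetaReg κ) {s : ℂ | θ < s.re ∧ s ≠ 1} :=
    DifferentiableOn.analyticOnNhd (hA.differentiableOn_zetaReg.mono fun s hs => hs.1) hU
  have hθ := hA.2.2.1
  have h2mem : (2 : ℂ) ∈ {s : ℂ | θ < s.re ∧ s ≠ 1} := ⟨by simp; linarith, by norm_num⟩
  have heq := a1.eqOn_of_preconnected_of_eventuallyEq a2 hconn h2mem (by
    have : {s : ℂ | 1 < s.re} ∈ 𝓝 (2 : ℂ) := (isOpen_halfPlane 1).mem_nhds (by simp)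
    filter_upwards [this] with s hs
    rw [hA.zetaReg_eq hs, hZ s hs, zetaSum])
  have := heq ⟨h1, h2⟩
  simpa [hZ0] using this.symm

theorem AxiomA.zetaReal_le (hA : B.AxiomA A κ θ) {σ : ℝ} (hσ : 1 < σ) :
    ∑' g, B.norm g ^ (-σ) ≤ κ / (σ - 1) + σ * (A / (σ - θ)) := by
  have hs : 1 < (σ : ℂ).re := by simpa using hσ
  have h1 := (hA.hasSum_zeta hs).tsum_eq
  have h2 : ∑' g, (B.norm g : ℂ) ^ (-(σ : ℂ)) = ((∑' g, B.norm g ^ (-σ) : ℝ) : ℂ) := by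
    rw [ofReal_tsum]
    congr 1
    ext g
    rw [ofReal_cpow (B.norm_pos g).le]; simp
  rw [h2] at h1
  have h3 : ∑' g, B.norm g ^ (-σ) ≤ ‖((∑' g, B.norm g ^ (-σ) : ℝ) : ℂ)‖ := by
    rw [norm_real]; exact le_abs_self _
  have hθ := hA.2.2.1
  have h4 := norm_tailMellin_le (fun x hx => hA.abs_countRem_le hx)
    (s := (σ : ℂ)) (by simp; linarith)
  refine h3.trans ?_
  rw [h1]
  refine (norm_add_le _ _).trans ?_
  have e1 : ‖(κ : ℂ) / ((σ : ℂ) - 1)‖ = κ / (σ - 1) := by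
    rw [← ofReal_one, ← ofReal_sub, ← ofReal_div, norm_real,
      Real.norm_of_nonneg (div_nonneg hA.1.le (by linarith))]
  rw [e1, norm_mul, norm_real, Real.norm_of_nonneg (by linarith)]
  rw [ofReal_re] at h4
  gcongr

theorem AxiomA.hasDerivAt_zetaSum_log (hA : B.AxiomA A κ θ) {s : ℂ} (hs : 1 < s.re) :
    HasDerivAt B.zetaSum
      (-∑' g, (Real.log (B.norm g) : ℂ) * (B.norm g : ℂ) ^ (-s)) s := by
  set σ := (1 + s.re) / 2
  have hσ : 1 < σ := by simp only [σ]; linarith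
  have hσs : σ < s.re := by simp only [σ]; linarith
  have hne : ∀ g, (B.norm g : ℂ) ≠ 0 := fun g => by exact_mod_cast (B.norm_pos g).ne'
  have hder : ∀ (g : G) (w : ℂ), HasDerivAt (fun w : ℂ => (B.norm g : ℂ) ^ (-w))
      (-((Real.log (B.norm g) : ℂ) * (B.norm g : ℂ) ^ (-w))) w := by
    intro g w
    have := ((hasDerivAt_id w).neg).const_cpow (c := (B.norm g : ℂ)) (Or.inl (hne g))
    refine this.congr_deriv ?_
    rw [ofReal_log (B.norm_pos g).le]
    simp only [Pi.neg_apply, id]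
    ring
  have hbound : ∀ (g : G) (w : ℂ), w ∈ {w : ℂ | σ < w.re} →
      ‖(B.norm g : ℂ) ^ (-w)‖ ≤ B.norm g ^ (-σ) := by
    intro g w hw
    rw [norm_cpow_neg]
    exact Real.rpow_le_rpow_of_exponent_le (B.one_le_norm g) (neg_le_neg (le_of_lt hw))
  have h1 := hasSum_deriv_of_summable_norm (hA.summable_rpow hσ)
    (fun g w _ => (hder g w).differentiableAt.differentiableWithinAt) (isOpen_halfPlane σ)
    hbound hσs
  have h2 : DifferentiableOn ℂ (fun w => ∑' g, (B.norm g : ℂ) ^ (-w)) {w : ℂ | σ < w.re} :=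
    differentiableOn_tsum_of_summable_norm (hA.summable_rpow hσ)
      (fun g w _ => (hder g w).differentiableAt.differentiableWithinAt) (isOpen_halfPlane σ) hbound
  have h3 := (h2.differentiableAt ((isOpen_halfPlane σ).mem_nhds hσs)).hasDerivAt
  refine h3.congr_deriv ?_
  rw [← h1.tsum_eq, ← tsum_neg]
  congr 1
  ext g
  exact (hder g s).deriv

-- This is log = Λ * 1. The double series over pairs p^k ∣ g converges absolutely; rows give log|g|,
-- while the g in a column run over p^k·G and reproduce the whole zeta series.
open Classical in
theorem AxiomA.tsum_log_eq (hA : B.AxiomA A κ θ) {s : ℂ} (hs : 1 < s.re) :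
    ∑' g, (Real.log (B.norm g) : ℂ) * (B.norm g : ℂ) ^ (-s) = B.mangoldtSum s * B.zetaSum s := by
  let f : G → B.primes × ℕ → ℂ := fun g q =>
    (if (q.1 : G) ^ (q.2 + 1) ∣ g then (Real.log (B.norm q.1) : ℂ) else 0) * (B.norm g : ℂ) ^ (-s)
  have hrow : ∀ g, HasSum (f g) ((Real.log (B.norm g) : ℂ) * (B.norm g : ℂ) ^ (-s)) := fun g =>
    (B.hasSum_log_prime_dvd ofRealHom.toAddMonoidHom g).mul_right _
  have hrowR : ∀ g, HasSum (fun q => ‖f g q‖) (Real.log (B.norm g) * B.norm g ^ (-s.re)) := by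
    intro g
    have := (B.hasSum_log_prime_dvd (AddMonoidHom.id ℝ) g).mul_right (B.norm g ^ (-s.re))
    have e : (fun q => ‖f g q‖) = fun q : B.primes × ℕ => (if (q.1 : G) ^ (q.2 + 1) ∣ g then
        AddMonoidHom.id ℝ (Real.log (B.norm q.1)) else 0) * B.norm g ^ (-s.re) := by
      funext q
      simp only [f, norm_mul, norm_cpow_neg]
      split_ifs
      · rw [norm_real, Real.norm_of_nonneg (Real.log_nonneg (B.one_le_norm _))]; rfl
      · simp
    rw [e]
    exact this
  have hsum : Summable (Function.uncurry f) := by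
    refine Summable.of_norm ?_
    rw [summable_prod_of_nonneg (fun _ => norm_nonneg _)]
    refine ⟨fun g => (hrowR g).summable, ?_⟩
    exact (hA.summable_log_rpow hs).congr fun g => ((hrowR g).tsum_eq).symm
  have hcol : ∀ q : B.primes × ℕ, ∑' g, f g q =
      (B.vonMangoldt ((q.1 : G) ^ (q.2 + 1)) : ℂ) * (B.norm ((q.1 : G) ^ (q.2 + 1)) : ℂ) ^ (-s)
        * B.zetaSum s := by
    intro q
    have hinj := B.mul_left_injective ((q.1 : G) ^ (q.2 + 1))
    rw [← hinj.tsum_eq (f := fun g => f g q), zetaSum, ← tsum_mul_left]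
    · congr 1
      ext g
      simp only [f]
      rw [if_pos (dvd_mul_right _ _), B.vonMangoldt_pow q.1 (by omega), map_mul, ofReal_mul,
        mul_cpow_ofReal_nonneg (B.norm_pos _).le (B.norm_pos _).le]
      ring
    · intro g hg
      by_contra hne
      apply hg
      simp only [f]
      rw [if_neg, zero_mul]
      rintro ⟨x, rfl⟩
      exact hne ⟨x, rfl⟩
  calc _ = ∑' g, ∑' q, f g q := by simp only [fun g => (hrow g).tsum_eq]
    _ = ∑' q, ∑' g, f g q := hsum.tsum_comm.symm
    _ = (∑' q : B.primes × ℕ, (B.vonMangoldt ((q.1 : G) ^ (q.2 + 1)) : ℂ) *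
          (B.norm ((q.1 : G) ^ (q.2 + 1)) : ℂ) ^ (-s)) * B.zetaSum s := by
        simp only [hcol]
        rw [tsum_mul_right]
    _ = _ := by
        congr 1
        have hinj : Function.Injective (fun q : B.primes × ℕ => (q.1 : G) ^ (q.2 + 1)) := by
          rintro ⟨p, j⟩ ⟨q, k⟩ h
          obtain ⟨h1, h2⟩ := B.prime_pow_injective (by omega) h
          ext
          · rw [h1]
          · simpa using h2
        rw [mangoldtSum]
        refine hinj.tsum_eq (f := fun g => (B.vonMangoldt g : ℂ) * (B.norm g : ℂ) ^ (-s)) ?_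
        intro g hg
        by_contra hne
        apply hg
        dsimp only
        rw [B.vonMangoldt_eq_zero]
        · simp
        · intro p k h
          exact hne ⟨(p, k), h.symm⟩

theorem AxiomA.hasDerivAt_zetaSum (hA : B.AxiomA A κ θ) {s : ℂ} (hs : 1 < s.re) :
    HasDerivAt B.zetaSum (-(B.mangoldtSum s * B.zetaSum s)) s := by
  rw [← hA.tsum_log_eq hs]
  exact hA.hasDerivAt_zetaSum_log hs

end BeurlingSystem

/-! ### Lower bounds for zeta to the right of 1. -/

namespace BeurlingSystem

open MeasureTheory Set Complex Filter Topology

variable {G : Type u} [CommMonoid G] {B : BeurlingSystem G} {A κ θ : ℝ}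

theorem AxiomA.norm_mangoldtSum_le (hA : B.AxiomA A κ θ) {s : ℂ} (hs : 1 < s.re) :
    ‖B.mangoldtSum s‖ ≤ ∑' g, B.vonMangoldt g * B.norm g ^ (-s.re) := by
  have h : ∀ g, ‖(B.vonMangoldt g : ℂ) * (B.norm g : ℂ) ^ (-s)‖
      = B.vonMangoldt g * B.norm g ^ (-s.re) := fun g => by
    rw [norm_mul, norm_real, Real.norm_of_nonneg (B.vonMangoldt_nonneg g), norm_cpow_neg]
  have := norm_tsum_le_tsum_norm (f := fun g => (B.vonMangoldt g : ℂ) * (B.norm g : ℂ) ^ (-s)) (by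
    simpa only [h] using hA.summable_mangoldt_rpow hs)
  simp only [h] at this
  exact this

theorem mangoldtSum_ofReal (σ : ℝ) :
    B.mangoldtSum σ = ((∑' g, B.vonMangoldt g * B.norm g ^ (-σ) : ℝ) : ℂ) := by
  rw [ofReal_tsum, mangoldtSum]
  congr 1
  ext g
  rw [ofReal_mul, ofReal_cpow (B.norm_pos g).le]; simp

theorem zetaSum_ofReal (σ : ℝ) : B.zetaSum σ = ((∑' g, B.norm g ^ (-σ) : ℝ) : ℂ) := by
  rw [ofReal_tsum, zetaSum]
  congr 1
  ext g
  rw [ofReal_cpow (B.norm_pos g).le]; simp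

theorem AxiomA.tendsto_zetaSum (hA : B.AxiomA A κ θ) (t : ℝ) :
    Tendsto (fun σ : ℝ => B.zetaSum (σ + t * I)) atTop (𝓝 1) := by
  classical
  have h1 : Tendsto (fun σ : ℝ => ∑' g, (B.norm g : ℂ) ^ (-((σ : ℂ) + t * I))) atTop
      (𝓝 (∑' g : G, if g = 1 then (1 : ℂ) else 0)) := by
    refine tendsto_tsum_of_dominated_convergence (hA.summable_rpow one_lt_two) ?_ ?_
    · intro g
      by_cases hg : g = 1
      · simp [hg]
      · rw [if_neg hg, tendsto_zero_iff_norm_tendsto_zero]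
        simp only [norm_cpow_neg]
        have : Tendsto (fun σ : ℝ => B.norm g ^ (-σ)) atTop (𝓝 0) :=
          (tendsto_rpow_atBot_of_base_gt_one _ (B.one_lt_norm hg)).comp tendsto_neg_atTop_atBot
        simpa using this
    · filter_upwards [eventually_ge_atTop 2] with σ hσ g
      rw [norm_cpow_neg]
      exact Real.rpow_le_rpow_of_exponent_le (B.one_le_norm g) (by simpa using hσ)
  rw [tsum_ite_eq] at h1
  exact h1

/-- With L the series `mangoldtSum`, log|ζ(σ+it)ζ(σ)| has σ-derivative -Re(L(σ+it) + L(σ)), which is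
at most 0 because |L(σ+it)| ≤ L(σ). The product therefore decreases to its limit 1 as σ → ∞. -/
theorem AxiomA.one_le_norm_zetaSum_mul (hA : B.AxiomA A κ θ) {s : ℂ} (hs : 1 < s.re) :
    1 ≤ ‖B.zetaSum s‖ * ∑' g, B.norm g ^ (-s.re) := by
  set t := s.im
  set w : ℝ → ℂ := fun σ => B.zetaSum (σ + t * I) * B.zetaSum (σ + (0 : ℝ) * I) with hw
  have hder : ∀ σ : ℝ, 1 < σ → HasDerivAt (fun σ => ‖w σ‖ ^ 2)
      (-2 * ((B.mangoldtSum (σ + t * I) + B.mangoldtSum (σ + (0 : ℝ) * I)).re * ‖w σ‖ ^ 2)) σ := by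
    intro σ hσ
    have aux : ∀ t : ℝ, HasDerivAt (fun σ : ℝ => B.zetaSum (σ + t * I))
        (-(B.mangoldtSum (σ + t * I) * B.zetaSum (σ + t * I))) σ := by
      intro t
      have h1 := hA.hasDerivAt_zetaSum (s := σ + t * I) (by simpa using hσ)
      have h2 : HasDerivAt (fun z : ℂ => z + t * I) 1 (σ : ℂ) := (hasDerivAt_id _).add_const _
      have h3 := (HasDerivAt.comp (σ : ℂ) h1 h2).comp_ofReal
      simpa using h3
    have h4 : HasDerivAt w (-((B.mangoldtSum (σ + t * I) + B.mangoldtSum (σ + (0 : ℝ) * I)) * w σ)) σ := by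
      refine ((aux t).fun_mul (aux 0)).congr_deriv ?_
      simp only [hw]; ring
    have h5 := h4.norm_sq
    refine h5.congr_deriv ?_
    rw [Complex.inner]
    set c := B.mangoldtSum (σ + t * I) + B.mangoldtSum (σ + (0 : ℝ) * I)
    have : -(c * w σ) * (starRingEnd ℂ) (w σ) = -(c * ((‖w σ‖ ^ 2 : ℝ) : ℂ)) := by
      rw [ofReal_pow, ← Complex.mul_conj']; ring
    rw [this, neg_re, re_mul_ofReal]; ring
  have hnonneg : ∀ σ : ℝ, 1 < σ →
      0 ≤ (B.mangoldtSum (σ + t * I) + B.mangoldtSum (σ + (0 : ℝ) * I)).re := by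
    intro σ hσ
    have h1 := hA.norm_mangoldtSum_le (s := σ + t * I) (by simpa using hσ)
    have h2 := neg_le_of_abs_le (abs_re_le_norm (B.mangoldtSum (σ + t * I)))
    have h3 : B.mangoldtSum (σ + (0 : ℝ) * I)
        = ((∑' g, B.vonMangoldt g * B.norm g ^ (-σ) : ℝ) : ℂ) := by
      rw [← mangoldtSum_ofReal]; simp
    rw [h3, add_re, ofReal_re]
    simp only [add_re, ofReal_re, mul_re, I_re, mul_zero, ofReal_im, I_im, mul_one, sub_self,
      add_zero] at h1
    linarith
  have hanti : AntitoneOn (fun σ => ‖w σ‖ ^ 2) (Ioi 1) := by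
    refine antitoneOn_of_deriv_nonpos (convex_Ioi 1)
      (fun σ hσ => (hder σ hσ).continuousAt.continuousWithinAt) ?_ ?_
    · rw [interior_Ioi]
      exact fun σ hσ => (hder σ hσ).differentiableAt.differentiableWithinAt
    · rw [interior_Ioi]
      intro σ hσ
      rw [(hder σ hσ).deriv]
      have := mul_nonneg (hnonneg σ hσ) (sq_nonneg ‖w σ‖)
      linarith
  have hlim : Tendsto (fun σ => ‖w σ‖ ^ 2) atTop (𝓝 1) := by
    have := (((hA.tendsto_zetaSum t).mul (hA.tendsto_zetaSum 0)).norm).pow 2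
    rw [mul_one, norm_one, one_pow] at this
    exact this
  have h1 : 1 ≤ ‖w s.re‖ ^ 2 := by
    refine le_of_tendsto hlim ?_
    filter_upwards [eventually_ge_atTop s.re] with σ hσ
    exact hanti hs (lt_of_lt_of_le hs hσ) hσ
  have h2 : ‖w s.re‖ = ‖B.zetaSum s‖ * ∑' g, B.norm g ^ (-s.re) := by
    rw [hw, norm_mul, re_add_im]
    have : B.zetaSum (s.re + (0 : ℝ) * I) = ((∑' g, B.norm g ^ (-s.re) : ℝ) : ℂ) := by
      rw [← zetaSum_ofReal]; simp
    rw [this, norm_real, Real.norm_of_nonneg (tsum_nonneg fun g => Real.rpow_nonneg (B.norm_pos g).le _)]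
  rw [← h2]
  nlinarith [norm_nonneg (w s.re)]

theorem AxiomA.zetaSum_ne_zero (hA : B.AxiomA A κ θ) {s : ℂ} (hs : 1 < s.re) :
    B.zetaSum s ≠ 0 := by
  intro h
  have := hA.one_le_norm_zetaSum_mul hs
  rw [h] at this
  simp at this
  linarith

theorem AxiomA.zetaReg_ne_zero (hA : B.AxiomA A κ θ) {s : ℂ} (hs : 1 < s.re) :
    B.zetaReg κ s ≠ 0 := by
  rw [hA.zetaReg_eq hs]
  refine mul_ne_zero (fun h => ?_) (hA.zetaSum_ne_zero hs)
  have := congrArg re h; simp at this; linarith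

/-- A uniform lower bound for `(s - 1) ζ(s)` in `Re s ≥ 2`. -/
theorem AxiomA.le_norm_zetaReg (hA : B.AxiomA A κ θ) {s : ℂ} (hs : 2 ≤ s.re) :
    1 ≤ ‖B.zetaReg κ s‖ * (κ + 2 * A) := by
  have hs1 : 1 < s.re := by linarith
  have h1 := hA.one_le_norm_zetaSum_mul hs1
  have hθ := hA.2.2.1
  have h2 : ∑' g, B.norm g ^ (-s.re) ≤ κ + 2 * A := by
    have e : ∑' g, B.norm g ^ (-s.re) ≤ ∑' g, B.norm g ^ (-(2 : ℝ)) :=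
      (hA.summable_rpow hs1).tsum_le_tsum (fun g =>
        Real.rpow_le_rpow_of_exponent_le (B.one_le_norm g) (by linarith)) (hA.summable_rpow one_lt_two)
    have e2 := hA.zetaReal_le one_lt_two
    have e3 : A / (2 - θ) ≤ A := div_le_self hA.constant_nonneg (by linarith)
    have e4 : κ / (2 - 1) = κ := by norm_num
    linarith
  have h3 : 1 ≤ ‖s - 1‖ := by
    have := re_le_norm (s - 1)
    simp at this; linarith
  rw [hA.zetaReg_eq hs1, norm_mul]
  have h4 : 0 ≤ ‖B.zetaSum s‖ := norm_nonneg _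
  have h5 : 0 ≤ κ + 2 * A := by linarith [hA.1, hA.constant_nonneg]
  calc 1 ≤ ‖B.zetaSum s‖ * (κ + 2 * A) := h1.trans (by gcongr)
    _ ≤ ‖s - 1‖ * (‖B.zetaSum s‖ * (κ + 2 * A)) := le_mul_of_one_le_left (by positivity) h3
    _ = _ := by ring

theorem AxiomA.deriv_zetaReg (hA : B.AxiomA A κ θ) {s : ℂ} (hs : 1 < s.re) :
    deriv (B.zetaReg κ) s = B.zetaReg κ s * (1 / (s - 1) - B.mangoldtSum s) := by
  have hs1 : s - 1 ≠ 0 := fun h => by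
    have := congrArg re h; simp at this; linarith
  have h1 : HasDerivAt (fun s => (s - 1) * B.zetaSum s)
      (1 * B.zetaSum s + (s - 1) * -(B.mangoldtSum s * B.zetaSum s)) s :=
    ((hasDerivAt_id s).sub_const 1).fun_mul (hA.hasDerivAt_zetaSum hs)
  have h2 : B.zetaReg κ =ᶠ[𝓝 s] fun s => (s - 1) * B.zetaSum s := by
    filter_upwards [(isOpen_halfPlane 1).mem_nhds hs] with w hw using hA.zetaReg_eq hw
  rw [h2.deriv_eq, h1.deriv, hA.zetaReg_eq hs]
  field_simp
  ring

/-- From Λ(g) ≤ log|g| ≤ 2|g|^(1/2) the sum is at most 2ζ(3/2), bounded in terms of κ and A alone.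
-/
theorem AxiomA.tsum_mangoldt_two_le (hA : B.AxiomA A κ θ) :
    ∑' g, B.vonMangoldt g * B.norm g ^ (-(2 : ℝ)) ≤ 4 * κ + 6 * A := by
  have hb : ∀ g, B.vonMangoldt g * B.norm g ^ (-(2 : ℝ)) ≤ 2 * B.norm g ^ (-(3 / 2 : ℝ)) := by
    intro g
    have h0 := B.norm_pos g
    have h1 : B.vonMangoldt g ≤ B.norm g ^ (1 / 2 : ℝ) / (1 / 2) :=
      (B.vonMangoldt_le_log g).trans (Real.log_le_rpow_div h0.le (by norm_num))
    calc _ ≤ B.norm g ^ (1 / 2 : ℝ) / (1 / 2) * B.norm g ^ (-(2 : ℝ)) := by gcongr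
      _ = 2 * (B.norm g ^ (1 / 2 : ℝ) * B.norm g ^ (-(2 : ℝ))) := by ring
      _ = _ := by rw [← Real.rpow_add h0]; norm_num
  have hs : (1 : ℝ) < 3 / 2 := by norm_num
  have h1 := (hA.summable_mangoldt_rpow one_lt_two).tsum_le_tsum hb
    ((hA.summable_rpow hs).mul_left 2)
  rw [tsum_mul_left] at h1
  have h2 := hA.zetaReal_le hs
  have hθ := hA.2.2.1
  have h3 : A / (3 / 2 - θ) ≤ A / (1 / 2) := by
    have := hA.constant_nonneg
    gcongr; linarith
  have h4 : κ / (3 / 2 - 1) = 2 * κ := by ring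
  linarith

end BeurlingSystem

/-! ### Laplace inversion and integrals against the oscillating weight. -/

namespace IsOscKernel

open MeasureTheory Set Complex Filter Topology

variable {K K' : ℝ → ℝ} {a b w γ : ℝ} {Φ : ℂ → ℂ}

theorem continuous (h : IsOscKernel K K' a b w γ Φ) : Continuous K :=
  continuous_iff_continuousAt.2 fun u => (h.hasDerivAt u).continuousAt

/-- Laplace inversion along the line `Re z = c`. -/
theorem inversion (h : IsOscKernel K K' a b w γ Φ) (c : ℝ)
    (hi : Integrable fun t : ℝ => Φ (c + t * I)) (u : ℝ) :
    ∫ t : ℝ, Φ (c + t * I) * cexp (-((c + t * I) * u)) = 2 * Real.pi * K u := by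
  have hK := h.continuous
  set f : ℝ → ℂ := fun u => (K u : ℂ) * cexp (c * u) with hf
  have hfc : Continuous f := by fun_prop
  have hfi : Integrable f := by
    refine hfc.integrable_of_hasCompactSupport (HasCompactSupport.intro isCompact_Icc (K := Icc a b) ?_)
    intro u hu
    simp [hf, h.eq_zero u hu]
  have hpi := Real.pi_pos
  have hF : ∀ ξ : ℝ, FourierTransform.fourier f ξ = Φ (c + ((-2 * Real.pi * ξ : ℝ) : ℂ) * I) := by
    intro ξ
    rw [Real.fourier_real_eq_integral_exp_smul, ← h.laplace]
    congr 1
    ext v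
    rw [smul_eq_mul, hf, mul_left_comm, ← exp_add]
    congr 2
    push_cast; ring
  have hFi : Integrable (FourierTransform.fourier f) := by
    have : FourierTransform.fourier f = fun ξ : ℝ =>
        (fun t : ℝ => Φ (c + t * I)) ((-2 * Real.pi) * ξ) := by
      ext ξ; rw [hF]
    rw [this]
    exact hi.comp_mul_left' (by linarith)
  have hinv := congrFun (hfc.fourierInv_fourier_eq hfi hFi) u
  rw [Real.fourierInv_eq'] at hinv
  simp only [hF] at hinv
  have e : ∀ v : ℝ, cexp (((2 * Real.pi * inner ℝ v u : ℝ) : ℂ) * I) •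
      Φ (c + ((-2 * Real.pi * v : ℝ) : ℂ) * I)
      = (fun t : ℝ => Φ (c + t * I) * cexp (-(t * I * u))) ((-2 * Real.pi) * v) := by
    intro v
    have hin : inner ℝ v u = u * v := by simp
    rw [hin, smul_eq_mul, mul_comm]
    congr 2
    push_cast; ring
  rw [integral_congr_ae (Eventually.of_forall e), Measure.integral_comp_mul_left
    (fun t : ℝ => Φ (c + t * I) * cexp (-(t * I * u))) (-2 * Real.pi)] at hinv
  have e2 : ∀ t : ℝ, Φ (c + t * I) * cexp (-((c + t * I) * u))
      = cexp (-(c * u)) * (Φ (c + t * I) * cexp (-(t * I * u))) := by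
    intro t
    rw [mul_left_comm, ← exp_add]
    congr 2
    ring
  simp only [e2]
  rw [integral_const_mul]
  have e3 : |(-2 * Real.pi)⁻¹| = (2 * Real.pi)⁻¹ := by
    rw [abs_inv, abs_mul, abs_of_pos hpi]; norm_num
  rw [e3, real_smul] at hinv
  have hp' : (Real.pi : ℂ) ≠ 0 := by exact_mod_cast hpi.ne'
  have e4 : ∫ t : ℝ, Φ (c + t * I) * cexp (-(t * I * u)) = 2 * Real.pi * f u := by
    have h2p : (2 * Real.pi : ℂ) ≠ 0 := mul_ne_zero two_ne_zero hp'
    rw [← hinv, ← mul_assoc, ofReal_inv, ofReal_mul, ofReal_ofNat, mul_inv_cancel₀ h2p, one_mul]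
  rw [e4, hf]
  have : cexp (-(c * u)) * cexp (c * u) = 1 := by rw [← exp_add]; simp
  linear_combination (2 * Real.pi * K u) * this

/-- Write 1/(s-z) = ∫_0^∞ e^(-(s-z)u) du and invert under the integral. As K lives on u > 0, the
half-line recovers all of Φ(z). Each split-off zero is thus evaluated exactly, without residues. -/
theorem integral_div_sub (h : IsOscKernel K K' a b w γ Φ) (ha : 0 < a) {c : ℝ}
    (hi : Integrable fun t : ℝ => Φ (c + t * I)) {z : ℂ} (hz : z.re < c) :
    ∫ t : ℝ, Φ (c + t * I) * (1 / (c + t * I - z)) = 2 * Real.pi * Φ z := by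
  have h1 : ∀ t : ℝ, Φ (c + t * I) * (1 / (c + t * I - z))
      = ∫ u in Ioi (0 : ℝ), Φ (c + t * I) * cexp (-(c + t * I - z) * u) := by
    intro t
    rw [integral_const_mul, integral_exp_mul_complex_Ioi (by simpa using hz)]
    rw [ofReal_zero, mul_zero, exp_zero, neg_div_neg_eq]
  simp only [h1]
  have hintegrable : Integrable (fun p : ℝ × ℝ => Φ (c + p.1 * I) * cexp (-(c + p.1 * I - z) * p.2))
      (volume.prod (volume.restrict (Ioi (0 : ℝ)))) := by
    have h2 : IntegrableOn (fun u : ℝ => cexp (-(c - z) * u)) (Ioi 0) :=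
      integrableOn_exp_mul_complex_Ioi (by simpa using hz) 0
    have h3 := hi.mul_prod h2
    have hm : AEStronglyMeasurable (fun p : ℝ × ℝ => cexp (-(p.1 * I * p.2)))
        (volume.prod (volume.restrict (Ioi (0 : ℝ)))) :=
      Continuous.aestronglyMeasurable (by fun_prop)
    have h4 := h3.bdd_mul (c := 1) hm (Eventually.of_forall fun p => by
      rw [norm_exp]; simp)
    refine h4.congr (Eventually.of_forall fun p => ?_)
    dsimp only
    rw [mul_left_comm, ← exp_add]
    congr 2
    ring
  rw [integral_integral_swap hintegrable]
  have h5 : ∀ u : ℝ, ∫ t : ℝ, Φ (c + t * I) * cexp (-(c + t * I - z) * u)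
      = 2 * Real.pi * (K u * cexp (z * u)) := by
    intro u
    have e : ∀ t : ℝ, Φ (c + t * I) * cexp (-(c + t * I - z) * u)
        = Φ (c + t * I) * cexp (-((c + t * I) * u)) * cexp (z * u) := by
      intro t
      rw [mul_assoc, ← exp_add]
      congr 2; ring
    simp only [e]
    rw [integral_mul_const, h.inversion c hi u]; ring
  simp only [h5]
  rw [integral_const_mul, ← h.laplace z]
  congr 1
  apply setIntegral_eq_integral_of_forall_compl_eq_zero
  intro u hu
  rw [h.eq_zero u]
  · simp
  · intro hu'
    exact hu (ha.trans_le hu'.1)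

/-- The oscillating weight `-(e^{-ρu} K)' = e^{-ρu} (ρ K - K')`. -/
theorem hasDerivAt_exp_mul (h : IsOscKernel K K' a b w γ Φ) (ρ : ℂ) (u : ℝ) :
    HasDerivAt (fun u : ℝ => cexp (-(ρ * u)) * K u) (-(cexp (-(ρ * u)) * (ρ * K u - K' u))) u := by
  have h1 : HasDerivAt (fun u : ℝ => cexp (-(ρ * u))) (cexp (-(ρ * u)) * -(ρ * 1)) u := by
    have := ((hasDerivAt_id (u : ℂ)).const_mul ρ).neg.cexp.comp_ofReal
    exact this
  have h2 := (h.hasDerivAt u).ofReal_comp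
  refine (h1.fun_mul h2).congr_deriv ?_
  ring

theorem continuous_weight (h : IsOscKernel K K' a b w γ Φ) (ρ : ℂ) :
    Continuous fun u : ℝ => cexp (-(ρ * u)) * (ρ * K u - K' u) := by
  have h1 := h.continuous
  have h2 := h.continuous_deriv
  fun_prop

theorem integrable_weight (h : IsOscKernel K K' a b w γ Φ) (ρ : ℂ) :
    Integrable fun u : ℝ => cexp (-(ρ * u)) * (ρ * K u - K' u) :=
  (h.continuous_weight ρ).integrable_of_hasCompactSupport
    (HasCompactSupport.intro (K := Icc a b) isCompact_Icc fun u hu => by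
      simp [h.eq_zero u hu, h.deriv_eq_zero u hu])

theorem integral_Ici_weight (h : IsOscKernel K K' a b w γ Φ) (ρ : ℂ) (c : ℝ) :
    ∫ u in Ici c, cexp (-(ρ * u)) * (ρ * K u - K' u) = cexp (-(ρ * c)) * K c := by
  rw [integral_Ici_eq_integral_Ioi]
  have h1 := integral_Ioi_of_hasDerivAt_of_tendsto (a := c) (m := 0)
    (h.hasDerivAt_exp_mul ρ c).continuousAt.continuousWithinAt
    (fun u _ => h.hasDerivAt_exp_mul ρ u) (h.integrable_weight ρ).neg.integrableOn (by
      refine tendsto_const_nhds.congr' ?_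
      filter_upwards [eventually_gt_atTop b] with u hu
      rw [h.eq_zero u (fun h' => not_lt.2 h'.2 hu)]; simp)
  rw [integral_neg, zero_sub] at h1
  exact neg_injective h1

/-- The derivative of e^u·e^(-ρu)K(u) integrates to zero. This evaluates the main term x in Δ(x) =
ψ(x) - x. -/
theorem integral_exp_weight (h : IsOscKernel K K' a b w γ Φ) (ρ : ℂ) :
    ∫ u : ℝ, (Real.exp u : ℂ) * (cexp (-(ρ * u)) * (ρ * K u - K' u)) = Φ (1 - ρ) := by
  have hK := h.continuous
  have e0 : ∀ u : ℝ, (Real.exp u : ℂ) * (cexp (-(ρ * u)) * K u) = K u * cexp ((1 - ρ) * u) := by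
    intro u
    rw [ofReal_exp, ← mul_assoc, ← exp_add, mul_comm]
    congr 2; ring
  have hd : ∀ u : ℝ, HasDerivAt (fun u : ℝ => (Real.exp u : ℂ) * (cexp (-(ρ * u)) * K u))
      ((Real.exp u : ℂ) * (cexp (-(ρ * u)) * K u) +
        (Real.exp u : ℂ) * -(cexp (-(ρ * u)) * (ρ * K u - K' u))) u := fun u =>
    (Real.hasDerivAt_exp u).ofReal_comp.fun_mul (h.hasDerivAt_exp_mul ρ u)
  have i1 : Integrable fun u : ℝ => (Real.exp u : ℂ) * (cexp (-(ρ * u)) * K u) :=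
    Continuous.integrable_of_hasCompactSupport (by fun_prop)
      (HasCompactSupport.intro (K := Icc a b) isCompact_Icc fun u hu => by
        simp [h.eq_zero u hu])
  have hw := h.continuous_weight ρ
  have i2 : Integrable fun u : ℝ => (Real.exp u : ℂ) * (cexp (-(ρ * u)) * (ρ * K u - K' u)) :=
    Continuous.integrable_of_hasCompactSupport (by fun_prop)
      (HasCompactSupport.intro (K := Icc a b) isCompact_Icc fun u hu => by
        simp [h.eq_zero u hu, h.deriv_eq_zero u hu])
  have i3 : Integrable fun u : ℝ => (Real.exp u : ℂ) * -(cexp (-(ρ * u)) * (ρ * K u - K' u)) := by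
    simp only [mul_neg]
    exact i2.neg
  have h1 := integral_eq_zero_of_hasDerivAt_of_integrable hd (i1.add i3) i1
  rw [integral_add i1 i3] at h1
  simp only [mul_neg, integral_neg, e0, h.laplace] at h1
  linear_combination -h1

end IsOscKernel

/-! ### The prime side of the explicit formula. -/

namespace BeurlingSystem

open MeasureTheory Set Complex Filter Topology

variable {G : Type u} [CommMonoid G] {B : BeurlingSystem G} {A κ θ : ℝ}
  {K K' : ℝ → ℝ} {a b w γ : ℝ} {Φ : ℂ → ℂ}

theorem cpow_neg_eq_exp (g : G) (s : ℂ) :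
    (B.norm g : ℂ) ^ (-s) = cexp (-(s * Real.log (B.norm g))) := by
  rw [cpow_def_of_ne_zero (by exact_mod_cast (B.norm_pos g).ne'), ofReal_log (B.norm_pos g).le]
  congr 1; ring

/-- Partial summation: the smoothed sum over prime powers as an integral of `Δ`. -/
theorem integral_delta_weight (h : IsOscKernel K K' a b w γ Φ) (ρ : ℂ) :
    ∫ u : ℝ, (B.Delta (Real.exp u) : ℂ) * (cexp (-(ρ * u)) * (ρ * K u - K' u))
      = ∑' g, (B.vonMangoldt g : ℂ) * ((B.norm g : ℂ) ^ (-ρ) * K (Real.log (B.norm g)))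
        - Φ (1 - ρ) := by
  classical
  set T := (B.finite_norm_le (Real.exp b)).toFinset with hT
  set k : ℝ → ℂ := fun u => cexp (-(ρ * u)) * (ρ * K u - K' u) with hk
  have hki := h.integrable_weight ρ
  have hk0 : ∀ u, u ∉ Icc a b → k u = 0 := fun u hu => by
    simp [hk, h.eq_zero u hu, h.deriv_eq_zero u hu]
  -- On the support u ≤ b, so ψ(e^u) is a sum of step functions over one fixed finite set, and each
  -- step can be integrated separately.
  have hpt : ∀ u : ℝ, (B.psi (Real.exp u) : ℂ) * k u
      = ∑ g ∈ T, (B.vonMangoldt g : ℂ) * (Ici (Real.log (B.norm g))).indicator k u := by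
    intro u
    by_cases hu : u ∈ Icc a b
    swap
    · rw [hk0 u hu, mul_zero]
      symm
      refine Finset.sum_eq_zero fun g _ => ?_
      by_cases hg : u ∈ Ici (Real.log (B.norm g))
      · rw [indicator_of_mem hg, hk0 u hu, mul_zero]
      · rw [indicator_of_notMem hg, mul_zero]
    rw [psi, ofReal_sum, Finset.sum_mul]
    have hsub : (B.finite_norm_le (Real.exp u)).toFinset ⊆ T := by
      intro g hg
      simp only [hT, Finite.mem_toFinset, mem_ofPred_eq] at hg ⊢
      exact hg.trans (Real.exp_le_exp.2 hu.2)
    have hmem : ∀ g, g ∈ (B.finite_norm_le (Real.exp u)).toFinset ↔ u ∈ Ici (Real.log (B.norm g)) := by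
      intro g
      simp only [Finite.mem_toFinset, mem_ofPred_eq, mem_Ici]
      rw [Real.log_le_iff_le_exp (B.norm_pos g)]
    refine Finset.sum_subset_zero_on_sdiff hsub ?_ ?_
    · intro g hg
      rw [indicator_of_notMem (fun h' => (Finset.mem_sdiff.1 hg).2 ((hmem g).2 h')), mul_zero]
    · intro g hg
      rw [indicator_of_mem ((hmem g).1 hg)]
  have hψi : ∀ g ∈ T, Integrable fun u =>
      (B.vonMangoldt g : ℂ) * (Ici (Real.log (B.norm g))).indicator k u := fun g _ =>
    (hki.indicator measurableSet_Ici).const_mul _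
  have hψ : ∫ u : ℝ, (B.psi (Real.exp u) : ℂ) * k u
      = ∑' g, (B.vonMangoldt g : ℂ) * ((B.norm g : ℂ) ^ (-ρ) * K (Real.log (B.norm g))) := by
    simp only [hpt]
    rw [integral_finsetSum _ hψi, tsum_eq_sum (s := T)]
    · refine Finset.sum_congr rfl fun g _ => ?_
      rw [integral_const_mul, integral_indicator measurableSet_Ici, h.integral_Ici_weight,
        cpow_neg_eq_exp]
    · intro g hg
      rw [h.eq_zero]
      · simp
      · intro h'
        apply hg
        simp only [hT, Finite.mem_toFinset, mem_ofPred_eq]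
        rw [← Real.log_le_iff_le_exp (B.norm_pos g)]
        exact h'.2
  have hψint : Integrable fun u : ℝ => (B.psi (Real.exp u) : ℂ) * k u := by
    simp only [hpt]
    exact integrable_finsetSum _ hψi
  have hkc := h.continuous_weight ρ
  have heint : Integrable fun u : ℝ => (Real.exp u : ℂ) * k u :=
    Continuous.integrable_of_hasCompactSupport (by fun_prop)
      (HasCompactSupport.intro (K := Icc a b) isCompact_Icc fun u hu => by
        simp [hk0 u hu])
  have hsplit : ∀ u : ℝ, (B.Delta (Real.exp u) : ℂ) * k u
      = (B.psi (Real.exp u) : ℂ) * k u - (Real.exp u : ℂ) * k u := by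
    intro u
    rw [Delta]; push_cast; ring
  rw [integral_congr_ae (Eventually.of_forall hsplit)]
  rw [integral_sub hψint heint, hψ, h.integral_exp_weight]

/-- The line lies in the region of absolute convergence, so inversion applies term by term. -/
theorem AxiomA.integral_mangoldtSum (hA : B.AxiomA A κ θ) (h : IsOscKernel K K' a b w γ Φ)
    {ρ : ℂ} {c : ℝ} (hc : 1 < ρ.re + c) (hi : Integrable fun t : ℝ => Φ (c + t * I)) :
    ∫ t : ℝ, Φ (c + t * I) * B.mangoldtSum (ρ + (c + t * I)) = 2 * Real.pi *
      ∑' g, (B.vonMangoldt g : ℂ) * ((B.norm g : ℂ) ^ (-ρ) * K (Real.log (B.norm g))) := by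
  have := B.countable
  set F : G → ℝ → ℂ := fun g t =>
    Φ (c + t * I) * ((B.vonMangoldt g : ℂ) * (B.norm g : ℂ) ^ (-(ρ + (c + t * I)))) with hF
  have hnorm : ∀ g t, ‖F g t‖ = ‖Φ (c + t * I)‖ * (B.vonMangoldt g * B.norm g ^ (-(ρ.re + c))) := by
    intro g t
    rw [hF, norm_mul, norm_mul, norm_cpow_neg, norm_real,
      Real.norm_of_nonneg (B.vonMangoldt_nonneg g)]
    simp
  have hFe : ∀ g t, F g t = (B.vonMangoldt g : ℂ) * (B.norm g : ℂ) ^ (-ρ) *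
      (Φ (c + t * I) * cexp (-((c + t * I) * Real.log (B.norm g)))) := by
    intro g t
    simp only [hF]
    rw [cpow_neg_eq_exp, cpow_neg_eq_exp, add_mul, neg_add, exp_add]
    ring
  have hcont : ∀ g : G, Continuous fun t : ℝ => (B.norm g : ℂ) ^ (-(ρ + (c + t * I))) := by
    intro g
    simp only [cpow_neg_eq_exp]
    fun_prop
  have hintegrable : ∀ g, Integrable (F g) := by
    intro g
    have hm : AEStronglyMeasurable (F g) volume :=
      hi.aestronglyMeasurable.mul
        (Continuous.aestronglyMeasurable (continuous_const.mul (hcont g)))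
    refine (hi.norm.mul_const (B.vonMangoldt g * B.norm g ^ (-(ρ.re + c)))).mono' hm
      (Eventually.of_forall fun t => (hnorm g t).le)
  have h1 := hasSum_integral_of_summable_integral_norm hintegrable (by
    simp only [hnorm, integral_mul_const]
    exact (hA.summable_mangoldt_rpow hc).mul_left _)
  have h2 : ∀ g, ∫ t, F g t = 2 * Real.pi *
      ((B.vonMangoldt g : ℂ) * ((B.norm g : ℂ) ^ (-ρ) * K (Real.log (B.norm g)))) := by
    intro g
    simp only [hFe]
    rw [integral_const_mul, h.inversion c hi]
    ring
  simp only [h2] at h1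
  rw [← tsum_mul_left, h1.tsum_eq]
  congr 1
  ext t
  simp only [hF]
  rw [tsum_mul_left, mangoldtSum]

end BeurlingSystem

/-! ### Shifting a line integral inside a rectangle. -/

section Contour

open MeasureTheory Set Complex Filter Topology

theorem norm_setIntegral_Ioi_le_of_sq {f : ℝ → ℂ} {T C : ℝ} (hT : 1 ≤ T) (hC : 0 ≤ C)
    (hf : ∀ t, T ≤ t → ‖f t‖ ≤ C / t ^ 2) : ‖∫ t in Ioi T, f t‖ ≤ C := by
  have hT0 : 0 < T := by linarith
  have hi : IntegrableOn (fun t : ℝ => C * t ^ (-2 : ℝ)) (Ioi T) :=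
    (integrableOn_Ioi_rpow_of_lt (by norm_num) hT0).const_mul C
  refine (norm_integral_le_of_norm_le hi ?_).trans ?_
  · filter_upwards [ae_restrict_mem measurableSet_Ioi] with t ht
    have ht0 : 0 < t := hT0.trans ht
    refine (hf t (le_of_lt ht)).trans (le_of_eq ?_)
    rw [Real.rpow_neg ht0.le, div_eq_mul_inv]
    norm_num
  · rw [integral_const_mul, integral_Ioi_rpow_of_lt (by norm_num) hT0]
    apply mul_le_of_le_one_right hC
    norm_num
    rw [Real.rpow_neg hT0.le, Real.rpow_one]
    exact inv_le_one_of_one_le₀ hT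

/-- Shifting a line integral to the left inside a rectangle and estimating the rest trivially. -/
theorem norm_integral_line_le {Φ E : ℂ → ℂ} {c δ T e₁ e₂ B₁ B₂ : ℝ} (hT : 1 ≤ T) (hc : -δ ≤ c)
    (he₁ : 0 ≤ e₁) (he₂ : 0 ≤ e₂) (_ : 0 ≤ B₁) (hB₂ : 0 ≤ B₂)
    (hd : DifferentiableOn ℂ (fun z => Φ z * E z) (Icc (-δ) c ×ℂ Icc (-T) T))
    (hE : ∀ z ∈ Icc (-δ) c ×ℂ Icc (-T) T, ‖E z‖ ≤ B₁) (hE' : ∀ t : ℝ, ‖E (c + t * I)‖ ≤ B₂)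
    (hleft : ∀ t : ℝ, ‖Φ ((-δ : ℝ) + t * I)‖ ≤ e₁)
    (hfar : ∀ x ∈ Icc (-δ) c, ∀ t : ℝ, T ≤ |t| → ‖Φ (x + t * I)‖ ≤ e₂ / t ^ 2)
    (hintegrable : Integrable fun t : ℝ => Φ (c + t * I) * E (c + t * I)) :
    ‖∫ t : ℝ, Φ (c + t * I) * E (c + t * I)‖ ≤
      2 * T * (e₁ * B₁) + 2 * ((c + δ) * (e₂ * B₁)) + 2 * (e₂ * B₂) := by
  set f : ℝ → ℂ := fun t => Φ (c + t * I) * E (c + t * I) with hf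
  have hT0 : 0 < T := by linarith
  have htail : ∀ t : ℝ, T ≤ |t| → ‖f t‖ ≤ e₂ * B₂ / t ^ 2 := by
    intro t ht
    rw [hf, norm_mul]
    calc _ ≤ e₂ / t ^ 2 * B₂ := by
          gcongr
          · exact hfar c ⟨hc, le_rfl⟩ t ht
          · exact hE' t
      _ = _ := by ring
  have hsplit : ∫ t, f t = (∫ t in Ioi T, f (-t)) + (∫ t in (-T)..T, f t) + ∫ t in Ioi T, f t := by
    rw [integral_comp_neg_Ioi, ← intervalIntegral.integral_Iic_sub_Iic hintegrable.integrableOn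
      hintegrable.integrableOn, ← intervalIntegral.integral_Iic_add_Ioi hintegrable.integrableOn
      hintegrable.integrableOn (b := T)]
    ring
  have h1 : ‖∫ t in Ioi T, f (-t)‖ ≤ e₂ * B₂ :=
    norm_setIntegral_Ioi_le_of_sq hT (by positivity) (fun t ht => by
      simpa using htail (-t) (by rw [abs_neg]; exact ht.trans (le_abs_self t)))
  have h2 : ‖∫ t in Ioi T, f t‖ ≤ e₂ * B₂ :=
    norm_setIntegral_Ioi_le_of_sq hT (by positivity) (fun t ht =>
      htail t (ht.trans (le_abs_self t)))
  -- Only the segment |t| ≤ T is moved. The left side is small by e₁ and the horizontal sides by e₂;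
  -- the tails stay on the original line, where the bound B₂ holds at every height.
  have hrect := integral_boundary_rect_eq_zero_of_differentiableOn (fun z => Φ z * E z)
    (((-δ : ℝ) : ℂ) + ((-T : ℝ) : ℂ) * I) ((c : ℂ) + (T : ℂ) * I) (by
      simpa [uIcc_of_le hc, uIcc_of_le (show -T ≤ T by linarith)] using hd)
  have r1 : (((-δ : ℝ) : ℂ) + ((-T : ℝ) : ℂ) * I).re = -δ := by simp
  have r2 : (((-δ : ℝ) : ℂ) + ((-T : ℝ) : ℂ) * I).im = -T := by simp
  have r3 : ((c : ℂ) + (T : ℂ) * I).re = c := by simp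
  have r4 : ((c : ℂ) + (T : ℂ) * I).im = T := by simp
  rw [r1, r2, r3, r4] at hrect
  have hhor : ∀ t : ℝ, |t| = T →
      ‖∫ x in (-δ)..c, Φ (x + t * I) * E (x + t * I)‖ ≤ (c + δ) * (e₂ * B₁) := by
    intro t ht
    have := intervalIntegral.norm_integral_le_of_norm_le_const (a := -δ) (b := c) (C := e₂ * B₁)
      (f := fun x : ℝ => Φ (x + t * I) * E (x + t * I)) (fun x hx => by
        rw [uIoc_of_le hc] at hx
        have hx' : x ∈ Icc (-δ) c := ⟨hx.1.le, hx.2⟩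
        rw [norm_mul]
        gcongr
        · refine (hfar x hx' t ht.ge).trans ?_
          apply div_le_self he₂
          rw [← sq_abs, ht]; nlinarith
        · apply hE
          rw [mem_reProdIm]
          simpa using ⟨hx', abs_le.1 ht.le⟩)
    rw [sub_neg_eq_add, abs_of_nonneg (by linarith)] at this
    linarith
  have hl : ‖∫ t in (-T)..T, Φ (((-δ : ℝ) : ℂ) + t * I) * E (((-δ : ℝ) : ℂ) + t * I)‖
      ≤ 2 * T * (e₁ * B₁) := by
    have := intervalIntegral.norm_integral_le_of_norm_le_const (a := -T) (b := T) (C := e₁ * B₁)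
      (f := fun t : ℝ => Φ (((-δ : ℝ) : ℂ) + t * I) * E (((-δ : ℝ) : ℂ) + t * I)) (fun t ht => by
        rw [uIoc_of_le (by linarith)] at ht
        rw [norm_mul]
        gcongr
        · exact hleft t
        · apply hE
          rw [mem_reProdIm]
          simpa using ⟨hc, ht.1.le, ht.2⟩)
    rw [sub_neg_eq_add, abs_of_nonneg (by linarith)] at this
    linarith
  have hmid : ‖∫ t in (-T)..T, f t‖ ≤ 2 * T * (e₁ * B₁) + 2 * ((c + δ) * (e₂ * B₁)) := by
    have e : I • ∫ t in (-T)..T, f t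
        = I • (∫ t in (-T)..T, Φ (((-δ : ℝ) : ℂ) + t * I) * E (((-δ : ℝ) : ℂ) + t * I))
          - (∫ x in (-δ)..c, Φ (x + ((-T : ℝ) : ℂ) * I) * E (x + ((-T : ℝ) : ℂ) * I))
          + ∫ x in (-δ)..c, Φ (x + (T : ℂ) * I) * E (x + (T : ℂ) * I) := by
      linear_combination hrect
    have e' : ‖∫ t in (-T)..T, f t‖ = ‖I • ∫ t in (-T)..T, f t‖ := by rw [norm_smul]; simp
    rw [e', e]
    refine (norm_add_le _ _).trans ?_
    have n1 := norm_sub_le (I • (∫ t in (-T)..T, Φ (((-δ : ℝ) : ℂ) + t * I) * E (((-δ : ℝ) : ℂ) + t * I)))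
      (∫ x in (-δ)..c, Φ (x + ((-T : ℝ) : ℂ) * I) * E (x + ((-T : ℝ) : ℂ) * I))
    have n2 := hhor (-T) (by rw [abs_neg, abs_of_pos hT0])
    have n3 := hhor T (abs_of_pos hT0)
    rw [norm_smul, norm_I, one_mul] at n1
    linarith
  rw [hsplit]
  have := norm_add₃_le (a := ∫ t in Ioi T, f (-t)) (b := ∫ t in (-T)..T, f t)
    (c := ∫ t in Ioi T, f t)
  linarith

end Contour

/-! ### The explicit formula. -/

namespace BeurlingSystem

open MeasureTheory Set Complex Filter Topology

variable {G : Type u} [CommMonoid G] {B : BeurlingSystem G} {A κ θ : ℝ}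
  {K K' : ℝ → ℝ} {a b w γ : ℝ} {Φ : ℂ → ℂ}

theorem AxiomA.re_le_one_of_zetaReg_eq_zero (hA : B.AxiomA A κ θ) {ρ : ℂ}
    (h : B.zetaReg κ ρ = 0) : ρ.re ≤ 1 := by
  by_contra! h1
  exact hA.zetaReg_ne_zero h1 h

theorem integrable_mul_one_div_sub {c : ℝ} (hi : Integrable fun t : ℝ => Φ (c + t * I)) {z : ℂ}
    (hz : z.re < c) : Integrable fun t : ℝ => Φ (c + t * I) * (1 / (c + t * I - z)) := by
  have hne : ∀ t : ℝ, (c : ℂ) + t * I - z ≠ 0 := fun t h => by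
    have := congrArg re h; simp at this; linarith
  have hcont : Continuous fun t : ℝ => 1 / ((c : ℂ) + t * I - z) :=
    continuous_const.div (by fun_prop) hne
  refine (hi.bdd_mul (c := 1 / (c - z.re)) hcont.aestronglyMeasurable
    (Eventually.of_forall fun t => ?_)).congr (Eventually.of_forall fun t => mul_comm _ _)
  rw [norm_div, norm_one]
  have h1 := re_le_norm ((c : ℂ) + t * I - z)
  have h2 : ((c : ℂ) + t * I - z).re = c - z.re := by simp
  rw [h2] at h1
  exact one_div_le_one_div_of_le (by linarith) h1

variable {S : Multiset ℂ} {g : ℂ → ℂ}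

/-- The logarithmic derivative of (s-1)ζ(s) is additive over the factorization, and split-off roots
contribute ∑ 1/(s-ρ). -/
theorem AxiomA.logDeriv_cofactor (hA : B.AxiomA A κ θ)
    (hg : DifferentiableOn ℂ g {s | θ < s.re})
    (hfac : ∀ s, θ < s.re → B.zetaReg κ s = rootProd S s * g s) {s : ℂ} (hs : 1 < s.re) :
    g s ≠ 0 ∧ deriv g s / g s = 1 / (s - 1) - B.mangoldtSum s
      - (S.map (fun ρ => 1 / (s - ρ))).sum := by
  have hsθ : θ < s.re := hA.2.2.1.trans hs
  have h0 := hA.zetaReg_ne_zero hs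
  rw [hfac s hsθ] at h0
  obtain ⟨h1, h2⟩ := mul_ne_zero_iff.1 h0
  refine ⟨h2, ?_⟩
  have hS : s ∉ S := fun h => h1 (rootProd_eq_zero_iff.2 h)
  have e1 := hA.deriv_zetaReg hs
  have hev : B.zetaReg κ =ᶠ[𝓝 s] fun s => rootProd S s * g s := by
    filter_upwards [(isOpen_halfPlane θ).mem_nhds hsθ] with w hw using hfac w hw
  have e2 : deriv (fun s => rootProd S s * g s) s
      = deriv (rootProd S) s * g s + rootProd S s * deriv g s :=
    ((differentiable_rootProd S s).hasDerivAt.fun_mul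
      (hg.differentiableAt ((isOpen_halfPlane θ).mem_nhds hsθ)).hasDerivAt).deriv
  rw [hev.deriv_eq, e2, hfac s hsθ] at e1
  rw [← deriv_rootProd_div S hS]
  field_simp
  linear_combination e1

theorem sum_one_div_norm_le {s : ℂ} (hs : 2 ≤ s.re) (hS : ∀ ρ ∈ S, ρ.re ≤ 1) :
    ‖(S.map (fun ρ => 1 / (s - ρ))).sum‖ ≤ Multiset.card S := by
  induction S using Multiset.induction_on with
  | empty => simp
  | cons ρ S ih =>
    rw [Multiset.map_cons, Multiset.sum_cons, Multiset.card_cons]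
    push_cast
    refine (norm_add_le _ _).trans ?_
    have h1 := ih (fun ρ' h => hS ρ' (Multiset.mem_cons_of_mem h))
    have h2 : ‖1 / (s - ρ)‖ ≤ 1 := by
      rw [norm_div, norm_one]
      have h3 := re_le_norm (s - ρ)
      have h4 := hS ρ (Multiset.mem_cons_self _ _)
      rw [sub_re] at h3
      exact div_le_one_of_le₀ (by linarith) (norm_nonneg _)
    linarith

/-- On Re s = 2 every piece is bounded uniformly in Im s; this controls the parts of the line
integral outside the box. -/
theorem AxiomA.norm_logDeriv_cofactor_le (hA : B.AxiomA A κ θ)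
    (hg : DifferentiableOn ℂ g {s | θ < s.re})
    (hfac : ∀ s, θ < s.re → B.zetaReg κ s = rootProd S s * g s) (hS : ∀ ρ ∈ S, ρ.re ≤ 1)
    {s : ℂ} (hs : s.re = 2) :
    ‖deriv g s / g s‖ ≤ 1 + (4 * κ + 6 * A) + Multiset.card S := by
  rw [(hA.logDeriv_cofactor hg hfac (by linarith)).2]
  have h1 : ‖1 / (s - 1)‖ ≤ 1 := by
    rw [norm_div, norm_one]
    have h3 := re_le_norm (s - 1)
    rw [sub_re, one_re] at h3
    exact div_le_one_of_le₀ (by linarith) (norm_nonneg _)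
  have h2 := hA.norm_mangoldtSum_le (s := s) (by linarith)
  rw [hs] at h2
  have h3 := hA.tsum_mangoldt_two_le
  have h4 := sum_one_div_norm_le hs.ge hS
  have n1 := norm_sub_le (1 / (s - 1) - B.mangoldtSum s) (S.map (fun ρ => 1 / (s - ρ))).sum
  have n2 := norm_sub_le (1 / (s - 1)) (B.mangoldtSum s)
  linarith

theorem integral_sum_one_div (h : IsOscKernel K K' a b w γ Φ) (ha : 0 < a) {c : ℝ} {ρ : ℂ}
    (hi : Integrable fun t : ℝ => Φ (c + t * I)) (hS : ∀ ρ' ∈ S, ρ'.re < ρ.re + c) :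
    (Integrable fun t : ℝ => Φ (c + t * I) *
      (S.map (fun ρ' => 1 / (ρ + (c + t * I) - ρ'))).sum) ∧
    ∫ t : ℝ, Φ (c + t * I) * (S.map (fun ρ' => 1 / (ρ + (c + t * I) - ρ'))).sum
      = 2 * Real.pi * (S.map (fun ρ' => Φ (ρ' - ρ))).sum := by
  induction S using Multiset.induction_on with
  | empty => simp
  | cons ρ₁ S ih =>
    obtain ⟨i1, e1⟩ := ih (fun ρ' h => hS ρ' (Multiset.mem_cons_of_mem h))
    have hz : (ρ₁ - ρ).re < c := by
      have := hS ρ₁ (Multiset.mem_cons_self _ _)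
      rw [sub_re]; linarith
    have i2 := integrable_mul_one_div_sub hi hz
    have e2 := h.integral_div_sub ha hi hz
    have e3 : ∀ t : ℝ, Φ (c + t * I) *
        ((ρ₁ ::ₘ S).map (fun ρ' => 1 / (ρ + (c + t * I) - ρ'))).sum
        = Φ (c + t * I) * (1 / (c + t * I - (ρ₁ - ρ))) +
          Φ (c + t * I) * (S.map (fun ρ' => 1 / (ρ + (c + t * I) - ρ'))).sum := by
      intro t
      rw [Multiset.map_cons, Multiset.sum_cons, mul_add]
      congr 3
      ring
    simp only [e3]
    refine ⟨i2.add i1, ?_⟩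
    rw [integral_add i2 i1, e1, e2, Multiset.map_cons, Multiset.sum_cons]
    ring

/-- The explicit formula: the smoothed `Δ` plus the sum over split-off zeros is a line integral of
the logarithmic derivative of the zero-free cofactor. -/
theorem AxiomA.explicit_formula (hA : B.AxiomA A κ θ) (h : IsOscKernel K K' a b w γ Φ) (ha : 0 < a)
    {ρ : ℂ} {c : ℝ} (hc : ρ.re + c = 2) (hi : Integrable fun t : ℝ => Φ (c + t * I))
    (hg : DifferentiableOn ℂ g {s | θ < s.re})
    (hfac : ∀ s, θ < s.re → B.zetaReg κ s = rootProd S s * g s) (hS : ∀ ρ ∈ S, ρ.re ≤ 1) :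
    (Integrable fun t : ℝ => Φ (c + t * I) *
      (deriv g (ρ + (c + t * I)) / g (ρ + (c + t * I)))) ∧
    2 * Real.pi * ((∫ u : ℝ, (B.Delta (Real.exp u) : ℂ) *
        (cexp (-(ρ * u)) * (ρ * K u - K' u))) + (S.map (fun ρ' => Φ (ρ' - ρ))).sum)
      = -∫ t : ℝ, Φ (c + t * I) * (deriv g (ρ + (c + t * I)) / g (ρ + (c + t * I))) := by
  have hre : ∀ t : ℝ, (ρ + (c + t * I)).re = 2 := fun t => by simp [hc]
  have hcont : Continuous fun t : ℝ => deriv g (ρ + (c + t * I)) / g (ρ + (c + t * I)) := by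
    have hmem : ∀ t : ℝ, ρ + (c + t * I) ∈ {s : ℂ | θ < s.re} := fun t => by
      rw [mem_ofPred_eq, hre]; linarith [hA.2.2.1]
    refine Continuous.div ?_ ?_ fun t =>
      (hA.logDeriv_cofactor hg hfac (s := ρ + (c + t * I)) (by rw [hre]; norm_num)).1
    · exact (hg.deriv (isOpen_halfPlane θ)).continuousOn.comp_continuous (by fun_prop) hmem
    · exact hg.continuousOn.comp_continuous (by fun_prop) hmem
  have i1 : Integrable fun t : ℝ => Φ (c + t * I) *
      (deriv g (ρ + (c + t * I)) / g (ρ + (c + t * I))) :=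
    (hi.bdd_mul hcont.aestronglyMeasurable (Eventually.of_forall fun t =>
      hA.norm_logDeriv_cofactor_le hg hfac hS (hre t))).congr
        (Eventually.of_forall fun t => mul_comm _ _)
  refine ⟨i1, ?_⟩
  obtain ⟨i2, e2⟩ := integral_sum_one_div (S := S) (ρ := ρ) h ha hi (fun ρ' h' => by
    have := hS ρ' h'; linarith)
  have hz : (1 - ρ).re < c := by rw [sub_re, one_re]; linarith
  have i3 := integrable_mul_one_div_sub hi hz
  have i31 : Integrable fun t : ℝ => Φ (c + t * I) * (1 / (c + t * I - (1 - ρ))) -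
      Φ (c + t * I) * (deriv g (ρ + (c + t * I)) / g (ρ + (c + t * I))) := i3.sub i1
  have e3 := h.integral_div_sub ha hi hz
  have e4 := hA.integral_mangoldtSum h (ρ := ρ) (c := c) (by linarith) hi
  rw [integral_delta_weight h ρ]
  -- The term 1/(s-1) integrates to 2πΦ(1-ρ), which cancels the contribution of the main term x.
  have hpt : ∀ t : ℝ, Φ (c + t * I) * B.mangoldtSum (ρ + (c + t * I))
      = Φ (c + t * I) * (1 / (c + t * I - (1 - ρ))) -
        Φ (c + t * I) * (deriv g (ρ + (c + t * I)) / g (ρ + (c + t * I))) -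
        Φ (c + t * I) * (S.map (fun ρ' => 1 / (ρ + (c + t * I) - ρ'))).sum := by
    intro t
    rw [(hA.logDeriv_cofactor hg hfac (s := ρ + (c + t * I)) (by rw [hre]; norm_num)).2,
      show (c : ℂ) + t * I - (1 - ρ) = ρ + (c + t * I) - 1 by ring]
    ring
  rw [integral_congr_ae (Eventually.of_forall hpt), integral_sub i31 i2,
    integral_sub i3 i1, e2, e3] at e4
  linear_combination -e4

end BeurlingSystem

/-! ### Zeros of zeta in discs. -/

namespace BeurlingSystem

open MeasureTheory Set Complex Filter Topology Metric

variable {G : Type u} [CommMonoid G] {B : BeurlingSystem G} {A κ θ : ℝ}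

theorem sub_le_re_of_mem_closedBall {X τ r : ℝ} {s : ℂ} (h : s ∈ closedBall (⟨X, τ⟩ : ℂ) r) :
    X - r ≤ s.re := by
  rw [mem_closedBall, dist_eq] at h
  have := (abs_le.1 ((abs_re_le_norm _).trans h)).1
  rw [sub_re] at this
  simp only at this
  linarith

/-- Bound for `(s - 1) ζ(s)` on the disc with centre `X + iτ` that stays `δ` away from the line
`Re s = θ`. -/
noncomputable def discBound (A κ X τ δ : ℝ) : ℝ := κ + (2 * X + |τ| + 1) ^ 2 * (A / δ)

/-- Logarithm of the ratio between `discBound` and the value at the centre of the disc. -/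
noncomputable def discLog (A κ X τ δ : ℝ) : ℝ := Real.log ((κ + 2 * A) * discBound A κ X τ δ)

variable {X τ δ : ℝ}

theorem AxiomA.norm_zetaReg_le_discBound (hA : B.AxiomA A κ θ) (hX : 2 ≤ X) (hδ : 0 < δ) {s : ℂ}
    (hs : s ∈ closedBall (⟨X, τ⟩ : ℂ) (X - θ - δ)) : ‖B.zetaReg κ s‖ ≤ discBound A κ X τ δ := by
  have h1 := sub_le_re_of_mem_closedBall hs
  have hA0 := hA.constant_nonneg
  have hθ := hA.2.1
  rw [mem_closedBall, dist_eq] at hs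
  have hc : ‖(⟨X, τ⟩ : ℂ)‖ ≤ X + |τ| := by
    refine (norm_le_abs_re_add_abs_im _).trans ?_
    simp only
    rw [abs_of_nonneg (by linarith)]
  have n1 : ‖s‖ ≤ 2 * X + |τ| := by
    have := norm_add_le (s - ⟨X, τ⟩) (⟨X, τ⟩ : ℂ)
    rw [sub_add_cancel] at this
    linarith
  have n2 : ‖s - 1‖ ≤ 2 * X + |τ| + 1 := by
    have := norm_sub_le s 1
    rw [norm_one] at this
    linarith
  refine (hA.norm_zetaReg_le (by linarith)).trans ?_
  rw [discBound, sq]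
  have h2 : δ ≤ s.re - θ := by linarith
  have h3 : 0 ≤ A / (s.re - θ) := div_nonneg hA0 (by linarith)
  have n1' : ‖s‖ ≤ 2 * X + |τ| + 1 := by linarith
  gcongr

theorem AxiomA.one_le_mul_discBound (hA : B.AxiomA A κ θ) (hX : 2 ≤ X) (hδ : 0 < δ)
    (hδ' : δ ≤ X - θ) : 1 ≤ (κ + 2 * A) * discBound A κ X τ δ := by
  have h1 := hA.le_norm_zetaReg (s := ⟨X, τ⟩) hX
  have h2 := hA.norm_zetaReg_le_discBound (τ := τ) (s := ⟨X, τ⟩) hX hδ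
    (mem_closedBall_self (by linarith))
  have := hA.1
  have := hA.constant_nonneg
  nlinarith

theorem AxiomA.discBound_div_le (hA : B.AxiomA A κ θ) (hX : 2 ≤ X) (hδ : 0 < δ) :
    discBound A κ X τ δ / ‖B.zetaReg κ ⟨X, τ⟩‖ ≤ (κ + 2 * A) * discBound A κ X τ δ := by
  have h1 := hA.le_norm_zetaReg (s := ⟨X, τ⟩) hX
  have h0 := norm_pos_iff.2 (hA.zetaReg_ne_zero (s := ⟨X, τ⟩) (by simp only; linarith))
  have hA0 := hA.constant_nonneg
  have hD : 0 ≤ discBound A κ X τ δ := by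
    rw [discBound]
    have := hA.1
    positivity
  rw [div_le_iff₀ h0]
  nlinarith

/-- Jensen's bound with radii X-θ-2δ and X-θ-δ, for which log(R/r) ≥ δ/X. -/
theorem AxiomA.card_le_discLog (hA : B.AxiomA A κ θ) (hX : 2 ≤ X) (hδ : 0 < δ)
    (hδ' : 2 * δ < X - θ) {S : Multiset ℂ} {g : ℂ → ℂ} (hg : DifferentiableOn ℂ g {s | θ < s.re})
    (hfac : ∀ s, θ < s.re → B.zetaReg κ s = rootProd S s * g s)
    (hS : ∀ ρ ∈ S, ρ ∈ closedBall (⟨X, τ⟩ : ℂ) (X - θ - 2 * δ)) :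
    Multiset.card S ≤ X / δ * discLog A κ X τ δ := by
  have hsub : closedBall (⟨X, τ⟩ : ℂ) (X - θ - δ) ⊆ {s | θ < s.re} := fun s hs => by
    have := sub_le_re_of_mem_closedBall hs
    rw [mem_ofPred_eq]; linarith
  have hθ := hA.2.1
  have h0 := hA.zetaReg_ne_zero (s := ⟨X, τ⟩) (by simp only; linarith)
  have hD := hA.norm_zetaReg_le_discBound (τ := τ) hX hδ (mem_closedBall_self (by linarith))
  have h1 := card_mul_log_le (B := discBound A κ X τ δ) (r := X - θ - 2 * δ) (R := X - θ - δ)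
    (by linarith) (by linarith) (hg.mono hsub) (fun z hz => hfac z (hsub hz)) h0 hS
    (fun z hz => hA.norm_zetaReg_le_discBound hX hδ (sphere_subset_closedBall hz))
  have h2 : Real.log (discBound A κ X τ δ / ‖B.zetaReg κ ⟨X, τ⟩‖) ≤ discLog A κ X τ δ :=
    Real.log_le_log (div_pos ((norm_pos_iff.2 h0).trans_le hD) (norm_pos_iff.2 h0))
      (hA.discBound_div_le hX hδ)
  have h3 : δ / X ≤ Real.log ((X - θ - δ) / (X - θ - 2 * δ)) := by
    have := Real.one_sub_inv_le_log_of_pos (x := (X - θ - δ) / (X - θ - 2 * δ))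
      (div_pos (by linarith) (by linarith))
    refine le_trans ?_ this
    rw [inv_div, one_sub_div (by linarith)]
    have e : X - θ - δ - (X - θ - 2 * δ) = δ := by ring
    rw [e]
    exact div_le_div_of_nonneg_left hδ.le (by linarith) (by linarith)
  have h4 : (Multiset.card S : ℝ) * (δ / X) ≤ discLog A κ X τ δ :=
    (mul_le_mul_of_nonneg_left h3 (by positivity)).trans (h1.trans h2)
  have hX0 : 0 < X := by linarith
  calc (Multiset.card S : ℝ) = X / δ * (Multiset.card S * (δ / X)) := by field_simp
    _ ≤ _ := by gcongr

/-- Splitting off the zeros in a disc, with a bound for the logarithmic derivative of the rest. -/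
theorem AxiomA.exists_disc_cofactor (hA : B.AxiomA A κ θ) (hX : 2 ≤ X) (hδ : 0 < δ) (τ : ℝ)
    (hδ' : 4 * δ ≤ X - θ) :
    ∃ (S : Multiset ℂ) (g : ℂ → ℂ), DifferentiableOn ℂ g {s | θ < s.re} ∧
      (∀ s, θ < s.re → B.zetaReg κ s = rootProd S s * g s) ∧
      (∀ ρ ∈ S, θ < ρ.re) ∧ (Multiset.card S ≤ X / δ * discLog A κ X τ δ) ∧
      ∀ s ∈ closedBall (⟨X, τ⟩ : ℂ) (X - θ - 4 * δ), g s ≠ 0 ∧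
        ‖deriv g s / g s‖ ≤ 2 * (1 + 2 * (X / δ) ^ 2 * discLog A κ X τ δ) * X / δ ^ 2 := by
  set c : ℂ := ⟨X, τ⟩ with hc
  have hθ := hA.2.1
  have hsub : closedBall c (X - θ - δ) ⊆ {s | θ < s.re} := fun s hs => by
    have := sub_le_re_of_mem_closedBall hs
    rw [mem_ofPred_eq]; linarith
  have h0 := hA.zetaReg_ne_zero (s := c) (by simp only [hc]; linarith)
  obtain ⟨S, g, hg, hfac, hg0, hS⟩ := exists_eq_rootProd_mul (isOpen_halfPlane θ)
    hA.differentiableOn_zetaReg (r := X - θ - 2 * δ) (R := X - θ - δ) (by linarith) (by linarith)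
    hsub h0
  have hcard := hA.card_le_discLog hX hδ (by linarith) hg hfac hS
  have hL0 : 0 ≤ discLog A κ X τ δ :=
    Real.log_nonneg (hA.one_le_mul_discBound hX hδ (by linarith))
  refine ⟨S, g, hg, hfac, fun ρ hρ => ?_, hcard, fun s hs => ⟨?_, ?_⟩⟩
  · have := sub_le_re_of_mem_closedBall (hS ρ hρ)
    linarith
  · exact hg0 s (closedBall_subset_closedBall (by linarith) hs)
  set L := discLog A κ X τ δ with hL
  set n := Multiset.card S with hn
  have hX0 : 0 < X := by linarith
  -- Every split-off root is at least δ away from the outer circle, so dividing by the root product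
  -- costs δ^(-n) there, and inside by the maximum principle.
  have hgsph : ∀ z ∈ closedBall c (X - θ - δ), ‖g z‖ ≤ discBound A κ X τ δ / δ ^ n := by
    intro z hz
    rw [← closure_ball c (by linarith : X - θ - δ ≠ 0)] at hz
    refine Complex.norm_le_of_forall_mem_frontier_norm_le isBounded_ball
      (DifferentiableOn.diffContOnCl ((hg.mono hsub).mono ?_)) ?_ hz
    · rw [closure_ball c (by linarith : X - θ - δ ≠ 0)]
    · intro w hw
      rw [frontier_ball c (by linarith : X - θ - δ ≠ 0)] at hw
      have hw' := sphere_subset_closedBall hw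
      have hr : δ ^ n ≤ ‖rootProd S w‖ := by
        apply le_norm_rootProd hδ.le
        intro ρ hρ
        have h1 := hS ρ hρ
        rw [mem_closedBall, dist_eq] at h1
        rw [mem_sphere, dist_eq] at hw
        have := norm_sub_le (w - ρ) (c - ρ)
        rw [sub_sub_sub_cancel_right, hw, norm_sub_rev c ρ] at this
        linarith
      have hF := hA.norm_zetaReg_le_discBound hX hδ hw'
      rw [hfac w (hsub hw'), norm_mul] at hF
      rw [le_div_iff₀ (by positivity)]
      calc ‖g w‖ * δ ^ n ≤ ‖g w‖ * ‖rootProd S w‖ := by gcongr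
        _ ≤ _ := by rw [mul_comm]; exact hF
  have hgc : ‖B.zetaReg κ c‖ / X ^ n ≤ ‖g c‖ := by
    rw [div_le_iff₀ (by positivity), hfac c (hsub (mem_closedBall_self (by linarith))), norm_mul,
      mul_comm]
    gcongr
    apply norm_rootProd_le
    intro ρ hρ
    have h1 := hS ρ hρ
    rw [mem_closedBall, dist_eq, norm_sub_rev] at h1
    linarith
  have hpos := norm_pos_iff.2 h0
  have hXδ : 1 ≤ X / δ := by rw [one_le_div hδ]; linarith
  -- Compared with the centre, where the root product is at most X^n, the loss is (X/δ)^n. This is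
  -- harmless because n ≤ (X/δ)L.
  have hbound : ∀ z ∈ ball c (X - θ - 2 * δ),
      ‖g z‖ ≤ Real.exp (1 + 2 * (X / δ) ^ 2 * L) * ‖g c‖ := by
    intro z hz
    have h1 := hgsph z (closedBall_subset_closedBall (by linarith) (ball_subset_closedBall hz))
    have h2 : discBound A κ X τ δ / δ ^ n
        ≤ (κ + 2 * A) * discBound A κ X τ δ * (X / δ) ^ n * (‖B.zetaReg κ c‖ / X ^ n) := by
      have h3 := hA.discBound_div_le (τ := τ) hX hδ
      rw [div_le_iff₀ hpos] at h3
      calc discBound A κ X τ δ / δ ^ n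
          ≤ (κ + 2 * A) * discBound A κ X τ δ * ‖B.zetaReg κ c‖ / δ ^ n := by gcongr
        _ = _ := by rw [div_pow]; field_simp
    have h5 : (κ + 2 * A) * discBound A κ X τ δ = Real.exp L := by
      rw [hL, discLog, Real.exp_log]
      linarith [hA.one_le_mul_discBound (τ := τ) hX hδ (by linarith)]
    have h6 : (X / δ) ^ n ≤ Real.exp ((X / δ) ^ 2 * L) := by
      calc (X / δ) ^ n ≤ (Real.exp (X / δ)) ^ n := by
            gcongr
            linarith [Real.add_one_le_exp (X / δ)]
        _ = Real.exp (n * (X / δ)) := by rw [Real.exp_nat_mul]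
        _ ≤ _ := by
            rw [Real.exp_le_exp]
            calc (n : ℝ) * (X / δ) ≤ X / δ * L * (X / δ) := by gcongr
              _ = _ := by ring
    calc ‖g z‖ ≤ _ := h1.trans h2
      _ ≤ Real.exp L * Real.exp ((X / δ) ^ 2 * L) * ‖g c‖ := by
          rw [h5]; gcongr
      _ ≤ _ := by
          gcongr
          rw [← Real.exp_add, Real.exp_le_exp]
          nlinarith [mul_le_mul_of_nonneg_right (one_le_pow₀ hXδ (n := 2)) hL0]
  have key := norm_deriv_div_le (r := X - θ - 4 * δ) (R := X - θ - 2 * δ) (c := c)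
    (M := 1 + 2 * (X / δ) ^ 2 * L) (by linarith) (by linarith) (by positivity)
    (hg.mono ((ball_subset_closedBall.trans (closedBall_subset_closedBall (by linarith))).trans hsub))
    (fun z hz => hg0 z (ball_subset_closedBall hz)) hbound hs
  refine key.trans ?_
  have e : X - θ - 2 * δ - (X - θ - 4 * δ) = 2 * δ := by ring
  rw [e, div_le_div_iff₀ (by positivity) (by positivity)]
  have hM : 0 ≤ 1 + 2 * (X / δ) ^ 2 * L := by positivity
  have : (1 + 2 * (X / δ) ^ 2 * L) * δ ^ 2 * (X - θ - 2 * δ)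
      ≤ (1 + 2 * (X / δ) ^ 2 * L) * δ ^ 2 * X :=
    mul_le_mul_of_nonneg_left (by linarith) (by positivity)
  linarith

end BeurlingSystem

/-! ### From discs to rectangles. -/

namespace BeurlingSystem

open MeasureTheory Set Complex Filter Topology Metric

variable {G : Type u} [CommMonoid G] {B : BeurlingSystem G} {A κ θ : ℝ} {X τ δ : ℝ}

theorem discLog_le (hκ : 0 < κ) (hA : 0 ≤ A) (hX : 2 ≤ X) (hδ : 0 < δ) (hδ1 : δ ≤ 1) :
    discLog A κ X τ δ ≤
      2 * Real.log (κ + 2 * A + 1) + 2 * Real.log (2 * X + |τ| + 1) + Real.log (1 / δ) := by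
  have hP : 1 ≤ 2 * X + |τ| + 1 := by linarith [abs_nonneg τ]
  have hK : 0 < κ + 2 * A + 1 := by linarith
  have hP' : 0 < 2 * X + |τ| + 1 := by linarith
  have e : 2 * Real.log (κ + 2 * A + 1) + 2 * Real.log (2 * X + |τ| + 1) + Real.log (1 / δ)
      = Real.log ((κ + 2 * A + 1) ^ 2 * (2 * X + |τ| + 1) ^ 2 * (1 / δ)) := by
    rw [Real.log_mul (by positivity) (by positivity), Real.log_mul (by positivity) (by positivity),
      Real.log_pow, Real.log_pow]
    norm_num
  rw [e, discLog, discBound]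
  set P := 2 * X + |τ| + 1
  refine Real.log_le_log (by positivity) ?_
  have h1 : 1 ≤ P ^ 2 * (1 / δ) := by
    have h2 : 1 ≤ 1 / δ := by rw [le_div_iff₀ hδ]; linarith
    nlinarith [one_le_pow₀ hP (n := 2)]
  have h3 : κ + P ^ 2 * (A / δ) ≤ (κ + A) * (P ^ 2 * (1 / δ)) := by
    have : P ^ 2 * (A / δ) = A * (P ^ 2 * (1 / δ)) := by ring
    rw [this]
    nlinarith
  calc (κ + 2 * A) * (κ + P ^ 2 * (A / δ))
      ≤ (κ + 2 * A + 1) * ((κ + 2 * A + 1) * (P ^ 2 * (1 / δ))) := by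
        refine mul_le_mul (by linarith) (h3.trans ?_) (by positivity) hK.le
        exact mul_le_mul_of_nonneg_right (by linarith) (by positivity)
    _ = _ := by ring

/-- Pythagoras: (X-a)² + T² ≤ (X-a+η)² as soon as T² ≤ 2η(X-a). A far centre makes the disc nearly a
half-plane, and a short rectangle fits even with X = 2. -/
theorem mem_closedBall_of_rect {a T η : ℝ} {s : ℂ} (h1 : a ≤ s.re) (h2 : s.re ≤ X)
    (h3 : |s.im - τ| ≤ T) (hη : 0 ≤ η) (hT : T ^ 2 ≤ η * (2 * (X - a))) :
    s ∈ closedBall (⟨X, τ⟩ : ℂ) (X - a + η) := by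
  rw [mem_closedBall, dist_eq]
  refine le_of_sq_le_sq ?_ (by linarith)
  rw [← normSq_eq_norm_sq, normSq_apply, sub_re, sub_im]
  simp only
  have h4 : (s.im - τ) * (s.im - τ) ≤ T ^ 2 := by
    rw [← sq, ← sq_abs]; gcongr
  have h5 : (s.re - X) * (s.re - X) ≤ (X - a) ^ 2 := by
    rw [← neg_mul_neg, ← sq]
    have : 0 ≤ -(s.re - X) := by linarith
    gcongr
    linarith
  nlinarith [sq_nonneg η]

theorem log_one_div_le {x : ℝ} (hx : 0 < x) : Real.log (1 / x) ≤ 1 / x := by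
  have := Real.log_le_sub_one_of_pos (one_div_pos.2 hx)
  linarith

/-- Splitting off zeros so that the logarithmic derivative of the cofactor is polynomially bounded
on a rectangle of height `2T` around `γ`. -/
theorem exists_rect_cofactor (hκ : 0 < κ) (hA0 : 0 ≤ A) {T : ℝ} (hT : 1 ≤ T) :
    ∃ C : ℝ, 1 ≤ C ∧ ∀ (G : Type u) [CommMonoid G] (B : BeurlingSystem G), B.AxiomA A κ θ →
      ∀ d γ y : ℝ, 0 < d → θ + d ≤ 1 → 1 ≤ y → |γ| ≤ Real.exp y →
      ∃ (S : Multiset ℂ) (g : ℂ → ℂ), DifferentiableOn ℂ g {s | θ < s.re} ∧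
        (∀ s, θ < s.re → B.zetaReg κ s = rootProd S s * g s) ∧
        (∀ ρ ∈ S, θ < ρ.re) ∧ (Multiset.card S ≤ C * (y / d) ^ 3) ∧
        ∀ s : ℂ, θ + d / 2 ≤ s.re → s.re ≤ 2 → |s.im - γ| ≤ T →
          g s ≠ 0 ∧ ‖deriv g s / g s‖ ≤ C * (y / d) ^ 8 := by
  set C₁ := 2 * Real.log (κ + 2 * A + 1) + 2 * Real.log (10 * T ^ 2) + Real.log 16 + 5 with hC₁
  have hC₁1 : 5 ≤ C₁ := by
    have h1 : 0 ≤ Real.log (κ + 2 * A + 1) := Real.log_nonneg (by linarith)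
    have h2 : 0 ≤ Real.log (10 * T ^ 2) := Real.log_nonneg (by nlinarith)
    have h3 : 0 ≤ Real.log 16 := Real.log_nonneg (by norm_num)
    linarith
  have hT0 : 0 < T := by linarith
  set D := 64 * T ^ 2 with hD
  have hD1 : 1 ≤ D := by rw [hD]; nlinarith
  set C₂ := 1 + 2 * D ^ 2 * C₁ with hC₂
  have hC₂1 : 1 ≤ C₂ := by
    have : 0 ≤ 2 * D ^ 2 * C₁ := by positivity
    linarith
  refine ⟨max (D * C₁) (2 * C₂ * (16 * D)), le_max_of_le_left (by nlinarith), ?_⟩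
  intro G _ B hA d γ y hd hd1 hy hγ
  have hθ := hA.2.1
  have hd1' : d ≤ 1 := by linarith
  set Q := y / d with hQ
  have hdQ : 1 / d ≤ Q := by rw [hQ]; gcongr
  have hd1d : 1 ≤ 1 / d := by rw [le_div_iff₀ hd]; linarith
  have hQ1 : 1 ≤ Q := hd1d.trans hdQ
  have hyQ : y ≤ Q := by
    rw [hQ, le_div_iff₀ hd]; nlinarith
  -- This X is large enough that the inner disc, for δ = d/16, contains the whole rectangle. The
  -- resulting powers of 1/d are affordable, since they meet the factor e^(-7dy).
  set X := 2 + 2 * T ^ 2 / d with hX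
  have hT2 : 1 ≤ T ^ 2 := one_le_pow₀ hT
  have hTd : 2 * T ^ 2 / d = 2 * T ^ 2 * (1 / d) := by ring
  have hX4 : X ≤ 4 * T ^ 2 * (1 / d) := by
    rw [hX, hTd]; nlinarith
  have hX2 : 2 ≤ X := by rw [hX]; linarith [show 0 ≤ 2 * T ^ 2 / d by positivity]
  have hXδ : X / (d / 16) ≤ D * Q ^ 2 := by
    calc X / (d / 16) = X * (16 * (1 / d)) := by field_simp
      _ ≤ 4 * T ^ 2 * Q * (16 * Q) := by
          have : X ≤ 4 * T ^ 2 * Q := hX4.trans (by gcongr)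
          gcongr
      _ = _ := by rw [hD]; ring
  have hXδ2 : X / (d / 16) ^ 2 ≤ 16 * D * Q ^ 3 := by
    calc X / (d / 16) ^ 2 = X / (d / 16) * (16 * (1 / d)) := by field_simp
      _ ≤ D * Q ^ 2 * (16 * Q) := by gcongr
      _ = _ := by ring
  have hL : discLog A κ X γ (d / 16) ≤ C₁ * Q := by
    refine (discLog_le hκ hA0 hX2 (by positivity) (by linarith)).trans ?_
    have hP : Real.log (2 * X + |γ| + 1) ≤ Real.log (10 * T ^ 2) + y + 1 / d := by
      have h1 : 2 * X + |γ| + 1 ≤ 10 * T ^ 2 * Real.exp y * (1 / d) := by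
        have h2 : 1 ≤ Real.exp y := Real.one_le_exp (by linarith)
        have h4 : 1 ≤ T ^ 2 * (1 / d) := by nlinarith
        have h3 : T ^ 2 * (1 / d) ≤ T ^ 2 * (1 / d) * Real.exp y :=
          le_mul_of_one_le_right (by positivity) h2
        have h5 : Real.exp y ≤ T ^ 2 * (1 / d) * Real.exp y :=
          le_mul_of_one_le_left (by positivity) h4
        linarith
      calc _ ≤ Real.log (10 * T ^ 2 * Real.exp y * (1 / d)) :=
            Real.log_le_log (by positivity) h1
        _ = Real.log (10 * T ^ 2) + y + Real.log (1 / d) := by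
            rw [Real.log_mul (by positivity) (by positivity),
              Real.log_mul (by positivity) (by positivity), Real.log_exp]
        _ ≤ _ := by linarith [log_one_div_le hd]
    have hδ : Real.log (1 / (d / 16)) ≤ Real.log 16 + 1 / d := by
      rw [show 1 / (d / 16) = 16 * (1 / d) by field_simp,
        Real.log_mul (by norm_num) (by positivity)]
      linarith [log_one_div_le hd]
    have hb : 0 ≤ C₁ - 5 := by linarith
    calc _ ≤ C₁ - 5 + 2 * y + 3 * (1 / d) := by rw [hC₁]; linarith
      _ ≤ (C₁ - 5) * Q + 2 * Q + 3 * Q := by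
          nlinarith [mul_le_mul_of_nonneg_left hQ1 hb]
      _ = _ := by ring
  have hL0 : 0 ≤ discLog A κ X γ (d / 16) :=
    Real.log_nonneg (hA.one_le_mul_discBound hX2 (by positivity) (by linarith))
  obtain ⟨S, g, hg, hfac, hSre, hcard, hbd⟩ := hA.exists_disc_cofactor hX2
    (show 0 < d / 16 by positivity) γ (by linarith)
  refine ⟨S, g, hg, hfac, hSre, hcard.trans ?_, fun s h1 h2 h3 => ?_⟩
  · calc X / (d / 16) * discLog A κ X γ (d / 16) ≤ D * Q ^ 2 * (C₁ * Q) := by gcongr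
      _ = D * C₁ * Q ^ 3 := by ring
      _ ≤ _ := by gcongr; exact le_max_left _ _
  · have hmem : s ∈ closedBall (⟨X, γ⟩ : ℂ) (X - θ - 4 * (d / 16)) := by
      have h6 : d * X = 2 * d + 2 * T ^ 2 := by rw [hX]; field_simp
      have h7 : 0 ≤ d * (1 - θ - d) := mul_nonneg hd.le (by linarith)
      have h8 : 0 ≤ d * d := by positivity
      have := mem_closedBall_of_rect (η := d / 4) h1 (h2.trans hX2) h3 (by positivity)
        (by linarith)
      rwa [show X - (θ + d / 2) + d / 4 = X - θ - 4 * (d / 16) by ring] at this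
    obtain ⟨h4, h5⟩ := hbd s hmem
    refine ⟨h4, h5.trans ?_⟩
    calc 2 * (1 + 2 * (X / (d / 16)) ^ 2 * discLog A κ X γ (d / 16)) * X / (d / 16) ^ 2
        = 2 * (1 + 2 * (X / (d / 16)) ^ 2 * discLog A κ X γ (d / 16)) * (X / (d / 16) ^ 2) := by
          ring
      _ ≤ 2 * (1 * Q ^ 5 + 2 * (D * Q ^ 2) ^ 2 * (C₁ * Q)) * (16 * D * Q ^ 3) := by
          have : 1 ≤ 1 * Q ^ 5 := by rw [one_mul]; exact one_le_pow₀ hQ1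
          gcongr
      _ = 2 * C₂ * (16 * D) * Q ^ 8 := by rw [hC₂]; ring
      _ ≤ _ := by gcongr; exact le_max_right _ _

end BeurlingSystem

/-! ### Counting zeros in rectangles. -/

theorem Multiset.card_le_mul_of_fiber {α : Type*} (S : Multiset α) (f : α → ℕ) (N : ℕ) {M : ℝ}
    (hf : ∀ a ∈ S, f a < N) (hM : ∀ j < N, (Multiset.card (S.filter (f · = j)) : ℝ) ≤ M) :
    (Multiset.card S : ℝ) ≤ N * M := by
  have h : Multiset.card S = ∑ j ∈ Finset.range N, Multiset.card (S.filter (f · = j)) := by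
    clear hM
    induction S using Multiset.induction_on with
    | empty => simp
    | cons a S ih =>
      have h1 : ∀ j, Multiset.card ((a ::ₘ S).filter (f · = j))
          = (if f a = j then 1 else 0) + Multiset.card (S.filter (f · = j)) := by
        intro j
        split_ifs with h
        · rw [Multiset.filter_cons_of_pos (p := (f · = j)) S h, Multiset.card_cons, add_comm]
        · rw [Multiset.filter_cons_of_neg (p := (f · = j)) S h, zero_add]
      rw [Finset.sum_congr rfl fun j _ => h1 j, Finset.sum_add_distrib,
        ← ih (fun b hb => hf b (Multiset.mem_cons_of_mem hb)), Finset.sum_ite_eq,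
        if_pos (Finset.mem_range.2 (hf a (Multiset.mem_cons_self _ _))), Multiset.card_cons,
        add_comm]
  rw [h]
  push_cast
  calc _ ≤ ∑ _j ∈ Finset.range N, M := Finset.sum_le_sum fun j hj => hM j (Finset.mem_range.1 hj)
    _ = _ := by simp

namespace BeurlingSystem

open MeasureTheory Set Complex Filter Topology Metric

variable {G : Type u} [CommMonoid G] {B : BeurlingSystem G} {A κ θ : ℝ}

/-- Unwanted roots are returned to the cofactor. Jensen's bound can then be applied to any selection
of roots lying in one disc. -/
theorem exists_cofactor_filter {S : Multiset ℂ} {g : ℂ → ℂ}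
    (hg : DifferentiableOn ℂ g {s | θ < s.re})
    (hfac : ∀ s, θ < s.re → B.zetaReg κ s = rootProd S s * g s) (p : ℂ → Prop) [DecidablePred p] :
    ∃ g' : ℂ → ℂ, DifferentiableOn ℂ g' {s | θ < s.re} ∧
      ∀ s, θ < s.re → B.zetaReg κ s = rootProd (S.filter p) s * g' s := by
  refine ⟨fun s => rootProd (S.filter (¬ p ·)) s * g s,
    (differentiable_rootProd _).differentiableOn.mul hg, fun s hs => ?_⟩
  rw [hfac s hs, ← mul_assoc, ← rootProd_add, Multiset.filter_add_not]

/-- The number of zeros in a rectangle of bounded height. -/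
theorem exists_card_rect_le (hκ : 0 < κ) (hA0 : 0 ≤ A) {T : ℝ} (hT : 1 ≤ T) :
    ∃ C : ℝ, 1 ≤ C ∧ ∀ (G : Type u) [CommMonoid G] (B : BeurlingSystem G), B.AxiomA A κ θ →
      ∀ d γ : ℝ, 0 < d → θ + d ≤ 1 → 0 < γ → ∀ (S : Multiset ℂ) (g : ℂ → ℂ),
        DifferentiableOn ℂ g {s | θ < s.re} →
        (∀ s, θ < s.re → B.zetaReg κ s = rootProd S s * g s) →
        (∀ ρ ∈ S, θ + d / 2 ≤ ρ.re ∧ ρ.re ≤ 1 ∧ |ρ.im - γ| ≤ T) →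
        Multiset.card S ≤ C * (Real.log (γ + 5) / d ^ 2) := by
  set k := 2 * Real.log (κ + 2 * A + 1) + 2 * Real.log (T + 1) + Real.log 8 with hk
  have hk0 : 0 ≤ k := by
    have h1 : 0 ≤ Real.log (κ + 2 * A + 1) := Real.log_nonneg (by linarith)
    have h2 : 0 ≤ Real.log (T + 1) := Real.log_nonneg (by linarith)
    have h3 : 0 ≤ Real.log 8 := Real.log_nonneg (by norm_num)
    linarith
  refine ⟨5 * T * (16 * (k + 4)), by nlinarith, ?_⟩
  intro G _ B hA d γ hd hd1 hγ S g hg hfac hS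
  have hθ := hA.2.1
  have hθ1 := hA.2.2.1
  -- Windows of height √d/2 are the right scale: a disc centred at abscissa 2 deviates from its
  -- vertical tangent by the order of d over a height √d.
  set q := Real.sqrt d with hq
  have hq0 : 0 < q := Real.sqrt_pos.2 hd
  have hqd : q ^ 2 = d := Real.sq_sqrt hd.le
  have hq1 : q ≤ 1 := by nlinarith
  set ℓ := Real.log (γ + 5) with hℓ
  have hℓ1 : 1 ≤ ℓ := by
    rw [hℓ, Real.le_log_iff_exp_le (by linarith)]
    linarith [Real.exp_one_lt_d9]
  set f : ℂ → ℕ := fun ρ => ⌊(ρ.im - γ + T) / (q / 2)⌋₊ with hf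
  set N := ⌊4 * T / q⌋₊ + 1 with hN
  have hT0 : 0 < T := by linarith
  have hNle : (N : ℝ) ≤ 5 * T / q := by
    rw [hN]
    push_cast
    have h1 := Nat.floor_le (show 0 ≤ 4 * T / q by positivity)
    have h2 : 1 ≤ T / q := by rw [le_div_iff₀ hq0]; linarith
    calc _ ≤ 4 * T / q + T / q := by linarith
      _ = _ := by ring
  have hpos : ∀ ρ ∈ S, 0 ≤ (ρ.im - γ + T) / (q / 2) := fun ρ hρ => by
    have := (abs_le.1 (hS ρ hρ).2.2).1
    exact div_nonneg (by linarith) (by positivity)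
  have hcount := S.card_le_mul_of_fiber f N (M := 16 * (k + 4) * (ℓ / (d * q))) (fun ρ hρ => by
      rw [hf, hN, Nat.lt_succ_iff]
      apply Nat.floor_le_floor
      have := (abs_le.1 (hS ρ hρ).2.2).2
      calc (ρ.im - γ + T) / (q / 2) ≤ (2 * T) / (q / 2) := by gcongr; linarith
        _ = _ := by field_simp; norm_num) (fun j hj => by
      obtain ⟨g', hg', hfac'⟩ := exists_cofactor_filter hg hfac (f · = j)
      set τ := γ - T + j * (q / 2) with hτ
      have hj' : (j : ℝ) * (q / 2) ≤ 2 * T := by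
        have h1 : (j : ℝ) ≤ 4 * T / q :=
          (Nat.le_floor_iff (by positivity)).1 (Nat.lt_succ_iff.1 hj)
        calc (j : ℝ) * (q / 2) ≤ 4 * T / q * (q / 2) := by gcongr
          _ = _ := by field_simp; norm_num
      have hτa : |τ| ≤ γ + T := by
        have : 0 ≤ (j : ℝ) * (q / 2) := by positivity
        rw [abs_le]; constructor <;> linarith
      have hcard := hA.card_le_discLog (X := 2) (τ := τ) (δ := d / 8) le_rfl (by positivity)
        (by linarith) hg' hfac' (fun ρ hρ => by
          obtain ⟨hρS, hρj⟩ := Multiset.mem_filter.1 hρ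
          obtain ⟨h1, h2, -⟩ := hS ρ hρS
          have h3 := Nat.floor_le (hpos ρ hρS)
          have h4 := Nat.lt_floor_add_one ((ρ.im - γ + T) / (q / 2))
          change ⌊(ρ.im - γ + T) / (q / 2)⌋₊ = j at hρj
          rw [hρj, le_div_iff₀ (by positivity)] at h3
          rw [hρj, div_lt_iff₀ (by positivity)] at h4
          have := mem_closedBall_of_rect (X := 2) (τ := τ) (T := q / 2) (η := d / 4) h1
            (by linarith) (by rw [abs_le]; constructor <;> linarith) (by positivity)
            (by rw [div_pow, hqd]; nlinarith)
          rwa [show 2 - (θ + d / 2) + d / 4 = 2 - θ - 2 * (d / 8) by ring] at this)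
      -- Estimating log(1/d) by 2/√d costs half a power of d. With one power from Jensen and half a
      -- power from the number of windows, the total is d^(-2).
      have hL : discLog A κ 2 τ (d / 8) ≤ (k + 4) * (ℓ / q) := by
        refine (discLog_le hκ hA0 le_rfl (by positivity) (by linarith)).trans ?_
        have hP : Real.log (2 * 2 + |τ| + 1) ≤ Real.log (T + 1) + ℓ := by
          rw [hℓ, ← Real.log_mul (by positivity) (by positivity)]
          refine Real.log_le_log (by positivity) ?_
          nlinarith
        have hδ : Real.log (1 / (d / 8)) ≤ Real.log 8 + 2 * (1 / q) := by
          rw [show 1 / (d / 8) = 8 * (1 / q) ^ 2 by rw [← hqd]; field_simp,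
            Real.log_mul (by norm_num) (by positivity), Real.log_pow]
          have := log_one_div_le hq0
          push_cast
          linarith
        have h1q : 1 ≤ 1 / q := by rw [le_div_iff₀ hq0]; linarith
        have e1 : ℓ / q = ℓ * (1 / q) := by ring
        have e2 : 1 / q ≤ ℓ / q := by rw [e1]; exact le_mul_of_one_le_left (by positivity) hℓ1
        have e3 : ℓ ≤ ℓ / q := by rw [e1]; exact le_mul_of_one_le_right (by positivity) h1q
        calc _ ≤ k * 1 + 2 * ℓ + 2 * (1 / q) := by
              rw [hk]
              generalize Real.log (2 * 2 + |τ| + 1) = a at hP ⊢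
              linarith
          _ ≤ k * (ℓ / q) + 2 * (ℓ / q) + 2 * (ℓ / q) := by gcongr; linarith
          _ = _ := by ring
      calc _ ≤ 2 / (d / 8) * ((k + 4) * (ℓ / q)) := hcard.trans (by gcongr)
        _ = _ := by field_simp; norm_num)
  refine hcount.trans ?_
  calc (N : ℝ) * (16 * (k + 4) * (ℓ / (d * q)))
      ≤ 5 * T / q * (16 * (k + 4) * (ℓ / (d * q))) := by gcongr
    _ = 5 * T * (16 * (k + 4)) * (ℓ / (d * q ^ 2)) := by field_simp
    _ = _ := by rw [hqd]; ring

end BeurlingSystem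

/-! ### Vertical decay of the kernel transform. -/

section KernelDecay

open MeasureTheory Set Complex

variable {Φ : ℂ → ℂ} {y : ℝ}

/-- After two powers of |Im z| are kept for integrability, at least y-2 remain. With |Im z| ≥ e^60
and y ≥ 60 they give e^(60(y-2)) ≥ e^(58y), and 58 = 44 + 14. -/
theorem norm_le_exp_div_sq (hy : 60 ≤ y)
    (h : ∀ z : ℂ, |z.re| ≤ 2 → z ≠ 0 → ‖Φ z‖ ≤ Real.exp (44 * y) / ‖z‖ ^ ⌈y⌉₊) {z : ℂ}
    (hre : |z.re| ≤ 2) (him : Real.exp 60 ≤ |z.im|) : ‖Φ z‖ ≤ Real.exp (-(14 * y)) / z.im ^ 2 := by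
  have h0 : 0 < |z.im| := (Real.exp_pos _).trans_le him
  have hz : z ≠ 0 := fun h => by simp [h] at h0
  refine (h z hre hz).trans ?_
  obtain ⟨k, hk⟩ : ∃ k, ⌈y⌉₊ = 2 + k := Nat.exists_eq_add_of_le (by
    have : (2 : ℝ) ≤ (⌈y⌉₊ : ℝ) := le_trans (by linarith) (Nat.le_ceil y)
    exact_mod_cast this)
  have hk' : y - 2 ≤ k := by
    have := Nat.le_ceil y
    rw [hk] at this
    push_cast at this
    linarith
  have h1 : Real.exp (58 * y) ≤ |z.im| ^ k := by
    calc Real.exp (58 * y) ≤ Real.exp (k * 60) := Real.exp_le_exp.2 (by linarith)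
      _ = Real.exp 60 ^ k := Real.exp_nat_mul _ _
      _ ≤ _ := by gcongr
  have h2 : z.im ^ 2 * Real.exp (58 * y) ≤ ‖z‖ ^ ⌈y⌉₊ := by
    calc z.im ^ 2 * Real.exp (58 * y) ≤ |z.im| ^ 2 * |z.im| ^ k := by rw [sq_abs]; gcongr
      _ = |z.im| ^ ⌈y⌉₊ := by rw [hk, pow_add]
      _ ≤ _ := by gcongr; exact abs_im_le_norm z
  have hsq : 0 < z.im ^ 2 := by rw [← sq_abs]; positivity
  calc Real.exp (44 * y) / ‖z‖ ^ ⌈y⌉₊ ≤ Real.exp (44 * y) / (z.im ^ 2 * Real.exp (58 * y)) := by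
        gcongr
    _ = Real.exp (44 * y) * (Real.exp (58 * y))⁻¹ / z.im ^ 2 := by field_simp
    _ = _ := by rw [← Real.exp_neg, ← Real.exp_add]; ring_nf

theorem integrable_of_le_one_div_sq {f : ℝ → ℂ} (hf : Continuous f) {T : ℝ} (hT : 1 ≤ T)
    (h : ∀ t, T ≤ |t| → ‖f t‖ ≤ 1 / t ^ 2) : Integrable f := by
  obtain ⟨M, hM⟩ := (isCompact_Icc (a := -T) (b := T)).exists_bound_of_continuousOn hf.continuousOn
  have hM0 : 0 ≤ M := (norm_nonneg _).trans (hM 0 ⟨by linarith, by linarith⟩)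
  refine (integrable_inv_one_add_sq.const_mul (M * (1 + T ^ 2) + 2)).mono'
    hf.aestronglyMeasurable (Filter.Eventually.of_forall fun t => ?_)
  rw [← div_eq_mul_inv, le_div_iff₀ (by positivity)]
  rcases le_total T |t| with ht | ht
  · have h1 := h t ht
    have h2 : 1 ≤ t ^ 2 := by rw [← sq_abs]; nlinarith
    rw [le_div_iff₀ (by positivity)] at h1
    have h3 : ‖f t‖ ≤ 1 := by nlinarith [norm_nonneg (f t)]
    have : 0 ≤ M * (1 + T ^ 2) := by positivity
    linarith
  · have h1 := hM t (abs_le.1 ht)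
    have h2 : t ^ 2 ≤ T ^ 2 := by rw [← sq_abs]; gcongr
    have : ‖f t‖ * (1 + t ^ 2) ≤ M * (1 + T ^ 2) := by gcongr
    linarith

end KernelDecay

/-! ### The smoothed error term against a power sum over zeros. -/

namespace BeurlingSystem

open MeasureTheory Set Complex Filter Topology Metric

variable {G : Type u} [CommMonoid G] {B : BeurlingSystem G} {A κ θ : ℝ}

/-- A unimodular c rotates the integral onto the nonnegative real axis, so only the real part of the
weight matters. The factor e^(-βu) absorbs the growth of Δ, and the kernel's oscillation bound
finishes. -/
theorem norm_integral_delta_weight_le {K K' : ℝ → ℝ} {a b w γ : ℝ} {Φ : ℂ → ℂ}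
    (h : IsOscKernel K K' a b w γ Φ) {ρ : ℂ} (hρ : ρ ≠ 0) (hγ : ρ.im = γ) {m : ℝ} (hm : 0 ≤ m)
    (hΔ : ∀ u ∈ Icc a b, |B.Delta (Real.exp u)| ≤ m * Real.exp (ρ.re * u)) :
    ‖∫ u : ℝ, (B.Delta (Real.exp u) : ℂ) * (cexp (-(ρ * u)) * (ρ * K u - K' u))‖
      ≤ m * (2 / Real.pi * (‖ρ‖ + 15 / (w ^ 2 * ‖ρ‖))) := by
  set f : ℝ → ℂ := fun u => (B.Delta (Real.exp u) : ℂ) * (cexp (-(ρ * u)) * (ρ * K u - K' u))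
    with hf
  by_cases hi : Integrable f
  swap
  · rw [integral_undef hi, norm_zero]
    have := Real.pi_pos
    positivity
  obtain ⟨c, hc, hcI⟩ : ∃ c : ℂ, ‖c‖ = 1 ∧ c * ∫ u, f u = ‖∫ u, f u‖ := by
    by_cases h0 : ∫ u, f u = 0
    · exact ⟨1, by simp, by simp [h0]⟩
    · have hn := norm_ne_zero_iff.2 h0
      refine ⟨‖∫ u, f u‖ / ∫ u, f u, ?_, ?_⟩
      · rw [norm_div, norm_real, norm_norm, div_self hn]
      · rw [div_mul_cancel₀ _ h0]
  have e1 : ‖∫ u, f u‖ = ∫ u, (c * f u).re := by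
    have h1 : ∫ u, (c * f u).re = (∫ u, c * f u).re :=
      integral_re (𝕜 := ℂ) (hi.const_mul c)
    rw [h1, integral_const_mul, hcI, ofReal_re]
  have hcont : Continuous fun u : ℝ => |(c * cexp (-(I * γ * u)) * (ρ * K u - K' u)).re| := by
    have h1 := h.continuous
    have h2 := h.continuous_deriv
    fun_prop
  have hi2 : Integrable fun u : ℝ => |(c * cexp (-(I * γ * u)) * (ρ * K u - K' u)).re| :=
    hcont.integrable_of_hasCompactSupport
      (HasCompactSupport.intro (K := Icc a b) isCompact_Icc fun u hu => by
        simp [h.eq_zero u hu, h.deriv_eq_zero u hu])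
  rw [e1]
  calc ∫ u, (c * f u).re
      ≤ ∫ u : ℝ, m * |(c * cexp (-(I * γ * u)) * (ρ * K u - K' u)).re| := by
        refine integral_mono (hi.const_mul c).re (hi2.const_mul m) fun u => ?_
        change (c * f u).re ≤ _
        by_cases hu : u ∈ Icc a b
        swap
        · simp [hf, h.eq_zero u hu, h.deriv_eq_zero u hu]
        have e2 : c * f u = ((B.Delta (Real.exp u) * Real.exp (-(ρ.re * u)) : ℝ) : ℂ) *
            (c * cexp (-(I * γ * u)) * (ρ * K u - K' u)) := by
          have : cexp (-(ρ * u)) = cexp (-(ρ.re * u)) * cexp (-(I * γ * u)) := by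
            rw [← Complex.exp_add]
            congr 1
            conv_lhs => rw [← re_add_im ρ, hγ]
            ring
          rw [hf]
          simp only
          rw [this]
          push_cast
          ring
        rw [e2, re_ofReal_mul]
        refine (le_abs_self _).trans ?_
        rw [abs_mul]
        gcongr
        rw [abs_mul, abs_of_pos (Real.exp_pos _)]
        calc _ ≤ m * Real.exp (ρ.re * u) * Real.exp (-(ρ.re * u)) := by gcongr; exact hΔ u hu
          _ = m := by rw [mul_assoc, ← Real.exp_add]; simp
    _ = m * ∫ u : ℝ, |(c * cexp (-(I * γ * u)) * (ρ * K u - K' u)).re| := integral_const_mul _ _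
    _ ≤ _ := by gcongr; exact h.osc ρ hρ c hc

theorem norm_sum_map_le {S : Multiset ℂ} {f : ℂ → ℂ} {e : ℝ} (h : ∀ ρ ∈ S, ‖f ρ‖ ≤ e) :
    ‖(S.map f).sum‖ ≤ Multiset.card S * e := by
  induction S using Multiset.induction_on with
  | empty => simp
  | cons ρ S ih =>
    rw [Multiset.map_cons, Multiset.sum_cons, Multiset.card_cons]
    push_cast
    have h1 := ih fun ρ' h' => h ρ' (Multiset.mem_cons_of_mem h')
    have h2 := h ρ (Multiset.mem_cons_self _ _)
    linarith [norm_add_le (f ρ) (S.map f).sum]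

open Classical in
/-- The smoothed `Δ` is, up to a small error, minus a power sum over the zeros in a box. -/
theorem AxiomA.norm_integral_add_sum_le (hA : B.AxiomA A κ θ) {Φ : ℂ → ℂ} {y γ : ℝ} (hy : 60 ≤ y)
    (hΦ : Differentiable ℂ Φ)
    (hΦl : ∀ z : ℂ, z.re ≤ 0 → ‖Φ z‖ ≤ Real.exp (14 * y * z.re))
    (hΦf : ∀ z : ℂ, |z.re| ≤ 2 → z ≠ 0 → ‖Φ z‖ ≤ Real.exp (44 * y) / ‖z‖ ^ ⌈y⌉₊)
    {ν : ℕ} (hν : 1 ≤ ν) {K K' : ℝ → ℝ}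
    (hK : IsOscKernel K K' (14 * y * ν) (22 * y * ν) y γ (fun z => Φ z ^ ν))
    {ρ₀ : ℂ} {d : ℝ} (hd : 0 < d) (hβ : ρ₀.re = θ + d) (hβ1 : ρ₀.re ≤ 1)
    {S : Multiset ℂ} {g : ℂ → ℂ} (hg : DifferentiableOn ℂ g {s | θ < s.re})
    (hfac : ∀ s, θ < s.re → B.zetaReg κ s = rootProd S s * g s) (hS : ∀ ρ ∈ S, ρ.re ≤ 1)
    {M : ℝ} (hM : 0 ≤ M) (hbox : ∀ s : ℂ, θ + d / 2 ≤ s.re → s.re ≤ 2 →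
      |s.im - ρ₀.im| ≤ Real.exp 60 → g s ≠ 0 ∧ ‖deriv g s / g s‖ ≤ M) :
    ‖(∫ u : ℝ, (B.Delta (Real.exp u) : ℂ) * (cexp (-(ρ₀ * u)) * (ρ₀ * K u - K' u))) +
      ((S.filter fun ρ => θ + d / 2 ≤ ρ.re ∧ |ρ.im - ρ₀.im| ≤ Real.exp 60).map
        (fun ρ => Φ (ρ - ρ₀) ^ ν)).sum‖ ≤
      Real.exp (-(7 * d * y)) * ((2 * Real.exp 60 + 5) * M + 2 * (1 + (4 * κ + 6 * A))
        + 3 * Multiset.card S) := by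
  set T := Real.exp 60 with hT
  have hT1 : 1 ≤ T := Real.one_le_exp (by norm_num)
  set c : ℝ := 2 - ρ₀.re with hc
  have hθ := hA.2.1
  have hA0 := hA.constant_nonneg
  have hκ := hA.1
  set e := Real.exp (-(7 * d * y)) with he
  have he0 : 0 < e := Real.exp_pos _
  have he2 : Real.exp (-(14 * y)) ≤ e := Real.exp_le_exp.2 (by nlinarith)
  have he1 : Real.exp (-(14 * y)) ≤ 1 := Real.exp_le_one_iff.2 (by linarith)
  -- All the bounds used are at most 1, so passing to the ν-th power preserves them uniformly in ν.
  have hpow : ∀ z : ℂ, ∀ r : ℝ, ‖Φ z‖ ≤ r → r ≤ 1 → ‖Φ z ^ ν‖ ≤ r := by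
    intro z r h1 h2
    rw [norm_pow]
    exact (pow_le_of_le_one (norm_nonneg _) (h1.trans h2) (by omega)).trans h1
  have hfar : ∀ z : ℂ, |z.re| ≤ 2 → T ≤ |z.im| →
      ‖Φ z ^ ν‖ ≤ Real.exp (-(14 * y)) / z.im ^ 2 := by
    intro z h1 h2
    refine hpow z _ (norm_le_exp_div_sq hy hΦf h1 h2) ?_
    have : 1 ≤ z.im ^ 2 := by rw [← sq_abs]; nlinarith
    exact (div_le_self (Real.exp_pos _).le this).trans he1
  have hleft : ∀ z : ℂ, z.re ≤ -(d / 2) → ‖Φ z ^ ν‖ ≤ e := by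
    intro z h1
    refine hpow z _ ((hΦl z (by linarith)).trans (Real.exp_le_exp.2 ?_)) (Real.exp_le_one_iff.2 ?_)
    · nlinarith
    · rw [neg_nonpos]; positivity
  have hi : Integrable fun t : ℝ => Φ (c + t * I) ^ ν := by
    refine integrable_of_le_one_div_sq ?_ hT1 fun t ht => ?_
    · have := hΦ.continuous
      fun_prop
    · refine (hfar (c + t * I) ?_ ?_).trans ?_
      · simp only [add_re, ofReal_re, mul_re, I_re, mul_zero, ofReal_im, I_im, mul_one, sub_self,
          add_zero]
        rw [abs_le]; constructor <;> linarith
      · simpa using ht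
      · simp only [add_im, ofReal_im, mul_im, ofReal_re, I_im, mul_one, I_re, mul_zero, add_zero,
          zero_add]
        gcongr
  obtain ⟨hintegrable, hform⟩ := hA.explicit_formula hK (by positivity) (show ρ₀.re + c = 2 by rw [hc]; ring)
    hi hg hfac hS
  -- The line moves from Re s = 2 to Re s = θ + d/2, which is d/2 left of ρ₀; there |Φ| ≤ e^(-7dy).
  have hline := norm_integral_line_le (Φ := fun z => Φ z ^ ν)
    (E := fun z => deriv g (ρ₀ + z) / g (ρ₀ + z)) (c := c) (δ := d / 2) (T := T) (e₁ := e)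
    (e₂ := Real.exp (-(14 * y))) (B₁ := M) (B₂ := 1 + (4 * κ + 6 * A) + Multiset.card S) hT1
    (by linarith) he0.le (Real.exp_pos _).le hM (by positivity) ?_ ?_ ?_ ?_ ?_ hintegrable
  rotate_left
  · intro z hz
    rw [mem_reProdIm] at hz
    obtain ⟨⟨h1, h2⟩, h3, h4⟩ := hz
    have hmem : θ < (ρ₀ + z).re := by rw [add_re]; linarith
    have hg0 := (hbox (ρ₀ + z) (by rw [add_re]; linarith) (by rw [add_re]; linarith)
      (by rw [add_im, add_sub_cancel_left, abs_le]; exact ⟨h3, h4⟩)).1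
    have hd1 : DifferentiableAt ℂ g (ρ₀ + z) :=
      hg.differentiableAt ((isOpen_halfPlane θ).mem_nhds hmem)
    have hd2 : DifferentiableAt ℂ (deriv g) (ρ₀ + z) :=
      (hg.deriv (isOpen_halfPlane θ)).differentiableAt ((isOpen_halfPlane θ).mem_nhds hmem)
    have hadd : DifferentiableAt ℂ (fun z => ρ₀ + z) z := by fun_prop
    exact (((hΦ z).pow ν).mul ((hd2.comp z hadd).div (hd1.comp z hadd) hg0)).differentiableWithinAt
  · intro z hz
    rw [mem_reProdIm] at hz
    obtain ⟨⟨h1, h2⟩, h3, h4⟩ := hz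
    exact (hbox (ρ₀ + z) (by rw [add_re]; linarith) (by rw [add_re]; linarith)
      (by rw [add_im, add_sub_cancel_left, abs_le]; exact ⟨h3, h4⟩)).2
  · intro t
    exact hA.norm_logDeriv_cofactor_le hg hfac hS (by simp [hc])
  · intro t
    exact hleft _ (by simp)
  · intro x hx t ht
    have := hfar (x + t * I) (by
      simp only [add_re, ofReal_re, mul_re, I_re, mul_zero, ofReal_im, I_im, mul_one, sub_self,
          add_zero]
      rw [abs_le]; constructor <;> linarith [hx.1, hx.2]) (by simpa using ht)
    simpa using this
  set p : ℂ → Prop := fun ρ => θ + d / 2 ≤ ρ.re ∧ |ρ.im - ρ₀.im| ≤ T with hp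
  -- A root outside the box is either at least d/2 to the left of ρ₀ or more than e^60 away
  -- vertically. Each case gives at most e^(-7dy).
  have hrest : ‖((S.filter (¬ p ·)).map (fun ρ => Φ (ρ - ρ₀) ^ ν)).sum‖ ≤ Multiset.card S * e := by
    refine (norm_sum_map_le (e := e) fun ρ hρ => ?_).trans ?_
    · obtain ⟨h1, h2⟩ := Multiset.mem_filter.1 hρ
      rcases lt_or_ge ρ.re (θ + d / 2) with h3 | h3
      · exact hleft _ (by rw [sub_re]; linarith)
      · have h4 : T < |ρ.im - ρ₀.im| := by
          by_contra! h5
          exact h2 ⟨h3, h5⟩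
        refine (hfar (ρ - ρ₀) ?_ (by rw [sub_im]; exact h4.le)).trans ?_
        · have := hS ρ h1
          rw [sub_re, abs_le]; constructor <;> linarith
        · refine (div_le_self (Real.exp_pos _).le ?_).trans he2
          rw [sub_im, ← sq_abs]; nlinarith
    · gcongr
      exact Multiset.filter_le _ _
  have hsplit : (S.map (fun ρ => Φ (ρ - ρ₀) ^ ν)).sum
      = ((S.filter p).map (fun ρ => Φ (ρ - ρ₀) ^ ν)).sum
        + ((S.filter (¬ p ·)).map (fun ρ => Φ (ρ - ρ₀) ^ ν)).sum := by
    rw [← Multiset.sum_add, ← Multiset.map_add, Multiset.filter_add_not]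
  rw [hsplit] at hform
  set J := ∫ u : ℝ, (B.Delta (Real.exp u) : ℂ) * (cexp (-(ρ₀ * u)) * (ρ₀ * K u - K' u)) with hJ
  set U := ((S.filter p).map (fun ρ => Φ (ρ - ρ₀) ^ ν)).sum with hU
  set V := ((S.filter (¬ p ·)).map (fun ρ => Φ (ρ - ρ₀) ^ ν)).sum with hV
  have hn : 2 * Real.pi * ‖J + (U + V)‖ ≤ 2 * T * (e * M) +
      2 * ((c + d / 2) * (Real.exp (-(14 * y)) * M)) +
      2 * (Real.exp (-(14 * y)) * (1 + (4 * κ + 6 * A) + Multiset.card S)) := by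
    refine le_trans (le_of_eq ?_) hline
    rw [← norm_neg (∫ t : ℝ, _), ← hform, norm_mul]
    congr 1
    rw [norm_mul, norm_real, Real.norm_of_nonneg Real.pi_pos.le]
    simp
  have hJUV : ‖J + (U + V)‖ ≤ 2 * T * (e * M) + 2 * ((5 / 2) * (e * M)) +
      2 * (e * (1 + (4 * κ + 6 * A) + Multiset.card S)) := by
    have h1 : ‖J + (U + V)‖ ≤ 2 * Real.pi * ‖J + (U + V)‖ :=
      le_mul_of_one_le_left (norm_nonneg _) (by linarith [Real.pi_gt_three])
    refine h1.trans (hn.trans ?_)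
    have : c + d / 2 ≤ 5 / 2 := by linarith
    gcongr
  have h2 := norm_sub_le (J + (U + V)) V
  rw [show J + (U + V) - V = J + U by ring] at h2
  calc _ ≤ _ := h2
    _ ≤ 2 * T * (e * M) + 2 * ((5 / 2) * (e * M)) +
      2 * (e * (1 + (4 * κ + 6 * A) + Multiset.card S)) + Multiset.card S * e :=
        add_le_add hJUV hrest
    _ = _ := by ring

end BeurlingSystem

/-! ### Oscillation in explicit intervals. -/

namespace BeurlingSystem

open MeasureTheory Set Complex Filter Topology Metric

/-- Let q = e^(-dy), so seven factors q are available, and (y/d)^8 = (dy)^8/d^16. The numerator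
costs one, as (dy)^8 ≤ 8!/q with 8! = 40320; q < d^5 makes d^(-16) cost four. Of the last two, one
beats the constant and one is below ε/8. -/
theorem exp_mul_pow_le {d y ε E : ℝ} (hd : 0 < d) (hd1 : d ≤ 1) (hy : 0 < y)
    (hε : Real.exp (-(d * y)) < ε / 8) (hd5 : Real.exp (-(d * y)) < d ^ 5)
    (hE : 1 ≤ E * 40320) (hyE : (E * 40320) ^ 2 ≤ y) :
    Real.exp (-(7 * d * y)) * ((y / d) ^ 8 * E) ≤ ε / 8 := by
  set x := d * y with hx
  have hx0 : 0 < x := by positivity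
  set q := Real.exp (-x) with hq
  have hq0 : 0 < q := Real.exp_pos _
  set C := E * 40320 with hC
  have hE0 : 0 < E := by linarith
  have h1 : x ^ 8 ≤ 40320 / q := by
    have := Real.pow_div_factorial_le_exp x hx0.le 8
    rw [show ((Nat.factorial 8 : ℕ) : ℝ) = 40320 by norm_num [Nat.factorial]] at this
    rw [hq, Real.exp_neg, div_inv_eq_mul]
    linarith [(div_le_iff₀ (by norm_num : (0 : ℝ) < 40320)).1 this]
  have h2 : q ^ 4 ≤ d ^ 16 := by
    calc q ^ 4 ≤ (d ^ 5) ^ 4 := by gcongr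
      _ = d ^ 16 * d ^ 4 := by ring
      _ ≤ d ^ 16 := mul_le_of_le_one_right (by positivity) (pow_le_one₀ hd.le hd1)
  have h3 : Real.exp (-(7 * d * y)) = q ^ 7 := by
    rw [hq, ← Real.exp_nat_mul]
    congr 1
    rw [hx]; push_cast; ring
  -- If d^5 ≤ 1/C then q < d^5 suffices. Otherwise d > 1/C, and y ≥ C² gives dy ≥ C.
  have h4 : q ≤ 1 / C := by
    rcases le_or_gt (d ^ 5) (1 / C) with h | h
    · exact hd5.le.trans h
    · have h5 : d ^ 5 ≤ d := pow_le_of_le_one hd.le hd1 (by norm_num)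
      have h6 : 1 < d * C := (div_lt_iff₀ (by linarith)).1 (h.trans_le h5)
      have h7 : C ≤ x := by
        have h8 : C * 1 ≤ C * (d * C) := by gcongr
        have h9 : d * C ^ 2 ≤ d * y := by gcongr
        rw [hx]
        linarith [show C * (d * C) = d * C ^ 2 by ring]
      rw [hq, Real.exp_neg, ← one_div]
      apply one_div_le_one_div_of_le (by linarith)
      linarith [Real.add_one_le_exp x]
  calc Real.exp (-(7 * d * y)) * ((y / d) ^ 8 * E) = q ^ 7 * (x ^ 8 / d ^ 16 * E) := by
        rw [h3, hx]
        congr 2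
        field_simp
    _ ≤ q ^ 7 * (40320 / q / q ^ 4 * E) := by gcongr
    _ = q * (q * C) := by rw [hC]; field_simp
    _ ≤ q * 1 := by
        gcongr
        rw [le_div_iff₀ (by linarith)] at h4
        exact h4
    _ ≤ _ := by linarith

/-- The product is (1 - 2ε/π)(1 + 15/(y²r²)). The bump's loss is at most ε/10 by the lower bound on
y, while the gain is at least 5ε/8. -/
theorem osc_constant_le {ε y γ r : ℝ} (hε : 0 < ε) (hε1 : ε < 0.1) (hy : 60 ≤ y) (hγ : 0 < γ)
    (hr : γ ≤ r) (h : 40 / (ε ^ 2 * γ ^ 4) < y) :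
    (Real.pi / 2 - ε) / r * (2 / Real.pi * (r + 15 / (y ^ 2 * r))) ≤ 1 - ε / 2 := by
  have hpi := Real.pi_pos
  have hpi3 := Real.pi_gt_three
  have hpi4 := Real.pi_lt_d2
  rw [div_lt_iff₀ (by positivity)] at h
  have hr0 : 0 < r := hγ.trans_le hr
  have h1 : 150 ≤ ε * y ^ 2 * γ ^ 2 := by
    refine le_of_sq_le_sq ?_ (by positivity)
    have h2 : (60 : ℝ) ^ 3 ≤ y ^ 3 := by gcongr
    have h3 : 40 * y ^ 3 ≤ y * (ε ^ 2 * γ ^ 4) * y ^ 3 := by gcongr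
    calc (150 : ℝ) ^ 2 ≤ 40 * 60 ^ 3 := by norm_num
      _ ≤ y * (ε ^ 2 * γ ^ 4) * y ^ 3 := by linarith
      _ = _ := by ring
  have h2 : 15 / (y ^ 2 * r ^ 2) ≤ ε / 10 := by
    rw [div_le_div_iff₀ (by positivity) (by norm_num)]
    have : ε * (y ^ 2 * γ ^ 2) ≤ ε * (y ^ 2 * r ^ 2) := by gcongr
    linarith
  have h3 : (Real.pi / 2 - ε) / r * (2 / Real.pi * (r + 15 / (y ^ 2 * r)))
      = (1 - 2 / Real.pi * ε) * (1 + 15 / (y ^ 2 * r ^ 2)) := by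
    field_simp
  have h4 : 5 / 8 ≤ 2 / Real.pi := by
    rw [div_le_div_iff₀ (by norm_num) hpi]; linarith
  have h5 : 5 / 8 * ε ≤ 2 / Real.pi * ε := by gcongr
  have h6 : 0 ≤ 15 / (y ^ 2 * r ^ 2) := by positivity
  rw [h3]
  nlinarith

open Classical in
/-- Oscillation of `Δ` in explicit intervals. -/
theorem exists_oscillation_interval (A κ θ : ℝ) :
    ∃ A₉ A₁₀ : ℝ, ∀ (G : Type u) [CommMonoid G] (B : BeurlingSystem G), B.AxiomA A κ θ →
      ∀ ρ₀ : ℂ, B.IsZetaZero θ ρ₀ → 0 < ρ₀.im →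
      ∀ ε : ℝ, 0 < ε → ε < 0.1 →
      ∀ Y : ℝ, 0 < Y →
        5 * Real.log (1 / (ρ₀.re - θ)) / (ρ₀.re - θ) < Real.log Y →
        Real.log (8 / ε) / (ρ₀.re - θ) < Real.log Y →
        40 / (ε ^ 2 * ρ₀.im ^ 4) < Real.log Y →
        Real.log ‖ρ₀‖ < Real.log Y →
        A₉ < Real.log Y →
        ∃ x ∈ Set.Icc Y (Y ^ (A₁₀ * (Real.log (ρ₀.im + 5) / (ρ₀.re - θ) ^ 2))),
          (Real.pi / 2 - ε) * (x ^ ρ₀.re / ‖ρ₀‖) < |B.Delta x| := by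
  by_cases hpos : 0 < κ ∧ 0 ≤ A
  swap
  · exact ⟨0, 0, fun G _ B hA => absurd ⟨hA.1, hA.constant_nonneg⟩ hpos⟩
  obtain ⟨hκ, hA0⟩ := hpos
  have hT1 : 1 ≤ Real.exp 60 := Real.one_le_exp (by norm_num)
  obtain ⟨C₁, hC₁, hrect⟩ := exists_rect_cofactor.{u} (θ := θ) hκ hA0 hT1
  obtain ⟨C₂, hC₂, hcount⟩ := exists_card_rect_le.{u} (θ := θ) hκ hA0 hT1
  set E := (2 * Real.exp 60 + 5) * C₁ + 2 * (1 + (4 * κ + 6 * A)) + 3 * C₁ with hE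
  have hE1 : 1 ≤ E := by
    have : 0 ≤ (2 * Real.exp 60 + 5) * C₁ := by positivity
    linarith
  -- The value 60 serves the decay estimate and the square absorbs the total error constant. The
  -- factor 44 = 22·2 combines the right end 22yν of the support with ν ≤ 2n.
  refine ⟨max 60 ((E * 40320) ^ 2), 44 * C₂, ?_⟩
  intro G _ B hA ρ₀ hρ₀ hγ ε hε hε1 Y hY h5 h8 h40 hlog hA9
  set y := Real.log Y with hy
  have hYy : Y = Real.exp y := (Real.exp_log hY).symm
  set d := ρ₀.re - θ with hd
  have hd0 : 0 < d := sub_pos.2 hρ₀.1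
  have hF0 := hA.zetaReg_eq_zero hρ₀
  have hβ1 := hA.re_le_one_of_zetaReg_eq_zero hF0
  have hθ := hA.2.1
  have hd1 : d ≤ 1 := by linarith
  have hy60 : 60 ≤ y := (le_max_left _ _).trans hA9.le
  have hyE : (E * 40320) ^ 2 ≤ y := (le_max_right _ _).trans hA9.le
  have hρ0 : ρ₀ ≠ 0 := fun h => by rw [h, zero_im] at hγ; exact lt_irrefl _ hγ
  have hnρ := norm_pos_iff.2 hρ0
  have hγn : ρ₀.im ≤ ‖ρ₀‖ := (le_abs_self _).trans (abs_im_le_norm _)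
  have hγy : |ρ₀.im| ≤ Real.exp y := by
    refine (abs_im_le_norm _).trans ?_
    rw [← Real.exp_log hnρ]
    exact Real.exp_le_exp.2 hlog.le
  have hqd : Real.exp (-(d * y)) < d ^ 5 := by
    rw [div_lt_iff₀ hd0, one_div, Real.log_inv] at h5
    rw [← Real.lt_log_iff_exp_lt (by positivity), Real.log_pow]
    push_cast
    linarith
  have hqε : Real.exp (-(d * y)) < ε / 8 := by
    rw [div_lt_iff₀ hd0, ← inv_div ε 8, Real.log_inv] at h8
    rw [← Real.lt_log_iff_exp_lt (by positivity)]
    linarith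
  -- The averaging window must fit inside width y; for small γ₀ this is ensured by the condition
  -- 40/(ε²γ₀⁴) < log Y.
  have hh : Real.pi / (2 * ρ₀.im) ≤ y := by
    rw [div_lt_iff₀ (by positivity)] at h40
    have h1 : 2 ^ 4 ≤ (ρ₀.im * y) ^ 4 := by
      have h2 : ε ^ 2 ≤ 1 := pow_le_one₀ hε.le (by linarith)
      have h3 : y * (ε ^ 2 * ρ₀.im ^ 4) ≤ y ^ 4 * (1 * ρ₀.im ^ 4) := by
        gcongr
        exact le_self_pow₀ (by linarith) (by norm_num)
      have : (ρ₀.im * y) ^ 4 = y ^ 4 * (1 * ρ₀.im ^ 4) := by ring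
      linarith
    have h2 : 2 ≤ ρ₀.im * y := le_of_pow_le_pow_left₀ (by norm_num) (by positivity) h1
    rw [div_le_iff₀ (by positivity)]
    linarith [Real.pi_lt_four]
  obtain ⟨Φ, hΦ, hΦ0, hΦl, hΦf, hker⟩ := exists_oscKernels (by linarith) hγ hh
  obtain ⟨S, g, hg, hfac, hSθ, hcard, hbox⟩ := hrect G B hA d ρ₀.im y hd0 (by linarith)
    (by linarith) hγy
  have hS1 : ∀ ρ ∈ S, ρ.re ≤ 1 := fun ρ hρ => hA.re_le_one_of_zetaReg_eq_zero (by
    rw [hfac ρ (hSθ ρ hρ), rootProd_eq_zero_iff.2 hρ, zero_mul])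
  set p : ℂ → Prop := fun ρ => θ + d / 2 ≤ ρ.re ∧ |ρ.im - ρ₀.im| ≤ Real.exp 60 with hp
  have hmem : ρ₀ ∈ S.filter p := by
    have hpρ : p ρ₀ := ⟨by linarith, by rw [sub_self, abs_zero]; exact (Real.exp_pos _).le⟩
    refine Multiset.mem_filter.2 ⟨?_, hpρ⟩
    rw [hfac ρ₀ hρ₀.1] at hF0
    exact rootProd_eq_zero_iff.1
      ((mul_eq_zero.1 hF0).resolve_right (hbox ρ₀ hpρ.1 (by linarith) hpρ.2).1)
  obtain ⟨g', hg', hfac'⟩ := exists_cofactor_filter hg hfac p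
  have hn := hcount G B hA d ρ₀.im hd0 (by linarith) hγ (S.filter p) g' hg' hfac' (fun ρ hρ => by
    obtain ⟨h1, h2, h3⟩ := Multiset.mem_filter.1 hρ
    exact ⟨h2, hS1 ρ h1, h3⟩)
  -- The root ρ₀ contributes Φ(0) = 1, as the power sum theorem requires.
  obtain ⟨ν, hν1, hν2, hν⟩ := exists_one_le_re_powerSum ((S.filter p).map fun ρ => Φ (ρ - ρ₀))
    (Multiset.mem_map.2 ⟨ρ₀, hmem, by rw [sub_self, hΦ0]⟩)
  rw [Multiset.map_map, Multiset.card_map] at *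
  obtain ⟨K, K', hK⟩ := hker ν hν1
  by_contra! hcon
  have hνA : 22 * (ν : ℝ) ≤ 44 * C₂ * (Real.log (ρ₀.im + 5) / d ^ 2) := by
    have h1 : (ν : ℝ) ≤ 2 * Multiset.card (S.filter p) := by
      have : ν ≤ 2 * Multiset.card (S.filter p) := by omega
      exact_mod_cast this
    linarith
  have hy0 : 0 < y := by linarith
  have hI := norm_integral_delta_weight_le (B := B) hK hρ0 rfl
    (m := (Real.pi / 2 - ε) / ‖ρ₀‖)
    (div_nonneg (by linarith [Real.pi_gt_three]) hnρ.le) (fun u hu => by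
      have hν1' : (1 : ℝ) ≤ ν := by exact_mod_cast hν1
      have h1 := hcon (Real.exp u) ⟨by
        rw [hYy]
        exact Real.exp_le_exp.2 (le_trans (by nlinarith) hu.1), by
        rw [hYy, ← Real.exp_mul]
        refine Real.exp_le_exp.2 (hu.2.trans ?_)
        calc 22 * y * ν = y * (22 * ν) := by ring
          _ ≤ _ := by gcongr⟩
      rw [← Real.exp_mul, mul_comm u] at h1
      calc _ ≤ _ := h1
        _ = _ := by ring)
  have hI' := hI.trans (osc_constant_le hε hε1 hy60 hγ hγn h40)
  have hsum := hA.norm_integral_add_sum_le hy60 hΦ hΦl hΦf hν1 hK hd0 (by linarith) hβ1 hg hfac hS1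
    (M := C₁ * (y / d) ^ 8) (by positivity) hbox
  have hQ1 : 1 ≤ y / d := by rw [le_div_iff₀ hd0]; linarith
  have herr : Real.exp (-(7 * d * y)) * ((2 * Real.exp 60 + 5) * (C₁ * (y / d) ^ 8)
      + 2 * (1 + (4 * κ + 6 * A)) + 3 * Multiset.card S) ≤ ε / 8 := by
    refine le_trans ?_ (exp_mul_pow_le (E := E) hd0 hd1 hy0 hqε hqd (by linarith) hyE)
    gcongr
    have h1 : (y / d) ^ 3 ≤ (y / d) ^ 8 := pow_le_pow_right₀ hQ1 (by norm_num)
    have h2 : 1 ≤ (y / d) ^ 8 := one_le_pow₀ hQ1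
    have h3 : C₁ * (y / d) ^ 3 ≤ C₁ * (y / d) ^ 8 := by gcongr
    have h4 : 2 * (1 + (4 * κ + 6 * A)) * 1 ≤ 2 * (1 + (4 * κ + 6 * A)) * (y / d) ^ 8 := by gcongr
    rw [hE]
    linarith
  have hfin := hsum.trans herr
  set J := ∫ u : ℝ, (B.Delta (Real.exp u) : ℂ) * (cexp (-(ρ₀ * u)) * (ρ₀ * K u - K' u))
  set U := ((S.filter p).map (fun ρ => Φ (ρ - ρ₀) ^ ν)).sum
  -- The contradiction is 1 ≤ |U| ≤ |J + U| + |J| ≤ ε/8 + (1 - ε/2).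
  have h1 : 1 ≤ ‖U‖ := hν.trans (re_le_norm _)
  have h2 := norm_sub_le (J + U) J
  rw [add_sub_cancel_left] at h2
  linarith

end BeurlingSystem

/-! ### Arbitrarily large x: the Mellin transform of Δ near a zero. -/

section TailMellinAdd

open MeasureTheory Set Complex

theorem tailMellin_add {r₁ r₂ : ℝ → ℝ} {C₁ C₂ τ₁ τ₂ : ℝ} {s : ℂ} (h₁ : Measurable r₁)
    (hb₁ : ∀ x, 1 < x → |r₁ x| ≤ C₁ * x ^ τ₁) (hs₁ : τ₁ < s.re) (h₂ : Measurable r₂)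
    (hb₂ : ∀ x, 1 < x → |r₂ x| ≤ C₂ * x ^ τ₂) (hs₂ : τ₂ < s.re) :
    tailMellin (fun x => r₁ x + r₂ x) s = tailMellin r₁ s + tailMellin r₂ s := by
  rw [tailMellin, tailMellin, tailMellin, ← integral_add (integrableOn_tailMellin h₁ hb₁ hs₁)
    (integrableOn_tailMellin h₂ hb₂ hs₂)]
  refine integral_congr_ae (Filter.Eventually.of_forall fun x => ?_)
  simp only
  push_cast
  ring

theorem tailMellin_id {s : ℂ} (hs : 1 < s.re) : tailMellin (fun x => x) s = 1 / (s - 1) := by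
  have e : EqOn (fun x : ℝ => (x : ℂ) * (x : ℂ) ^ (-s - 1)) (fun x : ℝ => (x : ℂ) ^ (-s))
      (Ioi 1) := by
    intro x hx
    have hx0 : (x : ℂ) ≠ 0 := by exact_mod_cast (one_pos.trans (mem_Ioi.1 hx)).ne'
    dsimp only
    rw [cpow_sub _ _ hx0, cpow_one]
    field_simp
  rw [tailMellin, setIntegral_congr_fun measurableSet_Ioi e,
    integral_Ioi_cpow_of_lt (by simpa using hs) one_pos, ofReal_one, one_cpow,
    ← neg_div_neg_eq, neg_neg]
  congr 1
  ring

end TailMellinAdd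

namespace BeurlingSystem

open MeasureTheory Set Complex Filter Topology

variable {G : Type u} [CommMonoid G] {B : BeurlingSystem G} {A κ θ : ℝ}

theorem monotone_psi : Monotone B.psi := monotone_summatory B.vonMangoldt_nonneg

theorem psi_nonneg (x : ℝ) : 0 ≤ B.psi x := Finset.sum_nonneg fun g _ => B.vonMangoldt_nonneg g

theorem measurable_Delta : Measurable B.Delta := monotone_psi.measurable.sub measurable_id

theorem abs_Delta_le {x x₀ : ℝ} (hx : 0 ≤ x) (h : x ≤ x₀) : |B.Delta x| ≤ B.psi x₀ + x₀ := by
  have h1 := monotone_psi (B := B) h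
  have h2 := psi_nonneg (B := B) x
  rw [Delta, abs_le]
  constructor <;> linarith

/-- If `Δ(x) = O(x ^ β)`, then the logarithmic derivative of zeta continues to `Re s > β`. -/
theorem AxiomA.deriv_zetaReg_of_bound (hA : B.AxiomA A κ θ) {C β : ℝ} (hβ : θ ≤ β) (hβ1 : β ≤ 1)
    (hb : ∀ x, 1 < x → |B.Delta x| ≤ C * x ^ β) {s : ℂ} (hs : β < s.re) :
    deriv (B.zetaReg κ) s = -(B.zetaReg κ s * (1 + s * tailMellin B.Delta s)) := by
  have hopen := isOpen_halfPlane β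
  have hF := hA.differentiableOn_zetaReg
  have hsub : {s : ℂ | β < s.re} ⊆ {s : ℂ | θ < s.re} := fun z hz => hβ.trans_lt hz
  have hD : DifferentiableOn ℂ (tailMellin B.Delta) {s : ℂ | β < s.re} := fun z hz =>
    (differentiableAt_tailMellin measurable_Delta hb hz).differentiableWithinAt
  have hl : AnalyticOnNhd ℂ (deriv (B.zetaReg κ)) {s : ℂ | β < s.re} :=
    ((hF.deriv (isOpen_halfPlane θ)).mono hsub).analyticOnNhd hopen
  have hr : AnalyticOnNhd ℂ (fun s => -(B.zetaReg κ s * (1 + s * tailMellin B.Delta s)))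
      {s : ℂ | β < s.re} := by
    refine DifferentiableOn.analyticOnNhd ?_ hopen
    exact ((hF.mono hsub).mul ((differentiableOn_const 1).add (differentiableOn_id.mul hD))).neg
  have h2 : (2 : ℂ) ∈ {s : ℂ | β < s.re} := by
    rw [mem_ofPred_eq, re_ofNat]; linarith
  refine hl.eqOn_of_preconnected_of_eventuallyEq hr (convex_halfSpace_re_gt β).isPreconnected h2
    ?_ hs
  filter_upwards [(isOpen_halfPlane 1).mem_nhds (show (2 : ℂ) ∈ {s : ℂ | 1 < s.re} by
    rw [mem_ofPred_eq, re_ofNat]; norm_num)] with z hz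
  have hz' : 1 < z.re := hz
  have hpsi : tailMellin B.psi z = tailMellin B.Delta z + 1 / (z - 1) := by
    rw [← tailMellin_id hz', ← tailMellin_add measurable_Delta hb (by linarith) measurable_id'
      (C₂ := 1) (τ₂ := 1) (fun x hx => ?_) hz']
    · congr 1
      ext x
      simp [Delta]
    · rw [Real.rpow_one, one_mul, abs_of_pos (by linarith)]
  have hz1 : z - 1 ≠ 0 := fun h => by
    have := congrArg re h
    simp at this; linarith
  rw [hA.deriv_zetaReg hz', hA.mangoldtSum_eq hz', hpsi]
  field_simp
  ring

/-- A zero `ρ` forces `Δ(x)` to be at least `(1 - ε) x ^ β / |ρ|` for arbitrarily large `x`. -/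
theorem AxiomA.frequently_one_sub_le (hA : B.AxiomA A κ θ) {ρ : ℂ} (hρ : B.IsZetaZero θ ρ) {ε : ℝ}
    (hε : 0 < ε) : ∃ᶠ x : ℝ in atTop, (1 - ε) * (x ^ ρ.re / ‖ρ‖) ≤ |B.Delta x| := by
  intro hcon
  simp only [not_le] at hcon
  have hθ := hA.2.1
  set β := ρ.re with hβ
  have hθβ : θ < β := hρ.1
  have hF0 := hA.zetaReg_eq_zero hρ
  have hβ1 : β ≤ 1 := hA.re_le_one_of_zetaReg_eq_zero hF0
  have hρ0 : ρ ≠ 0 := fun h => by rw [hβ, h, zero_re] at hθβ; linarith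
  have hnρ := norm_pos_iff.2 hρ0
  set m := (1 - ε) / ‖ρ‖ with hm
  obtain ⟨x₀, hx₀⟩ := eventually_atTop.1 (hcon.and (eventually_gt_atTop 1))
  have hx1 : 1 < x₀ := (hx₀ x₀ le_rfl).2
  have hlt : ∀ x, x₀ ≤ x → |B.Delta x| ≤ m * x ^ β := fun x hx => by
    refine (hx₀ x hx).1.le.trans (le_of_eq ?_)
    rw [hm]; ring
  have hm0 : 0 ≤ m := by
    have h1 := (abs_nonneg _).trans (hlt x₀ le_rfl)
    have h2 : 0 < x₀ ^ β := by positivity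
    exact nonneg_of_mul_nonneg_left h1 h2
  set C := B.psi x₀ + x₀ with hC
  have hC0 : 0 ≤ C := by have := psi_nonneg (B := B) x₀; linarith
  -- The part beyond x₀ carries the sharp constant m and contributes at most m/η at ρ+η. The part
  -- below x₀ is bounded, so its transform stays bounded as η → 0.
  set r₁ : ℝ → ℝ := (Ici x₀).indicator B.Delta with hr₁
  set r₂ : ℝ → ℝ := (Iio x₀).indicator B.Delta with hr₂
  have m₁ : Measurable r₁ := measurable_Delta.indicator measurableSet_Ici
  have m₂ : Measurable r₂ := measurable_Delta.indicator measurableSet_Iio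
  have b₁ : ∀ x, 1 < x → |r₁ x| ≤ m * x ^ β := by
    intro x hx
    by_cases h : x ∈ Ici x₀
    · rw [hr₁, indicator_of_mem h]; exact hlt x h
    · rw [hr₁, indicator_of_notMem h, abs_zero]; positivity
  have b₂ : ∀ x, 1 < x → |r₂ x| ≤ C * x ^ (0 : ℝ) := by
    intro x hx
    rw [Real.rpow_zero, mul_one]
    by_cases h : x ∈ Iio x₀
    · rw [hr₂, indicator_of_mem h]; exact abs_Delta_le (by linarith) (mem_Iio.1 h).le
    · rw [hr₂, indicator_of_notMem h, abs_zero]; exact hC0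
  have hsum : (fun x => r₁ x + r₂ x) = B.Delta := by
    have h := indicator_self_add_compl (Ici x₀) B.Delta
    rw [compl_Ici] at h
    exact h
  have hb : ∀ x, 1 < x → |B.Delta x| ≤ (m + C) * x ^ β := by
    intro x hx
    rw [← hsum]
    refine (abs_add_le _ _).trans ?_
    have h1 := b₁ x hx
    have h2 := b₂ x hx
    have h3 : C * 1 ≤ C * x ^ β := by
      gcongr
      exact Real.one_le_rpow hx.le (by linarith)
    rw [Real.rpow_zero] at h2
    linarith
  have hD : ∀ η : ℝ, 0 < η → η * ‖tailMellin B.Delta (ρ + η)‖ ≤ m + η * (C / β) := by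
    intro η hη
    have hre : (ρ + η : ℂ).re = β + η := by simp [hβ]
    have e := tailMellin_add (s := ρ + η) m₁ b₁ (by linarith) m₂ b₂ (by linarith)
    rw [hsum] at e
    have h1 := norm_tailMellin_le (s := ρ + η) b₁ (by linarith)
    have h2 := norm_tailMellin_le (s := ρ + η) b₂ (by linarith)
    rw [hre, add_sub_cancel_left] at h1
    rw [hre, sub_zero] at h2
    have h3 : C / (β + η) ≤ C / β := div_le_div_of_nonneg_left hC0 (by linarith) (by linarith)
    rw [e]
    calc η * ‖tailMellin r₁ (ρ + η) + tailMellin r₂ (ρ + η)‖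
        ≤ η * (m / η + C / β) := by
          gcongr
          exact (norm_add_le _ _).trans (add_le_add h1 (h2.trans h3))
      _ = _ := by field_simp
  have hFd := hA.differentiableOn_zetaReg
  have hFan : AnalyticOnNhd ℂ (B.zetaReg κ) {s | θ < s.re} :=
    hFd.analyticOnNhd (isOpen_halfPlane θ)
  have hnz : ¬ ∀ᶠ z in 𝓝 ρ, B.zetaReg κ z = 0 := by
    intro h
    have := hFan.eqOn_zero_of_preconnected_of_eventuallyEq_zero
      (convex_halfSpace_re_gt θ).isPreconnected hρ.1 h
    exact hA.zetaReg_ne_zero (s := 2) (by norm_num) (this (by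
      rw [mem_ofPred_eq, re_ofNat]; linarith))
  -- Factor out the full order n = k+1 ≥ 1 of the zero. The logarithmic derivative at ρ+η is then
  -- (k+1)/η + h'/h.
  obtain ⟨n, h, han, h0, heq⟩ :=
    ((hFan ρ hρ.1).exists_eventuallyEq_pow_smul_nonzero_iff).2 hnz
  have hn : n ≠ 0 := by
    rintro rfl
    have := heq.self_of_nhds
    rw [hF0, pow_zero, one_smul] at this
    exact h0 this.symm
  obtain ⟨k, rfl⟩ := Nat.exists_eq_succ_of_ne_zero hn
  have hnear : ∀ᶠ z in 𝓝 ρ, B.zetaReg κ z = (z - ρ) ^ (k + 1) * h z ∧ h z ≠ 0 ∧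
      deriv (B.zetaReg κ) z
        = (k + 1) * (z - ρ) ^ k * h z + (z - ρ) ^ (k + 1) * deriv h z := by
    filter_upwards [heq.eventually_nhds, han.eventually_analyticAt,
      han.continuousAt.eventually_ne h0] with z h1 h2 h3
    refine ⟨h1.self_of_nhds, h3, ?_⟩
    have h4 : B.zetaReg κ =ᶠ[𝓝 z] fun z => (z - ρ) ^ (k + 1) * h z := h1
    rw [h4.deriv_eq]
    have h5 : HasDerivAt (fun z => (z - ρ) ^ (k + 1)) ((k + 1) * (z - ρ) ^ k) z := by
      have := ((hasDerivAt_id z).sub_const ρ).fun_pow (k + 1)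
      simpa using this
    exact (h5.mul h2.differentiableAt.hasDerivAt).deriv
  have hpath : Tendsto (fun η : ℝ => ρ + (η : ℂ)) (𝓝[>] 0) (𝓝 ρ) := by
    have : Tendsto (fun η : ℝ => ρ + (η : ℂ)) (𝓝 0) (𝓝 (ρ + ((0 : ℝ) : ℂ))) :=
      (by fun_prop : Continuous fun η : ℝ => ρ + (η : ℂ)).tendsto 0
    rw [ofReal_zero, add_zero] at this
    exact this.mono_left nhdsWithin_le_nhds
  -- After multiplication by η, letting η → 0 gives k+1 ≤ |ρ|m = 1-ε, which is impossible.
  have hev : ∀ᶠ η : ℝ in 𝓝[>] 0, (k + 1 : ℝ) ≤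
      η + ‖ρ + η‖ * (m + η * (C / β)) + η * ‖deriv h (ρ + η) / h (ρ + η)‖ := by
    filter_upwards [hpath.eventually hnear, self_mem_nhdsWithin] with η h1 hη
    have hη0 : 0 < η := hη
    obtain ⟨e1, e2, e3⟩ := h1
    rw [hA.deriv_zetaReg_of_bound hθβ.le hβ1 hb (by simpa [hβ] using hη0), e1,
      add_sub_cancel_left] at e3
    have hηc : (η : ℂ) ≠ 0 := by exact_mod_cast hη0.ne'
    have e4 : ((k + 1 : ℝ) : ℂ) = -(η + (ρ + η) * (η * tailMellin B.Delta (ρ + η))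
        + η * (deriv h (ρ + η) / h (ρ + η))) := by
      have e5 : (η : ℂ) ^ k * h (ρ + η) * (k + 1) = (η : ℂ) ^ k * h (ρ + η) *
          -(η + (ρ + η) * (η * tailMellin B.Delta (ρ + η))
            + η * (deriv h (ρ + η) / h (ρ + η))) := by
        have : h (ρ + η) * (deriv h (ρ + η) / h (ρ + η)) = deriv h (ρ + η) := by
          field_simp
        linear_combination -e3 + (η : ℂ) ^ (k + 1) * this
      have := mul_left_cancel₀ (mul_ne_zero (pow_ne_zero k hηc) e2) e5
      push_cast
      exact this
    have e6 := congrArg (‖·‖) e4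
    rw [norm_real, Real.norm_of_nonneg (by positivity), norm_neg] at e6
    rw [e6]
    refine (norm_add₃_le).trans ?_
    rw [norm_mul, norm_mul, norm_mul, norm_real, Real.norm_of_nonneg hη0.le]
    gcongr
    exact hD η hη0
  have hlim : Tendsto (fun η : ℝ => η + ‖ρ + η‖ * (m + η * (C / β)) +
      η * ‖deriv h (ρ + η) / h (ρ + η)‖) (𝓝[>] 0)
      (𝓝 (0 + ‖ρ‖ * (m + 0 * (C / β)) + 0 * ‖deriv h ρ / h ρ‖)) := by
    have t0 : Tendsto (fun η : ℝ => η) (𝓝[>] 0) (𝓝 0) := tendsto_id.mono_left nhdsWithin_le_nhds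
    have t1 := (han.deriv.continuousAt.tendsto.comp hpath).div
      (han.continuousAt.tendsto.comp hpath) h0
    exact (t0.add (hpath.norm.mul ((t0.mul_const _).const_add m))).add (t0.mul t1.norm)
  have hfin := ge_of_tendsto hlim hev
  have hmρ : ‖ρ‖ * m = 1 - ε := by rw [hm]; field_simp
  have hk : (0 : ℝ) ≤ k := Nat.cast_nonneg k
  linarith

-- The Dirichlet coefficients and the norms are real, so conjugating Z on both sides gives another
-- continuation of the same series.
open ComplexConjugate in
theorem IsZetaZero.conj {ρ : ℂ} (h : B.IsZetaZero θ ρ) : B.IsZetaZero θ (conj ρ) := by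
  obtain ⟨h1, h2, Z, ⟨hZ, hZs⟩, h0⟩ := h
  refine ⟨by rwa [conj_re], fun h => h2 (by simpa using congrArg conj h), conj ∘ Z ∘ conj,
    ⟨fun s hs => ?_, fun s hs => ?_⟩, by simp [h0]⟩
  · have hopen : IsOpen {s : ℂ | θ < s.re ∧ s ≠ 1} := (isOpen_halfPlane θ).inter isOpen_ne
    have hs' : conj s ∈ {s : ℂ | θ < s.re ∧ s ≠ 1} :=
      ⟨by rw [conj_re]; exact hs.1, fun h => hs.2 (by simpa using congrArg conj h)⟩
    have := (hZ.differentiableAt (hopen.mem_nhds hs')).conj_conj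
    rw [conj_conj] at this
    exact this.differentiableWithinAt
  · simp only [Function.comp_apply]
    rw [hZs _ (by rwa [conj_re]), conj_tsum]
    refine tsum_congr fun g => ?_
    have harg : (B.norm g : ℂ).arg ≠ Real.pi := by
      rw [arg_ofReal_of_nonneg (B.norm_pos g).le]
      exact Real.pi_ne_zero.symm
    rw [← map_neg, cpow_conj _ _ harg, conj_conj, conj_ofReal]

/-- For a non-real zero the constant can be improved to `π / 2 - ε`. -/
theorem AxiomA.frequently_pi_div_two_sub_le (hA : B.AxiomA A κ θ) {ρ : ℂ} (hρ : B.IsZetaZero θ ρ)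
    (him : ρ.im ≠ 0) {ε : ℝ} (hε : 0 < ε) :
    ∃ᶠ x : ℝ in atTop, (Real.pi / 2 - ε) * (x ^ ρ.re / ‖ρ‖) ≤ |B.Delta x| := by
  wlog hpos : 0 < ρ.im generalizing ρ
  · have := this hρ.conj (by simpa using him) (by
      rw [conj_im]
      exact neg_pos.2 (lt_of_le_of_ne (not_lt.1 hpos) him))
    simpa using this
  obtain ⟨A₉, A₁₀, h⟩ := exists_oscillation_interval.{u} A κ θ
  rw [frequently_atTop]
  intro a
  -- The interval result needs ε < 0.1, and a smaller ε gives a stronger conclusion.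
  set ε' := min ε 0.05 with hε'
  have hε'0 : 0 < ε' := lt_min hε (by norm_num)
  have hlog := Real.tendsto_log_atTop
  obtain ⟨Y, h1, h2, h3, h4, h5, h6, h7⟩ := ((hlog.eventually_gt_atTop
    (5 * Real.log (1 / (ρ.re - θ)) / (ρ.re - θ))).and ((hlog.eventually_gt_atTop
    (Real.log (8 / ε') / (ρ.re - θ))).and ((hlog.eventually_gt_atTop
    (40 / (ε' ^ 2 * ρ.im ^ 4))).and ((hlog.eventually_gt_atTop (Real.log ‖ρ‖)).and
    ((hlog.eventually_gt_atTop A₉).and ((eventually_gt_atTop 0).and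
      (eventually_ge_atTop a))))))).exists
  obtain ⟨x, hx, hx'⟩ := h G B hA ρ hρ hpos ε' hε'0
    (lt_of_le_of_lt (min_le_right _ _) (by norm_num)) Y h6 h1 h2 h3 h4 h5
  refine ⟨x, h7.trans hx.1, le_trans ?_ hx'.le⟩
  have hx0 : 0 < x := h6.trans_le hx.1
  gcongr
  exact min_le_left _ _

end BeurlingSystem

theorem theorem1p2 (A κ θ : ℝ) :
    (∀ (G : Type u) [CommMonoid G] (B : BeurlingSystem G), B.AxiomA A κ θ →
      ∀ ρ₀ : ℂ, B.IsZetaZero θ ρ₀ → ∀ ε : ℝ, 0 < ε →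
        (∃ᶠ x : ℝ in Filter.atTop, (1 - ε) * (x ^ ρ₀.re / ‖ρ₀‖) ≤ |B.Delta x|) ∧
        (ρ₀.im ≠ 0 → ∃ᶠ x : ℝ in Filter.atTop,
          (Real.pi / 2 - ε) * (x ^ ρ₀.re / ‖ρ₀‖) ≤ |B.Delta x|)) ∧
    (∃ A₉ A₁₀ : ℝ, ∀ (G : Type u) [CommMonoid G] (B : BeurlingSystem G), B.AxiomA A κ θ →
      ∀ ρ₀ : ℂ, B.IsZetaZero θ ρ₀ → 0 < ρ₀.im →
      ∀ ε : ℝ, 0 < ε → ε < 0.1 →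
      ∀ Y : ℝ, 0 < Y →
        5 * Real.log (1 / (ρ₀.re - θ)) / (ρ₀.re - θ) < Real.log Y →
        Real.log (8 / ε) / (ρ₀.re - θ) < Real.log Y →
        40 / (ε ^ 2 * ρ₀.im ^ 4) < Real.log Y →
        Real.log ‖ρ₀‖ < Real.log Y →
        A₉ < Real.log Y →
        ∃ x ∈ Set.Icc Y (Y ^ (A₁₀ * (Real.log (ρ₀.im + 5) / (ρ₀.re - θ) ^ 2))),
          (Real.pi / 2 - ε) * (x ^ ρ₀.re / ‖ρ₀‖) < |B.Delta x|) :=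
  ⟨fun _ _ _ hA _ hρ _ hε => ⟨hA.frequently_one_sub_le hρ hε,
    fun him => hA.frequently_pi_div_two_sub_le hρ him hε⟩,
    BeurlingSystem.exists_oscillation_interval A κ θ⟩
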